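/- Let $d\ge 1$ and $K\ge 2$ be integers, and let $c_0,c_1,c_2>0$ be constants with $c_1\ge 5c_0$ and $c_1/8-c_2/2\ge 1$. Define $$\overline\alpha_0=1,\qquad \overline\alpha_1=1-\frac1{K^{c_0}},\qquad \overline\alpha_k=\overline\alpha_{k-1}-\frac{c_1\log K}{K}\,\overline\alpha_{k-1}(1-\overline\alpha_{k-1})\quad(2\le k\le K),$$ and $\alpha_k=\overline\alpha_k/\overline\alpha_{k-1}$ for $1\le k\le K$. Let $p^\star$ be a probability distribution on $\mathbb R^d$, let $\tau\ge 0$, and let the forward process be $X_0\sim p_0^\star=p^\star*\mathcal N(0,\tau I_d)$, $X_k=\sqrt{\alpha_k}\,X_{k-1}+\sqrt{1-\alpha_k}\,W_k$ for $1\le k\le K$, where $W_1,\dots,W_K$ are i.i.d. $\mathcal N(0,I_d)$ and independent of $X_0$. Let $p_{X_k}$ be the (continuous) density of $X_k$ and $s_{X_k}=\nabla\log p_{X_k}$ its score. Let $\widehat s_{X_1},\dots,\widehat s_{X_K}:\mathbb R^d\to\mathbb R^d$ be any score estimators built from training data $X^{(1)},\dots,X^{(n)}$ drawn i.i.d. from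 $p^\star$ and independent of the forward process. Given the training data, the sampler starts from $Y_K\sim\mathcal N(0,I_d)$ and sets $$Y_{k-1}=\frac1{\sqrt{\alpha_k}}\Big(Y_k+\frac{1-\alpha_k}{2}\,\widehat s_{X_k}(Y_k)\Big),\qquad k=K,\dots,2;$$ $p_{Y_1}$ denotes the law of $Y_1$ given the training data. Write $J_f$ for the Jacobian matrix of $f$, $\|\cdot\|$ for the spectral norm, and put $$\varepsilon_{\mathsf{sc}}=\sqrt{\frac1K\sum_{k=1}^K(1-\overline\alpha_k)\,\mathbb E\big[\|\widehat s_{X_k}(X_k)-s_{X_k}(X_k)\|_2^2\big]},\qquad \varepsilon_{\mathsf{jcb}}=\frac1K\sum_{k=1}^K(1-\overline\alpha_k)\,\mathbb E\big[\|J_{\widehat s_{X_k}}(X_k)-J_{s_{X_k}}(X_k)\|\big],$$ where the expectations are over both the training data and $X_k$. There are constants $C_0,C>0$ depending only on $c_0,c_1,c_2$ such that the following holds. Suppose that $K\ge C_0\,d^2(\log K)^5$ and $\mathbb E[\|X_0\|_2^2]\le K^{c_2}$, and that (almost surely with respect to the training data) each $\widehat s_{X_k}$, $1\le k\le K$, is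 differentiable on $\mathbb R^d$ and satisfies $J_{\widehat s_{X_k}}(x)+(1-\overline\alpha_k)^{-1}I_d\succeq 0$ for all $x\in\mathbb R^d$ (in the sense that $v^\top(J_{\widehat s_{X_k}}(x)+(1-\overline\alpha_k)^{-1}I_d)v\ge 0$ for all $v\in\mathbb R^d$). Then $$\mathbb E\big[\mathsf{TV}(p_{X_1},p_{Y_1})\big]\le C\Big(\frac{d(\log K)^4}{K}+\varepsilon_{\mathsf{sc}}\sqrt d\,(\log K)^{3/2}+\varepsilon_{\mathsf{jcb}}\,d\log K\Big),$$ where the expectation is over the training data and $\mathsf{TV}$ is the total variation distance. -/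

import Mathlib

open MeasureTheory ProbabilityTheory
open scoped ENNReal

noncomputable section

namespace ProbFlow

/-- `ℝ^d` with the Euclidean norm. -/
abbrev Vec (d : ℕ) : Type := EuclideanSpace ℝ (Fin d)

/-! ### Learning rates -/

/-- Cumulative noise parameters `ᾱ_k`: `ᾱ_0 = 1`, `ᾱ_1 = 1 - K^{-c₀}` and
`ᾱ_k = ᾱ_{k-1} - (c₁ log K / K) ᾱ_{k-1} (1 - ᾱ_{k-1})` for `k ≥ 2`. -/
def alphaBar (c₀ c₁ : ℝ) (K : ℕ) : ℕ → ℝ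
  | 0 => 1
  | 1 => 1 - 1 / (K : ℝ) ^ c₀
  | k + 2 => alphaBar c₀ c₁ K (k + 1) -
      c₁ * Real.log K / K * alphaBar c₀ c₁ K (k + 1) * (1 - alphaBar c₀ c₁ K (k + 1))

/-- Learning rates `α_k`, `k ≥ 1`, determined by `ᾱ_k = ∏_{i ≤ k} α_i`. -/
def alpha (c₀ c₁ : ℝ) (K k : ℕ) : ℝ :=
  alphaBar c₀ c₁ K k / alphaBar c₀ c₁ K (k - 1)

/-! ### Forward process -/

/-- The initial law `p⋆ ∗ N(0, τ I_d)`. -/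
def smoothed {d : ℕ} (pstar : Measure (Vec d)) (τ : ℝ) : Measure (Vec d) :=
  pstar ∗ (stdGaussian (Vec d)).map (fun w => √τ • w)

/-- The law of `X_k`, where `X_0 ∼ p0` and `X_k = √α_k X_{k-1} + √(1 - α_k) W_k` with
`W_k ∼ N(0, I_d)` independent of `X_{k-1}`. -/
def forwardLaw {d : ℕ} (α : ℕ → ℝ) (p0 : Measure (Vec d)) : ℕ → Measure (Vec d)
  | 0 => p0
  | k + 1 => ((forwardLaw α p0 k).prod (stdGaussian (Vec d))).map
      (fun q => √(α (k + 1)) • q.1 + √(1 - α (k + 1)) • q.2)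

/-! ### Densities and scores -/

/-- `p` is a continuous probability density function (with respect to Lebesgue measure) of `μ`. -/
def IsContDensity {d : ℕ} (μ : Measure (Vec d)) (p : Vec d → ℝ) : Prop :=
  Continuous p ∧ (∀ x, 0 ≤ p x) ∧ μ = volume.withDensity (fun x => ENNReal.ofReal (p x))

/-- A continuous density is unique as a function (not only almost everywhere). -/
theorem IsContDensity.unique {d : ℕ} {μ : Measure (Vec d)} {p q : Vec d → ℝ}
    [IsFiniteMeasure μ] (hp : IsContDensity μ p) (hq : IsContDensity μ q) : p = q := by
  have hpm : Measurable fun x => ENNReal.ofReal (p x) := hp.1.measurable.ennreal_ofReal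
  have hqm : Measurable fun x => ENNReal.ofReal (q x) := hq.1.measurable.ennreal_ofReal
  have hfin : ∫⁻ x, ENNReal.ofReal (p x) ≠ ∞ := by
    have h := measure_ne_top μ Set.univ
    rw [hp.2.2, withDensity_apply _ MeasurableSet.univ, Measure.restrict_univ] at h
    exact h
  have hae := (withDensity_eq_iff hpm.aemeasurable hqm.aemeasurable hfin).1
    (hp.2.2.symm.trans hq.2.2)
  have hae' : p =ᵐ[volume] q := by
    filter_upwards [hae] with x hx
    exact (ENNReal.ofReal_eq_ofReal_iff (hp.2.1 x) (hq.2.1 x)).1 hx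
  exact Continuous.ae_eq_iff_eq volume hp.1 hq.1 |>.1 hae'

open Classical in
/-- The continuous density `p_X` of the law `μ` of `X` (and `0` if `μ` has none). -/
def density {d : ℕ} (μ : Measure (Vec d)) : Vec d → ℝ :=
  if h : ∃ p, IsContDensity μ p then h.choose else 0

/-- The score function `s_X = ∇ log p_X` of the law `μ` of `X`. -/
def score {d : ℕ} (μ : Measure (Vec d)) (x : Vec d) : Vec d :=
  gradient (fun y => Real.log (density μ y)) x

/-! ### Sampling process -/

/-- One update `Y_{k-1} = (Y_k + (1 - α_k) / 2 * ŝ_k(Y_k)) / √α_k`. -/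
def step {d : ℕ} (α : ℕ → ℝ) (s : ℕ → Vec d → Vec d) (k : ℕ) (y : Vec d) : Vec d :=
  (1 / √(α k)) • (y + ((1 - α k) / 2) • s k y)

/-- The law of `Y_{K-j}`, where `Y_K ∼ N(0, I_d)`. -/
def samplerLawAux {d : ℕ} (α : ℕ → ℝ) (s : ℕ → Vec d → Vec d) (K : ℕ) : ℕ → Measure (Vec d)
  | 0 => stdGaussian (Vec d)
  | j + 1 => (samplerLawAux α s K j).map (step α s (K - j))

/-- The law of `Y_k`, for `k ≤ K`. -/
def samplerLaw {d : ℕ} (α : ℕ → ℝ) (s : ℕ → Vec d → Vec d) (K k : ℕ) : Measure (Vec d) :=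
  samplerLawAux α s K (K - k)

/-! ### Errors -/

/-- Total variation distance of two probability measures: the supremum over all events of the
difference of the probabilities (which is `½ ∫ |p - q|` for laws with densities `p`, `q`). -/
def tvDist {E : Type*} [MeasurableSpace E] (μ ν : Measure E) : ℝ≥0∞ :=
  ⨆ (A : Set E) (_ : MeasurableSet A), ENNReal.ofReal |μ.real A - ν.real A|

/-- Squared `L²` score error `E ‖ŝ(X) - s_X(X)‖₂²`; the expectation is over the training data
`D ∼ P` and an independent `X ∼ μ`. -/
def scoreErrSq {d : ℕ} {T : Type*} [MeasurableSpace T] (P : Measure T) (μ : Measure (Vec d))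
    (s : T → Vec d → Vec d) : ℝ≥0∞ :=
  ∫⁻ D, ∫⁻ x, ‖s D x - score μ x‖ₑ ^ 2 ∂μ ∂P

/-- Mean Jacobian error `E ‖J_ŝ(X) - J_{s_X}(X)‖` (spectral norm); the expectation is over the
training data `D ∼ P` and an independent `X ∼ μ`. -/
def jacErr {d : ℕ} {T : Type*} [MeasurableSpace T] (P : Measure T) (μ : Measure (Vec d))
    (s : T → Vec d → Vec d) : ℝ≥0∞ :=
  ∫⁻ D, ∫⁻ x, ‖fderiv ℝ (s D) x - fderiv ℝ (score μ) x‖ₑ ∂μ ∂P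

/-- `ε_sc = √(1/K ∑_{k=1}^K (1 - ᾱ_k) ε²_{sc,k})`, where `μ k` is the law of `X_k`. -/
def epsSc {d : ℕ} {T : Type*} [MeasurableSpace T] (P : Measure T) (abar : ℕ → ℝ) (K : ℕ)
    (μ : ℕ → Measure (Vec d)) (s : T → ℕ → Vec d → Vec d) : ℝ≥0∞ :=
  ((K : ℝ≥0∞)⁻¹ * ∑ k ∈ Finset.Icc 1 K,
    ENNReal.ofReal (1 - abar k) * scoreErrSq P (μ k) (fun D => s D k)) ^ (1 / 2 : ℝ)

/-- `ε_jcb = 1/K ∑_{k=1}^K (1 - ᾱ_k) ε_{jcb,k}`, where `μ k` is the law of `X_k`. -/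
def epsJcb {d : ℕ} {T : Type*} [MeasurableSpace T] (P : Measure T) (abar : ℕ → ℝ) (K : ℕ)
    (μ : ℕ → Measure (Vec d)) (s : T → ℕ → Vec d → Vec d) : ℝ≥0∞ :=
  (K : ℝ≥0∞)⁻¹ * ∑ k ∈ Finset.Icc 1 K,
    ENNReal.ofReal (1 - abar k) * jacErr P (μ k) (fun D => s D k)

/-- `J_s(x) + c I_d ⪰ 0` for all `x`, in the sense of quadratic forms; the Jacobian exists
everywhere. -/
def JacobianAddPSD {d : ℕ} (s : Vec d → Vec d) (c : ℝ) : Prop :=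
  Differentiable ℝ s ∧ ∀ x v : Vec d, 0 ≤ inner ℝ v (fderiv ℝ s x v + c • v)

end ProbFlow

end

open ProbFlow

open MeasureTheory ProbabilityTheory
open scoped ENNReal

noncomputable section

namespace ProbFlow

/-! ### Total variation distance -/

section TotalVariation

variable {E F : Type*} [MeasurableSpace E] [MeasurableSpace F]

/-! Total variation does not increase under push-forward, so exchanging the true process for the
sampler one step at a time bounds the error by TV(X_K, N(0, I)) plus, for each k, the distance from
the law of X_k to the image of the law of X_{k+1} under one sampler step
(`tvDist_samplerLawAux_le`). The first term is O(d/K) because ᾱ_K is polynomially small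
(`alphaBar_last_le`, `tvDist_gaussMix_stdGaussian_le`).

For one step, X_{k+1} is a signal a plus Gaussian noise of variance v = 1 - ᾱ_{k+1}. Up to scaling,
X_k is the same signal with noise variance (1 - η)v, and the step is T x = x + (ηv/2) ŝ(x). If p and
q are the two densities, the distance is at most the integral of the positive part of p - |det DT|
q∘T, and 1 - R ≤ -log R asks for a lower bound on log R, where R = |det DT| q(Tx)/p(x). The
posterior of a given x controls everything: its mean gives the score and its covariance the Jacobian
of the score. Jensen's inequality under the posterior bounds q(Tx)/p(x) (`mul_exp_le_mixDens`), and
the eigenvalues l of the posterior covariance bound the determinant (`log_det_ge`). The terms of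
first order in η cancel (`mixDens_sub_le`). What remains is O(dη²) on average, the errors of ŝ, and
(η/2) ∑ ηl²/(1 - η + ηl).

This last sum, `varianceDrop`, is not estimated step by step. Times v, it is the variance removed by
the best affine estimator of a from a less noisy observation, hence on average at most the decrease
of the minimum mean square error from noise v to (1 - η)v (`mmse_add_le`). That error divided by the
noise level stays in [0, d], so the drops telescope to O(d log K) over all steps (`sum_meanDrop_le`)
and contribute O(d log² K / K).

The score error enters through η E[‖m‖ ‖e‖], where the posterior mean m satisfies E‖m‖² ≤ vd;
Young's inequality with a weight θ common to all steps, tuned at the end, gives √d ε_sc log K. The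
lower bound on the Jacobian of ŝ makes T injective and DT coercive, so a Jacobian error changes log
|det DT| by at most about d times its size. -/

theorem tvDist_le_of_forall_le {μ ν : Measure E} [IsProbabilityMeasure μ] [IsProbabilityMeasure ν]
    {δ : ℝ≥0∞} (h : ∀ A, MeasurableSet A → μ A ≤ ν A + δ) : tvDist μ ν ≤ δ := by
  by_cases hδ : δ = ∞
  · simp [hδ]
  have key : ∀ A, MeasurableSet A → μ.real A ≤ ν.real A + δ.toReal := by
    intro A hA
    have := ENNReal.toReal_mono (by simp [hδ]) (h A hA)
    rwa [ENNReal.toReal_add (by simp) hδ] at this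
  refine iSup₂_le fun A hA => ?_
  refine ENNReal.ofReal_le_of_le_toReal (abs_le.2 ⟨?_, ?_⟩)
  -- Both total masses are 1, so the one-sided bound on the complement is the reverse bound on `A`.
  · have := key Aᶜ hA.compl
    rw [probReal_compl_eq_one_sub hA, probReal_compl_eq_one_sub hA] at this
    linarith
  · linarith [key A hA]

theorem tvDist_comm (μ ν : Measure E) : tvDist μ ν = tvDist ν μ := by
  simp only [tvDist, abs_sub_comm]

theorem tvDist_triangle (μ ν ρ : Measure E) : tvDist μ ρ ≤ tvDist μ ν + tvDist ν ρ := by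
  refine iSup₂_le fun A hA => ?_
  refine (ENNReal.ofReal_le_ofReal (abs_sub_le _ (ν.real A) _)).trans ?_
  rw [ENNReal.ofReal_add (abs_nonneg _) (abs_nonneg _)]
  exact add_le_add (le_iSup₂_of_le A hA le_rfl) (le_iSup₂_of_le A hA le_rfl)

theorem tvDist_map_le {μ ν : Measure E} {f : E → F} (hf : Measurable f) :
    tvDist (μ.map f) (ν.map f) ≤ tvDist μ ν := by
  refine iSup₂_le fun A hA => ?_
  rw [map_measureReal_apply hf hA, map_measureReal_apply hf hA]
  exact le_iSup₂_of_le (f ⁻¹' A) (hf hA) le_rfl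

theorem tvDist_le_one (μ ν : Measure E) [IsProbabilityMeasure μ] [IsProbabilityMeasure ν] :
    tvDist μ ν ≤ 1 := by
  refine iSup₂_le fun A _ => ?_
  rw [← ENNReal.ofReal_one]
  refine ENNReal.ofReal_le_ofReal (abs_le.2 ⟨?_, ?_⟩) <;>
  linarith [measureReal_nonneg (μ := μ) (s := A), measureReal_nonneg (μ := ν) (s := A),
    measureReal_le_one (μ := μ) (s := A), measureReal_le_one (μ := ν) (s := A)]

/-- Total variation distance of two laws with densities. -/
theorem tvDist_withDensity_le {m : Measure E} {p q : E → ℝ≥0∞}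
    [IsProbabilityMeasure (m.withDensity p)] [IsProbabilityMeasure (m.withDensity q)]
    (hq : Measurable q) :
    tvDist (m.withDensity p) (m.withDensity q) ≤ ∫⁻ x, (p x - q x) ∂m := by
  refine tvDist_le_of_forall_le fun A hA => ?_
  rw [withDensity_apply _ hA, withDensity_apply _ hA]
  calc ∫⁻ x in A, p x ∂m ≤ ∫⁻ x in A, (q x + (p x - q x)) ∂m :=
        lintegral_mono fun x => le_add_tsub
    _ = ∫⁻ x in A, q x ∂m + ∫⁻ x in A, (p x - q x) ∂m := lintegral_add_left hq _
    _ ≤ _ := by gcongr; exact Measure.restrict_le_self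

end TotalVariation

/-- Total variation distance between the image of a law under an injective differentiable map and
another law, in terms of the densities. -/
theorem tvDist_map_withDensity_le {E : Type*} [NormedAddCommGroup E] [NormedSpace ℝ E]
    [FiniteDimensional ℝ E] [MeasurableSpace E] [BorelSpace E] {m : Measure E} [m.IsAddHaarMeasure]
    {p q : E → ℝ≥0∞} [IsProbabilityMeasure (m.withDensity p)]
    [IsProbabilityMeasure (m.withDensity q)] (hq : Measurable q)
    {T : E → E} (hT : Differentiable ℝ T) (hinj : Function.Injective T) :
    tvDist (m.withDensity q) ((m.withDensity p).map T) ≤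
      ∫⁻ x, (p x - ENNReal.ofReal |(fderiv ℝ T x).det| * q (T x)) ∂m := by
  have hTm : Measurable T := hT.continuous.measurable
  have := Measure.isProbabilityMeasure_map (μ := m.withDensity p) hTm.aemeasurable
  rw [tvDist_comm]
  refine tvDist_le_of_forall_le fun A hA => ?_
  have hTA := hTm hA
  have hdet : Measurable fun x => ENNReal.ofReal |(fderiv ℝ T x).det| :=
    ((ContinuousLinearMap.continuous_det.measurable.comp (measurable_fderiv ℝ T)).abs).ennreal_ofReal
  rw [Measure.map_apply hTm hA, withDensity_apply _ hTA, withDensity_apply _ hA]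
  have hle : ∫⁻ x in T ⁻¹' A, ENNReal.ofReal |(fderiv ℝ T x).det| * q (T x) ∂m
      ≤ ∫⁻ y in A, q y ∂m := by
    -- By injectivity the left side is the integral of `q` over `T '' (T ⁻¹' A)`, a subset of `A`;
    -- surjectivity is not needed.
    rw [← lintegral_image_eq_lintegral_abs_det_fderiv_mul m hTA
      (fun x _ => (hT x).hasFDerivAt.hasFDerivWithinAt) hinj.injOn q]
    exact lintegral_mono_set (Set.image_preimage_subset T A)
  calc ∫⁻ x in T ⁻¹' A, p x ∂m
      ≤ ∫⁻ x in T ⁻¹' A, (ENNReal.ofReal |(fderiv ℝ T x).det| * q (T x) +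
          (p x - ENNReal.ofReal |(fderiv ℝ T x).det| * q (T x))) ∂m :=
        lintegral_mono fun x => le_add_tsub
    _ ≤ ∫⁻ x in T ⁻¹' A, ENNReal.ofReal |(fderiv ℝ T x).det| * q (T x) ∂m +
          ∫⁻ x in T ⁻¹' A, (p x - ENNReal.ofReal |(fderiv ℝ T x).det| * q (T x)) ∂m :=
        (lintegral_add_left (hdet.mul (hq.comp hTm)) _).le
    _ ≤ _ := by gcongr; exact Measure.restrict_le_self

/-! ### Determinants -/

/-- `|det f|` is the factor by which `f` scales volume, and `f` sends the unit ball into the ball of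
radius `‖f‖`. -/
theorem abs_det_le_opNorm_pow {E : Type*} [NormedAddCommGroup E] [InnerProductSpace ℝ E]
    [FiniteDimensional ℝ E] (f : E →L[ℝ] E) :
    |LinearMap.det (f : E →ₗ[ℝ] E)| ≤ ‖f‖ ^ Module.finrank ℝ E := by
  borelize E
  rcases subsingleton_or_nontrivial E with hE | hE
  · simp [Module.finrank_zero_of_subsingleton, LinearMap.det_eq_one_of_subsingleton]
  have h := Measure.addHaar_image_linearMap (volume : Measure E) (f : E →ₗ[ℝ] E)
    (Metric.closedBall 0 1)
  have hsub : (f : E →ₗ[ℝ] E) '' Metric.closedBall 0 1 ⊆ Metric.closedBall 0 ‖f‖ := by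
    rintro _ ⟨x, hx, rfl⟩
    rw [mem_closedBall_zero_iff] at hx ⊢
    exact (f.le_opNorm x).trans (mul_le_of_le_one_right (norm_nonneg _) hx)
  have h2 := measure_mono (μ := (volume : Measure E)) hsub
  rw [h, Measure.addHaar_closedBall _ _ (norm_nonneg f),
    Measure.addHaar_closedBall_eq_addHaar_ball,
    ENNReal.mul_le_mul_iff_left (Metric.measure_ball_pos _ _ one_pos).ne' measure_ball_lt_top.ne,
    ENNReal.ofReal_le_ofReal_iff (by positivity)] at h2
  exact h2

/-- Comparison of the determinants of an operator that is bounded below and a perturbation. -/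
theorem abs_det_le_abs_det_mul_pow {E : Type*} [NormedAddCommGroup E] [InnerProductSpace ℝ E]
    [FiniteDimensional ℝ E] (A B : E →L[ℝ] E) {c : ℝ} (hc : 0 < c)
    (hA : ∀ v, c * ‖v‖ ≤ ‖A v‖) :
    0 < |A.det| ∧ |B.det| ≤ |A.det| * (1 + ‖B - A‖ / c) ^ Module.finrank ℝ E := by
  have hinj : Function.Injective (A : E →ₗ[ℝ] E) := by
    rw [← LinearMap.ker_eq_bot, LinearMap.ker_eq_bot']
    intro v hv
    have h1 := hA v
    rw [show A v = 0 from hv, norm_zero] at h1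
    exact norm_le_zero_iff.1 (nonpos_of_mul_nonpos_right h1 hc)
  let e : E ≃ₗ[ℝ] E := LinearEquiv.ofInjectiveEndo (A : E →ₗ[ℝ] E) hinj
  have hAe : ∀ v, A (e.symm v) = v := fun v =>  e.apply_symm_apply v
  let G : E →L[ℝ] E := LinearMap.toContinuousLinearMap (e.symm : E →ₗ[ℝ] E)
  have hG : ∀ v, A (G v) = v := hAe
  have hGn : ‖G‖ ≤ c⁻¹ := by
    refine G.opNorm_le_bound (by positivity) fun v => ?_
    have := hA (G v)
    rw [hG] at this
    rw [inv_mul_eq_div, le_div_iff₀ hc]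
    linarith
  -- `G` inverts `A` and has norm at most `1 / c`, so the second factor is the identity plus an
  -- operator of norm at most `‖B - A‖ / c`.
  have hfac : B = A.comp (ContinuousLinearMap.id ℝ E + G.comp (B - A)) := by
    ext v
    simp [hG]
  have hdetA : A.det ≠ 0 := by
    have h1 : LinearMap.det (A : E →ₗ[ℝ] E) * LinearMap.det (G : E →ₗ[ℝ] E) = 1 := by
      rw [← LinearMap.det_comp, show (A : E →ₗ[ℝ] E) ∘ₗ (G : E →ₗ[ℝ] E) = LinearMap.id from
        LinearMap.ext hG, LinearMap.det_id]
    exact left_ne_zero_of_mul_eq_one h1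
  refine ⟨abs_pos.2 hdetA, ?_⟩
  have hdet : B.det = A.det * (ContinuousLinearMap.id ℝ E + G.comp (B - A)).det := by
    conv_lhs => rw [hfac]
    exact LinearMap.det_comp _ _
  rw [hdet, abs_mul]
  gcongr
  refine (abs_det_le_opNorm_pow _).trans ?_
  gcongr
  refine (norm_add_le _ _).trans (add_le_add ContinuousLinearMap.norm_id_le ?_)
  refine (ContinuousLinearMap.opNorm_comp_le _ _).trans ?_
  rw [div_eq_inv_mul]
  gcongr

theorem det_eq_prod_of_apply_basis {E ι : Type*} [AddCommGroup E] [Module ℝ E] [Fintype ι]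
    [DecidableEq ι] (b : Module.Basis ι ℝ E) (f : E →ₗ[ℝ] E) (μ : ι → ℝ)
    (h : ∀ i, f (b i) = μ i • b i) : LinearMap.det f = ∏ i, μ i := by
  rw [← LinearMap.det_toMatrix b, ← Matrix.det_diagonal]
  congr 1
  ext i j
  rw [LinearMap.toMatrix_apply, h, map_smul, Finsupp.smul_apply, b.repr_self, Matrix.diagonal_apply,
    Finsupp.single_apply]
  by_cases hij : i = j
  · subst hij; simp
  · simp [hij, Ne.symm hij]

/-- This is 1 - 1/x ≤ log x at x = 1 + t. Keeping 1 + t in the denominator makes the loss linear for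
large t, which matters because no bound on the posterior eigenvalues is available. -/
theorem le_log_one_add {t : ℝ} (ht : -1 < t) : t - t ^ 2 / (1 + t) ≤ Real.log (1 + t) := by
  have h := Real.one_sub_inv_le_log_of_pos (x := 1 + t) (by linarith)
  have : t - t ^ 2 / (1 + t) = 1 - (1 + t)⁻¹ := by
    have : 1 + t ≠ 0 := by linarith
    field_simp
    ring
  linarith

/-- The contribution of an eigenvalue `l` of the posterior covariance to the log-determinant. -/
theorem le_log_eigenvalue {η l : ℝ} (hη : 0 < η) (hη' : η ≤ 1 / 2) (hl : 0 ≤ l) :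
    η / 2 * (l - 1) - η / 2 * (η * l ^ 2 / (1 - η + η * l)) - η ^ 2 / 2 ≤
      Real.log (1 - η / 2 + η / 2 * l) := by
  have hηl : 0 ≤ η * l := by positivity
  have h := le_log_one_add (t := η / 2 * (l - 1)) (by nlinarith)
  rw [show 1 + η / 2 * (l - 1) = 1 - η / 2 + η / 2 * l by ring] at h
  refine le_trans ?_ h
  have h1 : 0 < 1 - η / 2 + η / 2 * l := by nlinarith
  have h2 : 0 < 1 - η + η * l := by nlinarith
  have h3 : (η / 2 * (l - 1)) ^ 2 / (1 - η / 2 + η / 2 * l) ≤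
      η / 2 * (η * l ^ 2 / (1 - η + η * l)) + η ^ 2 / 2 := by
    have e1 : (η / 2 * (l - 1)) ^ 2 ≤ (η ^ 2 / 4) * l ^ 2 + η ^ 2 / 4 := by
      nlinarith [mul_nonneg (sq_nonneg η) hl]
    calc (η / 2 * (l - 1)) ^ 2 / (1 - η / 2 + η / 2 * l)
        ≤ ((η ^ 2 / 4) * l ^ 2 + η ^ 2 / 4) / (1 - η / 2 + η / 2 * l) := by gcongr
      _ = (η ^ 2 / 4) * l ^ 2 / (1 - η / 2 + η / 2 * l) +
            (η ^ 2 / 4) / (1 - η / 2 + η / 2 * l) := add_div _ _ _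
      _ ≤ (η ^ 2 / 4) * l ^ 2 / ((1 - η + η * l) / 2) + (η ^ 2 / 4) / (1 / 2) := by
          gcongr <;> nlinarith
      _ = _ := by field_simp; ring
  linarith

/-! ### Gaussian densities -/

/-- The density of `N(0, v I_d)`. -/
def gaussDens {d : ℕ} (v : ℝ) (u : Vec d) : ℝ :=
  (2 * Real.pi * v) ^ (-(d / 2) : ℝ) * Real.exp (-‖u‖ ^ 2 / (2 * v))

theorem gaussDens_pos {d : ℕ} {v : ℝ} (hv : 0 < v) (u : Vec d) : 0 < gaussDens v u := by
  unfold gaussDens; positivity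

@[fun_prop]
theorem continuous_gaussDens {d : ℕ} (v : ℝ) : Continuous (gaussDens (d := d) v) := by
  unfold gaussDens; fun_prop

theorem integrable_gaussDens {d : ℕ} {v : ℝ} (hv : 0 < v) : Integrable (gaussDens (d := d) v) := by
  unfold gaussDens
  have := (GaussianFourier.integrable_cexp_neg_mul_sq_norm_add (V := Vec d)
    (b := ((1 / (2 * v) : ℝ) : ℂ)) (by rw [Complex.ofReal_re]; positivity) 0 0).norm
  refine Integrable.const_mul ?_ _
  refine this.congr (ae_of_all _ fun u => ?_)
  simp only [inner_zero_left, Complex.ofReal_zero, mul_zero, add_zero]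
  rw [show -((1 / (2 * v) : ℝ) : ℂ) * (‖u‖ : ℂ) ^ 2 = ((-‖u‖ ^ 2 / (2 * v) : ℝ) : ℂ) by
    push_cast; ring, ← Complex.ofReal_exp, Complex.norm_real, Real.norm_eq_abs, Real.abs_exp]

theorem isFiniteMeasure_gaussDens {d : ℕ} {v : ℝ} (hv : 0 < v) :
    IsFiniteMeasure ((volume : Measure (Vec d)).withDensity
      fun u => ENNReal.ofReal (gaussDens v u)) := by
  refine isFiniteMeasure_withDensity_ofReal (integrable_gaussDens hv).2

theorem map_smul_stdGaussian {d : ℕ} {v : ℝ} (hv : 0 < v) :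
    (stdGaussian (Vec d)).map (fun w => √v • w) =
      volume.withDensity fun u => ENNReal.ofReal (gaussDens v u) := by
  have := isFiniteMeasure_gaussDens (d := d) hv
  refine Measure.ext_of_charFun ?_
  ext t
  rw [charFun_map_smul, charFun_stdGaussian, charFun_apply,
    integral_withDensity_eq_integral_toReal_smul (by fun_prop) (by simp)]
  have h := GaussianFourier.integral_cexp_neg_mul_sq_norm_add (V := Vec d)
    (b := ((1 / (2 * v) : ℝ) : ℂ)) (by rw [Complex.ofReal_re]; positivity) Complex.I t
  have h2 : ∀ u : Vec d, (ENNReal.ofReal (gaussDens v u)).toReal •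
      Complex.exp (inner ℝ u t * Complex.I) =
      (((2 * Real.pi * v) ^ (-(d / 2) : ℝ) : ℝ) : ℂ) *
      Complex.exp (-((1 / (2 * v) : ℝ) : ℂ) * ‖u‖ ^ 2 + Complex.I * inner ℝ t u) := by
    intro u
    rw [ENNReal.toReal_ofReal (gaussDens_pos hv u).le, gaussDens, Complex.real_smul,
      Complex.exp_add, real_inner_comm]
    push_cast
    rw [mul_assoc]
    congr 2
    · congr 1; ring
    · congr 1; ring
  simp_rw [h2]
  rw [integral_const_mul, h, norm_smul, finrank_euclideanSpace, Fintype.card_fin,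
    ← mul_assoc]
  have h3 : (((2 * Real.pi * v) ^ (-(d / 2) : ℝ) : ℝ) : ℂ) *
      ((Real.pi : ℂ) / ((1 / (2 * v) : ℝ) : ℂ)) ^ ((d : ℂ) / 2) = 1 := by
    have : (Real.pi : ℂ) / ((1 / (2 * v) : ℝ) : ℂ) = ((2 * Real.pi * v : ℝ) : ℂ) := by
      push_cast; field_simp
    rw [this, show (d : ℂ) / 2 = ((d / 2 : ℝ) : ℂ) by push_cast; ring,
      ← Complex.ofReal_cpow (by positivity), ← Complex.ofReal_mul,
      ← Real.rpow_add (by positivity)]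
    simp
  rw [h3, one_mul]
  congr 1
  rw [Complex.I_sq, Real.norm_eq_abs, abs_of_nonneg (Real.sqrt_nonneg v)]
  push_cast
  rw [mul_pow, ← Complex.ofReal_pow, Real.sq_sqrt hv.le]
  field_simp
  ring

theorem lintegral_stdGaussian_add_smul {d : ℕ} {v : ℝ} (hv : 0 < v) (a : Vec d)
    {f : Vec d → ℝ≥0∞} (hf : Measurable f) :
    ∫⁻ w, f (a + √v • w) ∂(stdGaussian (Vec d)) =
      ∫⁻ x, ENNReal.ofReal (gaussDens v (x - a)) * f x := by
  rw [← lintegral_map (f := fun u => f (a + u)) (by fun_prop) (by fun_prop),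
    map_smul_stdGaussian hv, lintegral_withDensity_eq_lintegral_mul _ (by fun_prop) (by fun_prop),
    ← lintegral_sub_right_eq_self _ a]
  simp

/-- The law of `a + √v w`, where `a ∼ ν` and `w ∼ N(0, I_d)` are independent. -/
def gaussMix {d : ℕ} (ν : Measure (Vec d)) (v : ℝ) : Measure (Vec d) :=
  (ν.prod (stdGaussian (Vec d))).map (fun q => q.1 + √v • q.2)

instance {d : ℕ} (ν : Measure (Vec d)) [IsProbabilityMeasure ν] (v : ℝ) :
    IsProbabilityMeasure (gaussMix ν v) :=
  Measure.isProbabilityMeasure_map (by fun_prop)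

theorem lintegral_gaussMix {d : ℕ} (ν : Measure (Vec d)) [SFinite ν] (v : ℝ)
    {f : Vec d → ℝ≥0∞} (hf : Measurable f) :
    ∫⁻ x, f x ∂(gaussMix ν v) = ∫⁻ a, ∫⁻ w, f (a + √v • w) ∂(stdGaussian (Vec d)) ∂ν := by
  rw [gaussMix, lintegral_map hf (by fun_prop), lintegral_prod _ (by fun_prop)]

/-- The density of `gaussMix ν v`. -/
def mixDens {d : ℕ} (ν : Measure (Vec d)) (v : ℝ) (x : Vec d) : ℝ :=
  ∫ a, gaussDens v (x - a) ∂ν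

/-- The law of `a` given `a + √v w = x`. -/
def post {d : ℕ} (ν : Measure (Vec d)) (v : ℝ) (x : Vec d) : Measure (Vec d) :=
  ν.withDensity fun a => ENNReal.ofReal (gaussDens v (x - a) / mixDens ν v x)

/-- Supplies the domination for the integrals over signals: functions of quadratic growth in `x - a`
become bounded against the Gaussian density, so no moment of `ν` is needed. -/
theorem gaussDens_mul_le {d : ℕ} {v : ℝ} (hv : 0 < v) (u : Vec d) :
    gaussDens v u * (1 + ‖u‖ ^ 2) ≤ (2 * Real.pi * v) ^ (-(d / 2) : ℝ) * (1 + 2 * v) := by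
  unfold gaussDens
  rw [mul_assoc]
  gcongr
  have h1 : Real.exp (-‖u‖ ^ 2 / (2 * v)) ≤ 1 := Real.exp_le_one_iff.2 (by
    rw [neg_div]; exact neg_nonpos.2 (by positivity))
  have h2 : Real.exp (-‖u‖ ^ 2 / (2 * v)) * ‖u‖ ^ 2 ≤ 2 * v := by
    have h3 := Real.add_one_le_exp (‖u‖ ^ 2 / (2 * v))
    rw [neg_div, Real.exp_neg, inv_mul_le_iff₀ (Real.exp_pos _)]
    have h4 : ‖u‖ ^ 2 = ‖u‖ ^ 2 / (2 * v) * (2 * v) := by field_simp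
    nlinarith
  linarith

theorem gaussDens_le {d : ℕ} {v : ℝ} (hv : 0 < v) (u : Vec d) :
    gaussDens v u ≤ (2 * Real.pi * v) ^ (-(d / 2) : ℝ) * (1 + 2 * v) :=
  (le_mul_of_one_le_right (gaussDens_pos hv u).le (by nlinarith [sq_nonneg ‖u‖])).trans
    (gaussDens_mul_le hv u)

/-! ### Posterior law of the signal in a Gaussian mixture -/

section Posterior

variable {d : ℕ} {ν : Measure (Vec d)} [IsProbabilityMeasure ν] {v : ℝ}

theorem integrable_gaussDens_smul {F : Type*} [NormedAddCommGroup F] [NormedSpace ℝ F]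
    (hv : 0 < v) (x : Vec d) {f : Vec d → F} (hf : AEStronglyMeasurable f ν) {B : ℝ}
    (hB : ∀ a, ‖f a‖ ≤ B * (1 + ‖x - a‖ ^ 2)) :
    Integrable (fun a => gaussDens v (x - a) • f a) ν := by
  have hc : AEStronglyMeasurable (fun a => gaussDens v (x - a)) ν :=
    Continuous.aestronglyMeasurable (by fun_prop)
  refine Integrable.of_bound (hc.smul hf)
    ((2 * Real.pi * v) ^ (-(d / 2) : ℝ) * (1 + 2 * v) * |B|) (ae_of_all _ fun a => ?_)
  rw [norm_smul, Real.norm_of_nonneg (gaussDens_pos hv _).le]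
  calc gaussDens v (x - a) * ‖f a‖ ≤ gaussDens v (x - a) * (|B| * (1 + ‖x - a‖ ^ 2)) := by
        refine mul_le_mul_of_nonneg_left ((hB a).trans ?_) (gaussDens_pos hv _).le
        gcongr
        exact le_abs_self B
    _ = gaussDens v (x - a) * (1 + ‖x - a‖ ^ 2) * |B| := by ring
    _ ≤ _ := mul_le_mul_of_nonneg_right (gaussDens_mul_le hv _) (abs_nonneg B)

theorem integrable_gaussDens_sub (hv : 0 < v) (x : Vec d) :
    Integrable (fun a => gaussDens v (x - a)) ν := by
  simpa using integrable_gaussDens_smul (ν := ν) hv x (f := fun _ => (1 : ℝ)) (by fun_prop) (B := 1)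
    (fun a => by simp)

theorem mixDens_pos (hv : 0 < v) (x : Vec d) : 0 < mixDens ν v x := by
  refine (integral_pos_iff_support_of_nonneg (fun a => (gaussDens_pos hv _).le)
    (integrable_gaussDens_sub hv x)).2 ?_
  have : (Function.support fun a => gaussDens v (x - a)) = Set.univ :=
    Set.eq_univ_of_forall fun a => (gaussDens_pos hv _).ne'
  simp [this]

theorem continuous_mixDens (hv : 0 < v) : Continuous (mixDens ν v) := by
  refine continuous_of_dominated (bound := fun _ => (2 * Real.pi * v) ^ (-(d / 2) : ℝ) * (1 + 2 * v))
    (fun x => Continuous.aestronglyMeasurable (by fun_prop)) (fun x => ae_of_all _ fun a => ?_)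
    (integrable_const _) (ae_of_all _ fun a => by fun_prop)
  rw [Real.norm_of_nonneg (gaussDens_pos hv _).le]
  exact gaussDens_le hv _

theorem ofReal_mixDens (hv : 0 < v) (x : Vec d) :
    ENNReal.ofReal (mixDens ν v x) = ∫⁻ a, ENNReal.ofReal (gaussDens v (x - a)) ∂ν :=
  ofReal_integral_eq_lintegral_ofReal (integrable_gaussDens_sub hv x)
    (ae_of_all _ fun _ => (gaussDens_pos hv _).le)

theorem gaussMix_eq_withDensity (hv : 0 < v) :
    gaussMix ν v = volume.withDensity fun x => ENNReal.ofReal (mixDens ν v x) := by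
  refine Measure.ext_of_lintegral _ fun f hf => ?_
  rw [lintegral_gaussMix _ _ hf, lintegral_withDensity_eq_lintegral_mul _
    (continuous_mixDens hv).measurable.ennreal_ofReal hf]
  simp_rw [lintegral_stdGaussian_add_smul hv _ hf, Pi.mul_apply, ofReal_mixDens hv]
  rw [lintegral_lintegral_swap (Measurable.aemeasurable (by fun_prop))]
  refine lintegral_congr fun x => ?_
  rw [lintegral_mul_const _ (by fun_prop)]

theorem isContDensity_mixDens (hv : 0 < v) : IsContDensity (gaussMix ν v) (mixDens ν v) :=
  ⟨continuous_mixDens hv, fun x => (mixDens_pos hv x).le, gaussMix_eq_withDensity hv⟩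

theorem density_gaussMix (hv : 0 < v) : density (gaussMix ν v) = mixDens ν v := by
  have h : ∃ p, IsContDensity (gaussMix ν v) p := ⟨_, isContDensity_mixDens hv⟩
  rw [density, dif_pos h]
  exact IsContDensity.unique h.choose_spec (isContDensity_mixDens hv)

/-- Bayes' rule, cleared of the marginal density in the denominator. -/
theorem lintegral_post (hv : 0 < v) (x : Vec d) {f : Vec d → ℝ≥0∞} (hf : Measurable f) :
    ENNReal.ofReal (mixDens ν v x) * ∫⁻ a, f a ∂(post ν v x) =
      ∫⁻ a, ENNReal.ofReal (gaussDens v (x - a)) * f a ∂ν := by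
  rw [post, lintegral_withDensity_eq_lintegral_mul _ (by fun_prop) hf,
    ← lintegral_const_mul _ (by fun_prop)]
  refine lintegral_congr fun a => ?_
  rw [Pi.mul_apply, ← mul_assoc, ← ENNReal.ofReal_mul (mixDens_pos hv x).le,
    mul_div_cancel₀ _ (mixDens_pos hv x).ne']

theorem isProbabilityMeasure_post (hv : 0 < v) (x : Vec d) : IsProbabilityMeasure (post ν v x) := by
  constructor
  have h := lintegral_post (ν := ν) hv x (f := fun _ => 1) measurable_const
  simp only [lintegral_const, one_mul, mul_one, ← ofReal_mixDens hv] at h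
  exact (ENNReal.mul_eq_left (by simpa using mixDens_pos hv x) ENNReal.ofReal_ne_top).1 h

theorem integral_post {F : Type*} [NormedAddCommGroup F] [NormedSpace ℝ F] (hv : 0 < v) (x : Vec d)
    (f : Vec d → F) :
    ∫ a, f a ∂(post ν v x) = (mixDens ν v x)⁻¹ • ∫ a, gaussDens v (x - a) • f a ∂ν := by
  rw [post, integral_withDensity_eq_integral_toReal_smul (by fun_prop) (by simp),
    ← integral_smul]
  refine integral_congr_ae (ae_of_all _ fun a => ?_)
  simp only
  rw [ENNReal.toReal_ofReal (div_nonneg (gaussDens_pos hv _).le (mixDens_pos hv x).le), smul_smul,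
    div_eq_inv_mul]

theorem integrable_post {F : Type*} [NormedAddCommGroup F] [NormedSpace ℝ F] (hv : 0 < v) (x : Vec d)
    {f : Vec d → F} (hf : Continuous f) {B : ℝ} (hB : ∀ a, ‖f a‖ ≤ B * (1 + ‖x - a‖ ^ 2)) :
    Integrable f (post ν v x) := by
  rw [post, integrable_withDensity_iff_integrable_smul' (by fun_prop) (by simp)]
  refine ((integrable_gaussDens_smul (ν := ν) hv x hf.aestronglyMeasurable hB).smul
    (mixDens ν v x)⁻¹).congr (ae_of_all _ fun a => ?_)
  simp only [Pi.smul_apply]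
  rw [ENNReal.toReal_ofReal (div_nonneg (gaussDens_pos hv _).le (mixDens_pos hv x).le), smul_smul,
    div_eq_inv_mul]

theorem measurable_lintegral_post (hv : 0 < v) {f : Vec d → Vec d → ℝ≥0∞}
    (hf : Measurable fun q : Vec d × Vec d => f q.1 q.2) :
    Measurable fun x => ∫⁻ a, f x a ∂(post ν v x) := by
  have hm := (continuous_mixDens (ν := ν) hv).measurable
  have hf1 : ∀ x, Measurable (f x) := fun x => hf.comp (by fun_prop : Measurable fun a => (x, a))
  have : (fun x => ∫⁻ a, f x a ∂(post ν v x)) = fun x =>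
      ∫⁻ a, ENNReal.ofReal (gaussDens v (x - a) / mixDens ν v x) * f x a ∂ν := by
    funext x
    rw [post, lintegral_withDensity_eq_lintegral_mul _ (by fun_prop) (hf1 x)]
    rfl
  rw [this]
  refine Measurable.lintegral_prod_right' (f := fun q : Vec d × Vec d =>
    ENNReal.ofReal (gaussDens v (q.1 - q.2) / mixDens ν v q.1) * f q.1 q.2) ?_
  exact Measurable.mul (by fun_prop) hf

/-- Disintegration of the joint law of `x = a + √v w` and `a` with respect to `x`. -/
theorem lintegral_gaussMix_post (hv : 0 < v) {f : Vec d → Vec d → ℝ≥0∞}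
    (hf : Measurable fun q : Vec d × Vec d => f q.1 q.2) :
    ∫⁻ x, ∫⁻ a, f x a ∂(post ν v x) ∂(gaussMix ν v) =
      ∫⁻ a, ∫⁻ w, f (a + √v • w) a ∂(stdGaussian (Vec d)) ∂ν := by
  have hf1 : ∀ x, Measurable (f x) := fun x => hf.comp (by fun_prop : Measurable fun a => (x, a))
  have hf2 : ∀ a, Measurable fun x => f x a :=
    fun a => hf.comp (by fun_prop : Measurable fun x => (x, a))
  rw [gaussMix_eq_withDensity hv, lintegral_withDensity_eq_lintegral_mul _
    (continuous_mixDens hv).measurable.ennreal_ofReal (measurable_lintegral_post hv hf)]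
  simp_rw [lintegral_stdGaussian_add_smul hv _ (hf2 _), Pi.mul_apply, lintegral_post hv _ (hf1 _)]
  rw [lintegral_lintegral_swap]
  exact (Measurable.mul (by fun_prop) hf).aemeasurable

end Posterior

/-! ### The score and its Jacobian -/

theorem hasFDerivAt_integral_translate {d : ℕ} {F : Type*} [NormedAddCommGroup F] [NormedSpace ℝ F]
    {ν : Measure (Vec d)} [IsProbabilityMeasure ν] {h : Vec d → F} {h' : Vec d → Vec d →L[ℝ] F}
    (hh : ∀ u, HasFDerivAt h (h' u) u) (hc : Continuous h') {B B' : ℝ} (hB : ∀ u, ‖h u‖ ≤ B)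
    (hB' : ∀ u, ‖h' u‖ ≤ B') (x : Vec d) :
    HasFDerivAt (fun x => ∫ a, h (x - a) ∂ν) (∫ a, h' (x - a) ∂ν) x := by
  have hcont : Continuous h := continuous_iff_continuousAt.2 fun u => (hh u).continuousAt
  refine hasFDerivAt_integral_of_dominated_of_fderiv_le (s := Set.univ) (bound := fun _ => B')
    (F' := fun x a => h' (x - a))
    Filter.univ_mem (Filter.Eventually.of_forall fun y => Continuous.aestronglyMeasurable
      (by fun_prop)) ?_ (Continuous.aestronglyMeasurable (by fun_prop))
      (ae_of_all _ fun a y _ => hB' _) (integrable_const _) (ae_of_all _ fun a y _ => ?_)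
  · exact Integrable.of_bound (Continuous.aestronglyMeasurable (by fun_prop)) B
      (ae_of_all _ fun a => hB _)
  · exact (hh (y - a)).comp y ((hasFDerivAt_id y).sub_const a)

theorem hasFDerivAt_gaussDens {d : ℕ} (v : ℝ) (u : Vec d) :
    HasFDerivAt (gaussDens v) (-(gaussDens v u / v) • innerSL ℝ u) u := by
  unfold gaussDens
  have h := ((((hasStrictFDerivAt_norm_sq u).hasFDerivAt.neg).mul_const (2 * v)⁻¹).exp).const_mul
    ((2 * Real.pi * v) ^ (-(d / 2) : ℝ))
  refine (h.congr_fderiv ?_)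
  ext w
  simp
  ring_nf

theorem hasFDerivAt_gaussDens_smul {d : ℕ} (v : ℝ) (u : Vec d) :
    HasFDerivAt (fun u : Vec d => gaussDens v u • u)
      (gaussDens v u • ContinuousLinearMap.id ℝ (Vec d) -
        (gaussDens v u / v) • (innerSL ℝ u).smulRight u) u := by
  refine ((hasFDerivAt_gaussDens v u).smul (hasFDerivAt_id u)).congr_fderiv ?_
  ext1 w
  simp only [add_apply, smul_apply,
    ContinuousLinearMap.smulRight_apply, sub_apply, innerSL_apply_apply, id_eq,
    smul_eq_mul]
  module

section Score

variable {d : ℕ} 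

/-- The posterior mean of `√v w` given `a + √v w = x`. -/
def postMean (ν : Measure (Vec d)) (v : ℝ) (x : Vec d) : Vec d := ∫ a, (x - a) ∂(post ν v x)

/-- The posterior covariance of `w` given `a + √v w = x`. -/
def postCov (ν : Measure (Vec d)) (v : ℝ) (x : Vec d) : Vec d →L[ℝ] Vec d :=
  v⁻¹ • (∫ a, (innerSL ℝ (x - a)).smulRight (x - a) ∂(post ν v x) -
    (innerSL ℝ (postMean ν v x)).smulRight (postMean ν v x))

variable {ν : Measure (Vec d)} [IsProbabilityMeasure ν] {v : ℝ}

theorem integrable_sub_post (hv : 0 < v) (x : Vec d) :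
    Integrable (fun a => x - a) (post ν v x) :=
  integrable_post hv x (by fun_prop) (B := 1) fun a => by nlinarith [sq_nonneg (‖x - a‖ - 1)]

theorem continuous_smulRight_self : Continuous fun u : Vec d => (innerSL ℝ u).smulRight u := by
  have : (fun u : Vec d => (innerSL ℝ u).smulRight u) = fun u =>
      ContinuousLinearMap.smulRightL ℝ (Vec d) (Vec d) (innerSL ℝ u) u := by
    ext; simp
  rw [this]
  fun_prop

theorem integrable_smulRight_post (hv : 0 < v) (x : Vec d) :
    Integrable (fun a => (innerSL ℝ (x - a)).smulRight (x - a)) (post ν v x) :=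
  integrable_post hv x (continuous_smulRight_self.comp (by fun_prop)) (B := 1) fun a => by
    rw [ContinuousLinearMap.norm_smulRight_apply, innerSL_apply_norm]; nlinarith

theorem postMean_eq (hv : 0 < v) (x : Vec d) :
    postMean ν v x = (mixDens ν v x)⁻¹ • ∫ a, gaussDens v (x - a) • (x - a) ∂ν :=
  integral_post hv x _

theorem hasFDerivAt_mixDens (hv : 0 < v) (x : Vec d) :
    HasFDerivAt (mixDens ν v) (-(mixDens ν v x / v) • innerSL ℝ (postMean ν v x)) x := by
  have hp := mixDens_pos (ν := ν) hv x
  have hb : ∀ u : Vec d, ‖gaussDens v u‖ ≤ (2 * Real.pi * v) ^ (-(d / 2) : ℝ) * (1 + 2 * v) :=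
    fun u => by rw [Real.norm_of_nonneg (gaussDens_pos hv u).le]; exact gaussDens_le hv u
  have h := hasFDerivAt_integral_translate (ν := ν) (hasFDerivAt_gaussDens (d := d) v)
    (by fun_prop) hb (B' := (2 * Real.pi * v) ^ (-(d / 2) : ℝ) * (1 + 2 * v) / v) (fun u => by
      rw [norm_smul, innerSL_apply_norm, norm_neg, Real.norm_of_nonneg
        (div_nonneg (gaussDens_pos hv u).le hv.le), div_mul_eq_mul_div]
      have := gaussDens_mul_le hv u
      have h2 := gaussDens_pos hv u
      refine div_le_div_of_nonneg_right (le_trans ?_ this) hv.le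
      gcongr
      nlinarith [sq_nonneg (‖u‖ - 1)]) x
  refine h.congr_fderiv ?_
  have hint : Integrable (fun a => gaussDens v (x - a) • (x - a)) ν :=
    integrable_gaussDens_smul hv x (by fun_prop) (B := 1)
      fun a => by nlinarith [sq_nonneg (‖x - a‖ - 1)]
  have e : ∀ a : Vec d, -(gaussDens v (x - a) / v) • innerSL ℝ (x - a) =
      (-v⁻¹) • innerSL ℝ (gaussDens v (x - a) • (x - a)) := by
    intro a
    rw [map_smul, smul_smul]
    congr 1
    ring
  simp_rw [e]
  rw [integral_smul, ContinuousLinearMap.integral_comp_comm _ hint, postMean_eq hv, map_smul,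
    smul_smul]
  congr 1
  field_simp

/-- Quotient rule applied to `postMean_eq`: the numerator yields the identity minus the second
moment over `v`, and the denominator restores the outer product of the mean, which turns the second
moment into a covariance. -/
theorem hasFDerivAt_postMean (hv : 0 < v) (x : Vec d) :
    HasFDerivAt (postMean ν v) (ContinuousLinearMap.id ℝ _ - postCov ν v x) x := by
  have hp := mixDens_pos (ν := ν) hv x
  have hb := fun u : Vec d => gaussDens_mul_le hv u
  set B := (2 * Real.pi * v) ^ (-(d / 2) : ℝ) * (1 + 2 * v)
  have hg := fun u : Vec d => gaussDens_pos hv u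
  have h := hasFDerivAt_integral_translate (ν := ν) (hasFDerivAt_gaussDens_smul (d := d) v)
    (by
      have := continuous_smulRight_self (d := d)
      fun_prop) (B := B) (fun u => by
      rw [norm_smul, Real.norm_of_nonneg (hg u).le]
      exact (mul_le_mul_of_nonneg_left (by nlinarith [sq_nonneg (‖u‖ - 1)]) (hg u).le).trans (hb u))
    (B' := B + B / v) (fun u => by
      refine (norm_sub_le _ _).trans (add_le_add ?_ ?_)
      · rw [norm_smul, Real.norm_of_nonneg (hg u).le]
        exact (mul_le_of_le_one_right (hg u).le ContinuousLinearMap.norm_id_le).trans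
          (gaussDens_le hv u)
      · rw [norm_smul, ContinuousLinearMap.norm_smulRight_apply, innerSL_apply_norm,
          Real.norm_of_nonneg (div_nonneg (hg u).le hv.le), div_mul_eq_mul_div]
        gcongr
        exact (mul_le_mul_of_nonneg_left (by nlinarith) (hg u).le).trans (hb u)) x
  have hP := ((hasDerivAt_inv hp.ne').comp_hasFDerivAt x (hasFDerivAt_mixDens (ν := ν) hv x)).smul h
  have hfun : postMean ν v =
      fun x => (mixDens ν v x)⁻¹ • ∫ a, gaussDens v (x - a) • (x - a) ∂ν :=
    funext fun x => postMean_eq hv x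
  rw [hfun]
  refine hP.congr_fderiv ?_
  have hN : ∫ a, gaussDens v (x - a) • (x - a) ∂ν = mixDens ν v x • postMean ν v x := by
    rw [postMean_eq hv, smul_smul, mul_inv_cancel₀ hp.ne', one_smul]
  have hi1 : Integrable (fun a => gaussDens v (x - a) • ContinuousLinearMap.id ℝ (Vec d)) ν :=
    (integrable_gaussDens_sub hv x).smul_const _
  have hi2 : Integrable (fun a => gaussDens v (x - a) • (innerSL ℝ (x - a)).smulRight (x - a)) ν :=
    integrable_gaussDens_smul hv x (continuous_smulRight_self.comp (f := fun a => x - a)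
      (by fun_prop)).aestronglyMeasurable (B := 1) fun a => by
        rw [ContinuousLinearMap.norm_smulRight_apply, innerSL_apply_norm]; nlinarith
  have hN' : ∫ a, (gaussDens v (x - a) • ContinuousLinearMap.id ℝ (Vec d) -
      (gaussDens v (x - a) / v) • (innerSL ℝ (x - a)).smulRight (x - a)) ∂ν =
      mixDens ν v x • (ContinuousLinearMap.id ℝ (Vec d) -
        v⁻¹ • ∫ a, (innerSL ℝ (x - a)).smulRight (x - a) ∂(post ν v x)) := by
    have e : ∀ a : Vec d, (gaussDens v (x - a) / v) • (innerSL ℝ (x - a)).smulRight (x - a) =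
        v⁻¹ • (gaussDens v (x - a) • (innerSL ℝ (x - a)).smulRight (x - a)) := by
      intro a
      rw [smul_smul, div_eq_inv_mul]
    simp_rw [e]
    rw [integral_sub hi1 (hi2.fun_smul v⁻¹), integral_smul_const, integral_smul, integral_post hv,
      smul_sub, smul_comm (mixDens ν v x) v⁻¹, smul_smul (mixDens ν v x), mul_inv_cancel₀ hp.ne',
      one_smul]
    rfl
  rw [hN', hN]
  simp only [postCov, smul_smul]
  ext1 w
  simp only [add_apply, smul_apply,
    ContinuousLinearMap.smulRight_apply, sub_apply, innerSL_apply_apply,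
    smul_eq_mul, smul_smul, ContinuousLinearMap.id_apply, smul_sub, Function.comp_apply]
  have : -(mixDens ν v x ^ 2)⁻¹ * -(mixDens ν v x / v) * inner ℝ (postMean ν v x) w *
      mixDens ν v x = v⁻¹ * inner ℝ (postMean ν v x) w := by
    field_simp
  rw [this, inv_mul_cancel₀ hp.ne']
  module

/-- Tweedie's formula, read off from the logarithmic derivative of `mixDens`. -/
theorem score_gaussMix (hv : 0 < v) :
    score (gaussMix ν v) = fun x => -v⁻¹ • postMean ν v x := by
  funext x
  have hp := mixDens_pos (ν := ν) hv x
  have h := (hasFDerivAt_mixDens (ν := ν) hv x).log hp.ne'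
  rw [score, density_gaussMix hv]
  refine HasGradientAt.gradient (f' := -v⁻¹ • postMean ν v x) ?_
  rw [hasGradientAt_iff_hasFDerivAt]
  refine h.congr_fderiv ?_
  ext w
  simp
  field_simp

theorem fderiv_score_gaussMix (hv : 0 < v) (x : Vec d) :
    fderiv ℝ (score (gaussMix ν v)) x =
      -v⁻¹ • (ContinuousLinearMap.id ℝ _ - postCov ν v x) := by
  rw [score_gaussMix hv]
  exact ((hasFDerivAt_postMean hv x).const_smul (-v⁻¹)).fderiv

theorem continuous_postMean (hv : 0 < v) : Continuous (postMean ν v) :=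
  continuous_iff_continuousAt.2 fun x => (hasFDerivAt_postMean hv x).continuousAt

end Score

/-! ### Pointwise comparison of densities -/

section Pointwise

variable {d : ℕ} {ν : Measure (Vec d)} [IsProbabilityMeasure ν] {v : ℝ}

theorem integrable_post_iff {F : Type*} [NormedAddCommGroup F] [NormedSpace ℝ F] (hv : 0 < v)
    (x : Vec d) {f : Vec d → F} :
    Integrable f (post ν v x) ↔ Integrable (fun a => gaussDens v (x - a) • f a) ν := by
  have hp := mixDens_pos (ν := ν) hv x
  rw [post, integrable_withDensity_iff_integrable_smul' (by fun_prop) (by simp),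
    ← integrable_smul_iff (inv_ne_zero hp.ne') fun a => gaussDens v (x - a) • f a]
  refine integrable_congr (ae_of_all _ fun a => ?_)
  simp only [Pi.smul_apply]
  rw [ENNReal.toReal_ofReal (div_nonneg (gaussDens_pos hv _).le hp.le), smul_smul, div_eq_inv_mul]

/-- The posterior second moment of `√v w` given `a + √v w = x`. -/
def postSq (ν : Measure (Vec d)) (v : ℝ) (x : Vec d) : ℝ := ∫ a, ‖x - a‖ ^ 2 ∂(post ν v x)

theorem integrable_normSq_post (hv : 0 < v) (x : Vec d) :
    Integrable (fun a => ‖x - a‖ ^ 2) (post ν v x) :=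
  integrable_post hv x (by fun_prop) (B := 1) fun a => by
    rw [Real.norm_of_nonneg (by positivity)]; linarith

theorem integrable_inner_mul_inner_post (hv : 0 < v) (x u w : Vec d) :
    Integrable (fun a => inner ℝ (x - a) u * inner ℝ (x - a) w) (post ν v x) := by
  have := ((innerSL ℝ w).comp (ContinuousLinearMap.apply ℝ (Vec d) u)).integrable_comp
    (integrable_smulRight_post (ν := ν) hv x)
  refine this.congr (ae_of_all _ fun a => ?_)
  simp only [ContinuousLinearMap.comp_apply, ContinuousLinearMap.apply_apply,
    ContinuousLinearMap.smulRight_apply, innerSL_apply_apply, real_inner_smul_right,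
    real_inner_comm w]

theorem inner_postMean (hv : 0 < v) (x u : Vec d) :
    ∫ a, inner ℝ (x - a) u ∂(post ν v x) = inner ℝ (postMean ν v x) u := by
  have := (innerSL ℝ u).integral_comp_comm (integrable_sub_post (ν := ν) hv x)
  simp only [innerSL_apply_apply, real_inner_comm u] at this ⊢
  exact this

theorem inner_postCov (hv : 0 < v) (x u w : Vec d) :
    inner ℝ (postCov ν v x u) w = v⁻¹ * (∫ a, inner ℝ (x - a) u * inner ℝ (x - a) w ∂(post ν v x) -
      inner ℝ (postMean ν v x) u * inner ℝ (postMean ν v x) w) := by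
  have h := ((innerSL ℝ w).comp (ContinuousLinearMap.apply ℝ (Vec d) u)).integral_comp_comm
    (integrable_smulRight_post (ν := ν) hv x)
  simp only [ContinuousLinearMap.comp_apply, ContinuousLinearMap.apply_apply,
    ContinuousLinearMap.smulRight_apply, innerSL_apply_apply, real_inner_smul_right] at h
  rw [postCov, smul_apply, real_inner_smul_left, sub_apply, inner_sub_left,
    ContinuousLinearMap.smulRight_apply, real_inner_smul_left, innerSL_apply_apply,
    real_inner_comm w, ← h]
  simp only [real_inner_comm w]

theorem integral_inner_sub_sq_post (hv : 0 < v) (x u : Vec d) :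
    ∫ a, inner ℝ (x - a - postMean ν v x) u ^ 2 ∂(post ν v x) =
      ∫ a, inner ℝ (x - a) u * inner ℝ (x - a) u ∂(post ν v x) -
        inner ℝ (postMean ν v x) u * inner ℝ (postMean ν v x) u := by
  have := isProbabilityMeasure_post (ν := ν) hv x
  set m := postMean ν v x
  have h1 := integrable_inner_mul_inner_post (ν := ν) hv x u u
  have h2 : Integrable (fun a => inner ℝ (x - a) u) (post ν v x) := by
    refine ((innerSL ℝ u).integrable_comp (integrable_sub_post (ν := ν) hv x)).congr
      (ae_of_all _ fun a => ?_)
    simp [real_inner_comm]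
  have e : ∀ a : Vec d, inner ℝ (x - a - m) u ^ 2 = inner ℝ (x - a) u * inner ℝ (x - a) u -
      2 * inner ℝ m u * inner ℝ (x - a) u + inner ℝ m u * inner ℝ m u := by
    intro a
    rw [inner_sub_left]
    ring
  simp_rw [e]
  have h3 : Integrable (fun a => 2 * inner ℝ m u * inner ℝ (x - a) u) (post ν v x) := h2.const_mul _
  have h4 : Integrable (fun a => inner ℝ (x - a) u * inner ℝ (x - a) u -
    2 * inner ℝ m u * inner ℝ (x - a) u) (post ν v x) := h1.sub h3
  rw [integral_add h4 (integrable_const _), integral_sub h1 h3, integral_const_mul, inner_postMean hv]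
  simp
  ring

theorem exists_eigenbasis_postCov (hv : 0 < v) (x : Vec d) :
    ∃ (b : OrthonormalBasis (Fin d) ℝ (Vec d)) (l : Fin d → ℝ),
      (∀ i, postCov ν v x (b i) = l i • b i) ∧ (∀ i, 0 ≤ l i) ∧
      (∀ i, v * l i = ∫ a, inner ℝ (x - a - postMean ν v x) (b i) ^ 2 ∂(post ν v x)) ∧
      v * ∑ i, l i = postSq ν v x - ‖postMean ν v x‖ ^ 2 := by
  have hsymm : (postCov ν v x : Vec d →ₗ[ℝ] Vec d).IsSymmetric := by
    intro u w
    refine (inner_postCov hv x u w).trans (Eq.trans ?_ (real_inner_comm _ _))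
    refine Eq.trans ?_ (inner_postCov hv x w u).symm
    simp only [mul_comm]
  have hn : Module.finrank ℝ (Vec d) = d := finrank_euclideanSpace_fin
  let b := hsymm.eigenvectorBasis hn
  let l := hsymm.eigenvalues hn
  have hb : ∀ i, postCov ν v x (b i) = l i • b i := fun i => hsymm.apply_eigenvectorBasis hn i
  have hl' : ∀ i, v * l i = ∫ a, inner ℝ (x - a) (b i) * inner ℝ (x - a) (b i) ∂(post ν v x) -
        inner ℝ (postMean ν v x) (b i) * inner ℝ (postMean ν v x) (b i) := by
    intro i
    have h := inner_postCov (ν := ν) hv x (b i) (b i)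
    rw [hb, real_inner_smul_left, real_inner_self_eq_norm_sq, b.orthonormal.1 i] at h
    rw [show l i = l i * 1 ^ 2 by ring, h, mul_inv_cancel_left₀ hv.ne']
  have hl : ∀ i, v * l i = ∫ a, inner ℝ (x - a - postMean ν v x) (b i) ^ 2 ∂(post ν v x) :=
    fun i => (hl' i).trans (integral_inner_sub_sq_post hv x (b i)).symm
  refine ⟨b, l, hb, fun i => ?_, hl, ?_⟩
  · have : 0 ≤ v * l i := by rw [hl]; exact integral_nonneg fun a => sq_nonneg _
    exact nonneg_of_mul_nonneg_right this hv
  · rw [Finset.mul_sum]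
    simp_rw [hl']
    rw [Finset.sum_sub_distrib, ← integral_finsetSum _
      fun i _ => integrable_inner_mul_inner_post hv x _ _, postSq]
    congr 1
    · refine integral_congr_ae (ae_of_all _ fun a => ?_)
      simp only [← sq]
      exact b.sum_sq_inner_left (x - a)
    · simp only [← sq]
      exact b.sum_sq_inner_left _

/-- Lower bound for the ratio of two mixture densities, by Jensen's inequality. -/
theorem mul_exp_le_mixDens {v' : ℝ} (hv : 0 < v) (hv' : 0 < v') (x u : Vec d) :
    mixDens ν v x * ((v / v') ^ (d / 2 : ℝ) * Real.exp (postSq ν v x / (2 * v) -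
      (postSq ν v x + 2 * inner ℝ (postMean ν v x) u + ‖u‖ ^ 2) / (2 * v'))) ≤
      mixDens ν v' (x + u) := by
  have := isProbabilityMeasure_post (ν := ν) hv x
  set c := postSq ν v x / (2 * v) -
      (postSq ν v x + 2 * inner ℝ (postMean ν v x) u + ‖u‖ ^ 2) / (2 * v') with hc
  set F : Vec d → ℝ := fun a => ‖x - a‖ ^ 2 / (2 * v) -
    (‖x - a‖ ^ 2 + 2 * inner ℝ (x - a) u + ‖u‖ ^ 2) / (2 * v') with hF
  set κ := (v / v') ^ (d / 2 : ℝ) with hκ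
  have hκ0 : 0 < κ := by positivity
  have h2 : Integrable (fun a => inner ℝ (x - a) u) (post ν v x) := by
    refine ((innerSL ℝ u).integrable_comp (integrable_sub_post (ν := ν) hv x)).congr
      (ae_of_all _ fun a => ?_)
    simp [real_inner_comm]
  have hs := integrable_normSq_post (ν := ν) hv x
  have hs2 : Integrable (fun a => ‖x - a‖ ^ 2 + 2 * inner ℝ (x - a) u) (post ν v x) :=
    hs.add (h2.const_mul 2)
  have hs3 : Integrable (fun a => ‖x - a‖ ^ 2 + 2 * inner ℝ (x - a) u + ‖u‖ ^ 2) (post ν v x) :=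
    hs2.add (integrable_const _)
  have hFi : Integrable F (post ν v x) := (hs.div_const _).sub (hs3.div_const _)
  have hFc : ∫ a, F a ∂(post ν v x) = c := by
    rw [hF, integral_sub (hs.div_const _) (hs3.div_const _), integral_div, integral_div,
      integral_add hs2 (integrable_const _), integral_add hs (h2.const_mul 2), integral_const_mul,
      inner_postMean hv]
    simp [hc, postSq]
  -- Moving to `x + u` and noise `v'` reweights the integrand by `κ * exp (F a)`, so the quotient of
  -- the two mixture densities is the posterior mean of that weight.
  have hratio : ∀ a, gaussDens v' (x + u - a) = gaussDens v (x - a) * (κ * Real.exp (F a)) := by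
    intro a
    have e1 : x + u - a = (x - a) + u := by abel
    have e2 : (2 * Real.pi * v') ^ (-(d / 2) : ℝ) = (2 * Real.pi * v) ^ (-(d / 2) : ℝ) * κ := by
      rw [hκ, Real.rpow_neg (by positivity), Real.rpow_neg (by positivity),
        Real.div_rpow hv.le hv'.le, Real.mul_rpow (by positivity) hv.le,
        Real.mul_rpow (by positivity) hv'.le]
      have : (0 : ℝ) < (2 * Real.pi) ^ (d / 2 : ℝ) := by positivity
      have : (0 : ℝ) < v ^ (d / 2 : ℝ) := by positivity
      have : (0 : ℝ) < v' ^ (d / 2 : ℝ) := by positivity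
      field_simp
    rw [gaussDens, gaussDens, e2, e1, norm_add_sq_real, hF]
    rw [show (2 * Real.pi * v) ^ (-(d / 2) : ℝ) * Real.exp (-‖x - a‖ ^ 2 / (2 * v)) *
      (κ * Real.exp (‖x - a‖ ^ 2 / (2 * v) -
        (‖x - a‖ ^ 2 + 2 * inner ℝ (x - a) u + ‖u‖ ^ 2) / (2 * v'))) =
      (2 * Real.pi * v) ^ (-(d / 2) : ℝ) * κ * (Real.exp (-‖x - a‖ ^ 2 / (2 * v)) *
      Real.exp (‖x - a‖ ^ 2 / (2 * v) -
        (‖x - a‖ ^ 2 + 2 * inner ℝ (x - a) u + ‖u‖ ^ 2) / (2 * v'))) by ring, ← Real.exp_add]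
    congr 2
    ring
  -- Jensen in tangent-line form: `c` is the posterior mean of `F`, so the tangent to exp at `c`
  -- averages to `exp c`.
  have hpost : ∫ a, κ * Real.exp c * (1 + (F a - c)) ∂(post ν v x) = κ * Real.exp c := by
    have h1 : Integrable (fun a => F a - c) (post ν v x) := hFi.sub (integrable_const _)
    rw [integral_const_mul, integral_add (integrable_const _) h1, integral_sub hFi (integrable_const _), hFc]
    simp
  have hi : Integrable (fun a => κ * Real.exp c * (1 + (F a - c))) (post ν v x) :=
    ((integrable_const _).add (hFi.sub (integrable_const _))).const_mul _
  rw [← hpost, integral_post hv, smul_eq_mul, mul_inv_cancel_left₀ (mixDens_pos hv x).ne', mixDens]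
  have hi' := (integrable_post_iff hv x).1 hi
  simp only [smul_eq_mul] at hi'
  refine integral_mono hi' ?_ fun a => ?_
  · have := integrable_gaussDens_sub (ν := ν) hv' (x + u)
    exact this
  · simp only [smul_eq_mul]
    rw [hratio]
    refine mul_le_mul_of_nonneg_left ?_ (gaussDens_pos hv _).le
    rw [mul_assoc]
    refine mul_le_mul_of_nonneg_left ?_ hκ0.le
    have h3 := Real.add_one_le_exp (F a - c)
    calc Real.exp c * (1 + (F a - c)) ≤ Real.exp c * Real.exp (F a - c) := by gcongr; linarith
      _ = Real.exp (F a) := by rw [← Real.exp_add]; congr 1; ring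


end Pointwise

/-! ### Pointwise likelihood ratio of one sampler step -/

section OneStep

variable {d : ℕ} {ν : Measure (Vec d)} [IsProbabilityMeasure ν] {v : ℝ}

open Classical in
/-- The eigenvalues of `postCov ν v x`. -/
def postEig (ν : Measure (Vec d)) [IsProbabilityMeasure ν] (v : ℝ) (x : Vec d) : Fin d → ℝ :=
  if hv : 0 < v then (exists_eigenbasis_postCov (ν := ν) hv x).choose_spec.choose else 0

theorem postEig_spec (hv : 0 < v) (x : Vec d) :
    ∃ (b : OrthonormalBasis (Fin d) ℝ (Vec d)),
      (∀ i, postCov ν v x (b i) = postEig ν v x i • b i) ∧ (∀ i, 0 ≤ postEig ν v x i) ∧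
      (∀ i, v * postEig ν v x i =
        ∫ a, inner ℝ (x - a - postMean ν v x) (b i) ^ 2 ∂(post ν v x)) ∧
      v * ∑ i, postEig ν v x i = postSq ν v x - ‖postMean ν v x‖ ^ 2 := by
  rw [postEig, dif_pos hv]
  exact ⟨_, (exists_eigenbasis_postCov (ν := ν) hv x).choose_spec.choose_spec⟩

/-- The relative decrease of the posterior variance in a direction of eigenvalue `l`, summed over an
eigenbasis. -/
def varianceDrop (ν : Measure (Vec d)) [IsProbabilityMeasure ν] (v η : ℝ) (x : Vec d) : ℝ :=
  ∑ i, η * postEig ν v x i ^ 2 / (1 - η + η * postEig ν v x i)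

theorem varianceDrop_nonneg (hv : 0 < v) {η : ℝ} (hη : 0 < η) (hη' : η ≤ 1 / 2) (x : Vec d) :
    0 ≤ varianceDrop ν v η x := by
  obtain ⟨b, -, hl, -⟩ := postEig_spec (ν := ν) hv x
  refine Finset.sum_nonneg fun i _ => ?_
  have := hl i
  have : 0 ≤ 1 - η := by linarith
  positivity

/-- The semidefiniteness hypothesis scaled by `η * v / 2`. This coercivity serves twice: to compare
determinants and to prove that the step is injective. -/
theorem norm_le_norm_add_of_psd {J : Vec d →L[ℝ] Vec d} (hv : 0 < v)
    (hJ : ∀ w, 0 ≤ inner ℝ w (J w + v⁻¹ • w)) {η : ℝ} (hη : 0 < η) (w : Vec d) :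
    (1 - η / 2) * ‖w‖ ^ 2 ≤ inner ℝ w (w + (η * v / 2) • J w) := by
  have h := hJ w
  rw [inner_add_right, real_inner_smul_right, real_inner_self_eq_norm_sq] at h
  rw [inner_add_right, real_inner_smul_right, real_inner_self_eq_norm_sq]
  have h2 : 0 ≤ (η * v / 2) * (inner ℝ w (J w) + v⁻¹ * ‖w‖ ^ 2) := by positivity
  have h3 : (η * v / 2) * (v⁻¹ * ‖w‖ ^ 2) = η / 2 * ‖w‖ ^ 2 := by field_simp
  linarith

/-- For the exact score the determinant is a product over an eigenbasis of the posterior covariance.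
Bounding the determinant of the estimated step from below by it needs the estimated operator `A` to
be coercive, which is where semidefiniteness enters. -/
theorem log_det_ge (hv : 0 < v) {η : ℝ} (hη : 0 < η) (hη' : η ≤ 1 / 2) (x : Vec d)
    {J : Vec d →L[ℝ] Vec d} (hJ : ∀ w, 0 ≤ inner ℝ w (J w + v⁻¹ • w)) :
    0 < |(ContinuousLinearMap.id ℝ (Vec d) + (η * v / 2) • J).det| ∧
    η / 2 * (∑ i, postEig ν v x i - d) - η / 2 * varianceDrop ν v η x - d * η ^ 2 / 2 -
      2 / 3 * (d * (η * v * ‖J - fderiv ℝ (score (gaussMix ν v)) x‖)) ≤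
      Real.log |(ContinuousLinearMap.id ℝ (Vec d) + (η * v / 2) • J).det| := by
  set A := ContinuousLinearMap.id ℝ (Vec d) + (η * v / 2) • J with hA
  set S := fderiv ℝ (score (gaussMix ν v)) x with hS
  set B := ContinuousLinearMap.id ℝ (Vec d) + (η * v / 2) • S with hB
  have hc : 0 < 1 - η / 2 := by linarith
  have hAw : ∀ w, (1 - η / 2) * ‖w‖ ≤ ‖A w‖ := by
    intro w
    rcases eq_or_ne w 0 with rfl | hw
    · simp
    have h1 := norm_le_norm_add_of_psd hv hJ hη w
    have h2 : inner ℝ w (A w) ≤ ‖w‖ * ‖A w‖ := real_inner_le_norm _ _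
    have h3 : A w = w + (η * v / 2) • J w := rfl
    rw [← h3] at h1
    have hw' : 0 < ‖w‖ := norm_pos_iff.2 hw
    refine le_of_mul_le_mul_left ?_ hw'
    nlinarith
  obtain ⟨hdet, hle⟩ := abs_det_le_abs_det_mul_pow A B hc hAw
  refine ⟨hdet, ?_⟩
  obtain ⟨b, hb, hl, -, -⟩ := postEig_spec (ν := ν) hv x
  have hBdet : B.det = ∏ i, (1 - η / 2 + η / 2 * postEig ν v x i) := by
    refine det_eq_prod_of_apply_basis b.toBasis (B : Vec d →ₗ[ℝ] Vec d) _ fun i => ?_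
    rw [OrthonormalBasis.coe_toBasis]
    change b i + (η * v / 2) • S (b i) = _
    rw [hS, fderiv_score_gaussMix hv]
    change b i + (η * v / 2) • (-v⁻¹ • (b i - postCov ν v x (b i))) = _
    rw [hb, smul_smul, show η * v / 2 * -v⁻¹ = -(η / 2) by field_simp]
    module
  have hpos : ∀ i, 0 < 1 - η / 2 + η / 2 * postEig ν v x i := fun i => by
    have := hl i
    positivity
  have hB0 : 0 < |B.det| := by
    rw [hBdet]
    exact abs_pos.2 (Finset.prod_pos fun i _ => hpos i).ne'
  have hlogB : η / 2 * (∑ i, postEig ν v x i - d) - η / 2 * varianceDrop ν v η x - d * η ^ 2 / 2 ≤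
      Real.log |B.det| := by
    rw [hBdet, Finset.abs_prod, Real.log_prod fun i _ => (abs_pos.2 (hpos i).ne').ne']
    calc _ = ∑ i, (η / 2 * (postEig ν v x i - 1) - η / 2 * (η * postEig ν v x i ^ 2 /
            (1 - η + η * postEig ν v x i)) - η ^ 2 / 2) := by
          rw [Finset.sum_sub_distrib, Finset.sum_sub_distrib, ← Finset.mul_sum, ← Finset.mul_sum,
            Finset.sum_sub_distrib, varianceDrop]
          simp
          ring
      _ ≤ _ := by
          refine Finset.sum_le_sum fun i _ => ?_
          rw [abs_of_pos (hpos i)]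
          exact le_log_eigenvalue hη hη' (hl i)
  -- The constant is (1/2) / (1 - η/2) ≤ (1/2) / (3/4) = 2/3 for η ≤ 1/2.
  have hBA : ‖B - A‖ / (1 - η / 2) ≤ 2 / 3 * (η * v * ‖J - S‖) := by
    have : B - A = -((η * v / 2) • (J - S)) := by
      rw [hA, hB, smul_sub]; abel
    rw [this, norm_neg, norm_smul, Real.norm_of_nonneg (by positivity), div_le_iff₀ hc]
    have : 0 ≤ η * v * ‖J - S‖ := by positivity
    nlinarith
  have hlog : Real.log |B.det| ≤ Real.log |A.det| + d * (2 / 3 * (η * v * ‖J - S‖)) := by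
    have h1 := Real.log_le_log hB0 hle
    rw [finrank_euclideanSpace_fin, Real.log_mul hdet.ne' (by positivity), Real.log_pow] at h1
    have h2 := Real.log_le_sub_one_of_pos (x := 1 + ‖B - A‖ / (1 - η / 2)) (by positivity)
    have h3 : (d : ℝ) * Real.log (1 + ‖B - A‖ / (1 - η / 2)) ≤
      d * (2 / 3 * (η * v * ‖J - S‖)) := by gcongr; linarith
    linarith
  linarith

/-- The bound on the negative log-likelihood ratio of one step. -/
def stepBound (ν : Measure (Vec d)) [IsProbabilityMeasure ν] (v η : ℝ) (s : Vec d → Vec d)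
    (x : Vec d) : ℝ :=
  η / 2 * varianceDrop ν v η x + d * η ^ 2 / 2 + η ^ 2 * postSq ν v x / v +
    η * ‖postMean ν v x‖ * ‖s x - score (gaussMix ν v) x‖ +
    η ^ 2 * v * ‖s x - score (gaussMix ν v) x‖ ^ 2 / 4 +
    2 / 3 * (d * (η * v * ‖fderiv ℝ s x - fderiv ℝ (score (gaussMix ν v)) x‖))

/-- Here `S2`, `L`, `M`, `E` stand for the posterior second moment, the trace of the posterior
covariance, the norm of the posterior mean and the score error. The leading term `η / 2 * L` is the
one cancelled by the log-determinant; replacing 1/(1 - η) by 1 in it costs a term of order η². -/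
theorem exponent_bound {η V S2 L M2 ip E M w2 : ℝ} (hη : 0 < η) (hη' : η ≤ 1 / 2) (hV : 0 < V)
    (hS : S2 = M2 + V * L) (hL : 0 ≤ L) (hM2 : M2 = M ^ 2) (hip : ip ≤ M * E) (hip' : -(M * E) ≤ ip)
    (hw : w2 = E ^ 2) :
    (S2 + (2 * (-(η / 2) * M2 + η * V / 2 * ip)) +
      (η ^ 2 / 4 * M2 - η * (η * V / 2) * ip + (η * V / 2) ^ 2 * w2)) / (2 * ((1 - η) * V))
      - S2 / (2 * V) ≤
      η / 2 * L + η ^ 2 * S2 / V + η * M * E + η ^ 2 * V * E ^ 2 / 4 := by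
  subst hw
  have h1 : 0 < 1 - η := by linarith
  have hM0 : 0 ≤ M2 := by rw [hM2]; positivity
  have e : (S2 + (2 * (-(η / 2) * M2 + η * V / 2 * ip)) +
      (η ^ 2 / 4 * M2 - η * (η * V / 2) * ip + (η * V / 2) ^ 2 * E ^ 2)) / (2 * ((1 - η) * V))
      - S2 / (2 * V) = (η * L + η ^ 2 / 4 * (M2 / V) + η * (2 - η) / 2 * ip + η ^ 2 / 4 * V * E ^ 2) /
        (2 * (1 - η)) := by
    rw [hS]
    field_simp
    ring
  rw [e, div_le_iff₀ (by linarith)]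
  have e2 : η ^ 2 * S2 / V = η ^ 2 * (M2 / V) + η ^ 2 * L := by
    rw [hS]; field_simp
  rw [e2]
  set q := M2 / V with hq
  have hq0 : 0 ≤ q := by positivity
  have hME : 0 ≤ M * E := by linarith
  have t1 : η * L ≤ (η / 2 * L + η ^ 2 * L) * (2 * (1 - η)) := by
    nlinarith [mul_nonneg (mul_nonneg (sq_nonneg η) hL) (by linarith : 0 ≤ 1 / 2 - η)]
  have t2 : η ^ 2 / 4 * q ≤ η ^ 2 * q * (2 * (1 - η)) := by
    nlinarith [mul_nonneg (sq_nonneg η) hq0]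
  have t3 : η * (2 - η) / 2 * ip ≤ η * (M * E) * (2 * (1 - η)) := by
    have : η * (2 - η) / 2 * ip ≤ η * (2 - η) / 2 * (M * E) := by
      gcongr
      nlinarith
    nlinarith [mul_nonneg hη.le hME]
  have t4 : η ^ 2 / 4 * V * E ^ 2 ≤ η ^ 2 * V * E ^ 2 / 4 * (2 * (1 - η)) := by
    have : 0 ≤ η ^ 2 * V * E ^ 2 := by positivity
    nlinarith
  nlinarith

/-- With R = `D * (ρ * exp c)`, use 1 - R ≤ -log R. To first order, log `D` gives (η/2)(∑ l - d),
the normalizing constants give dη/2 and the Jensen exponent gives -(η/2) ∑ l. These cancel, and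
`stepBound` collects the rest. -/
theorem mixDens_sub_le (hv : 0 < v) {η : ℝ} (hη : 0 < η) (hη' : η ≤ 1 / 2) {s : Vec d → Vec d}
    (hs : JacobianAddPSD s v⁻¹) (x : Vec d) :
    mixDens ν v x - |(fderiv ℝ (fun x => x + (η * v / 2) • s x) x).det| *
      mixDens ν ((1 - η) * v) (x + (η * v / 2) • s x) ≤ mixDens ν v x * stepBound ν v η s x := by
  have hp := mixDens_pos (ν := ν) hv x
  have h1η : 0 < 1 - η := by linarith
  have hfd : fderiv ℝ (fun x => x + (η * v / 2) • s x) x =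
      ContinuousLinearMap.id ℝ (Vec d) + (η * v / 2) • fderiv ℝ s x :=
    ((hasFDerivAt_id x).add ((hs.1 x).hasFDerivAt.const_smul (η * v / 2))).fderiv
  rw [hfd]
  obtain ⟨hdet, hlog⟩ := log_det_ge (ν := ν) hv hη hη' x (hs.2 x)
  set D := |(ContinuousLinearMap.id ℝ (Vec d) + (η * v / 2) • fderiv ℝ s x).det| with hD
  have hJ := mul_exp_le_mixDens (ν := ν) (v' := (1 - η) * v) hv (by positivity) x
    ((η * v / 2) • s x)
  set m := postMean ν v x with hm
  set e := s x - score (gaussMix ν v) x with he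
  obtain ⟨-, -, hl, -, hsum⟩ := postEig_spec (ν := ν) hv x
  set ρ := (v / ((1 - η) * v)) ^ (d / 2 : ℝ) with hρ
  have hρ0 : 0 < ρ := by positivity
  have hlogρ : d * η / 2 ≤ Real.log ρ := by
    rw [hρ, Real.log_rpow (by positivity), show v / ((1 - η) * v) = (1 - η)⁻¹ by field_simp,
      Real.log_inv]
    have := Real.log_le_sub_one_of_pos h1η
    have hd : (0 : ℝ) ≤ d / 2 := by positivity
    nlinarith
  have hu : (η * v / 2) • s x = -(η / 2) • m + (η * v / 2) • e := by
    rw [he, score_gaussMix hv]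
    simp only
    rw [smul_sub, smul_smul, show η * v / 2 * -v⁻¹ = -(η / 2) by field_simp]
    module
  have hexp := exponent_bound (η := η) (V := v) (S2 := postSq ν v x) (L := ∑ i, postEig ν v x i)
    (M2 := ‖m‖ ^ 2) (ip := inner ℝ m e) (E := ‖e‖) (M := ‖m‖) (w2 := ‖e‖ ^ 2) hη hη' hv
    (by linarith) (Finset.sum_nonneg fun i _ => hl i) rfl (real_inner_le_norm _ _)
    (neg_le_of_abs_le (abs_real_inner_le_norm _ _)) rfl
  set c := postSq ν v x / (2 * v) - (postSq ν v x + 2 * inner ℝ m ((η * v / 2) • s x) +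
    ‖(η * v / 2) • s x‖ ^ 2) / (2 * ((1 - η) * v)) with hc
  have hcle : -c ≤ η / 2 * (∑ i, postEig ν v x i) + η ^ 2 * postSq ν v x / v + η * ‖m‖ * ‖e‖ +
      η ^ 2 * v * ‖e‖ ^ 2 / 4 := by
    refine le_trans (le_of_eq ?_) hexp
    rw [hc, hu, inner_add_right, real_inner_smul_right, real_inner_smul_right, norm_add_sq_real,
      real_inner_self_eq_norm_sq, real_inner_smul_left, real_inner_smul_right, norm_smul, norm_smul,
      mul_pow, mul_pow, Real.norm_eq_abs, Real.norm_eq_abs, sq_abs, sq_abs]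
    ring
  have hR : Real.log (D * (ρ * Real.exp c)) = Real.log D + (Real.log ρ + c) := by
    rw [Real.log_mul hdet.ne' (by positivity), Real.log_mul hρ0.ne' (Real.exp_pos _).ne',
      Real.log_exp]
  have h1R := Real.log_le_sub_one_of_pos (x := D * (ρ * Real.exp c)) (by positivity)
  have hfin : 1 - D * (ρ * Real.exp c) ≤ stepBound ν v η s x := by
    rw [stepBound]
    linarith
  calc _ ≤ mixDens ν v x - D * (mixDens ν v x * (ρ * Real.exp c)) := by gcongr
    _ = mixDens ν v x * (1 - D * (ρ * Real.exp c)) := by ring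
    _ ≤ _ := by gcongr

end OneStep

/-! ### Gaussian moments -/

theorem memLp_inner_stdGaussian {d : ℕ} (b : Vec d) :
    MemLp (fun w => inner ℝ w b) 2 (stdGaussian (Vec d)) := by
  refine (IsGaussian.memLp_dual (stdGaussian (Vec d)) (innerSL ℝ b) 2 (by simp)).ae_eq
    (ae_of_all _ fun w => ?_)
  simp [real_inner_comm]

theorem integrable_add_mul_inner_sq {d : ℕ} (b : Vec d) (p q : ℝ) :
    Integrable (fun w => (p + q * inner ℝ w b) ^ 2) (stdGaussian (Vec d)) :=
  ((memLp_const p).add ((memLp_inner_stdGaussian b).const_mul q)).integrable_sq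

theorem integral_add_mul_inner_sq {d : ℕ} {b : Vec d} (hb : ‖b‖ = 1) (p q : ℝ) :
    ∫ w, (p + q * inner ℝ w b) ^ 2 ∂(stdGaussian (Vec d)) = p ^ 2 + q ^ 2 := by
  have h1 : ∫ w, inner ℝ w b ∂(stdGaussian (Vec d)) = 0 := by
    have := integral_strongDual_stdGaussian (E := Vec d) (innerSL ℝ b)
    simpa [real_inner_comm] using this
  have h2 : ∫ w, (inner ℝ w b) ^ 2 ∂(stdGaussian (Vec d)) = 1 := by
    have := variance_dual_stdGaussian (E := Vec d) (innerSL ℝ b)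
    rw [variance_eq_integral (by fun_prop), integral_strongDual_stdGaussian, innerSL_apply_norm,
      hb] at this
    simpa [real_inner_comm] using this
  have hi := (memLp_inner_stdGaussian b)
  have hi1 : Integrable (fun w => inner ℝ w b) (stdGaussian (Vec d)) := hi.integrable (by simp)
  have e : ∀ w : Vec d, (p + q * inner ℝ w b) ^ 2 =
      p ^ 2 + (2 * p * q * inner ℝ w b + q ^ 2 * (inner ℝ w b) ^ 2) := fun w => by ring
  simp_rw [e]
  have i1 : Integrable (fun w => 2 * p * q * inner ℝ w b) (stdGaussian (Vec d)) := hi1.const_mul _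
  have i2 : Integrable (fun w => q ^ 2 * (inner ℝ w b) ^ 2) (stdGaussian (Vec d)) :=
    hi.integrable_sq.const_mul _
  have i3 : Integrable (fun w => 2 * p * q * inner ℝ w b + q ^ 2 * (inner ℝ w b) ^ 2)
    (stdGaussian (Vec d)) := i1.add i2
  rw [integral_add (integrable_const _) i3, integral_add i1 i2, integral_const_mul,
    integral_const_mul, h1, h2]
  simp

theorem lintegral_normSq_stdGaussian (d : ℕ) :
    ∫⁻ w, ENNReal.ofReal (‖w‖ ^ 2) ∂(stdGaussian (Vec d)) = d := by
  let b := stdOrthonormalBasis ℝ (Vec d)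
  have h : ∀ w : Vec d, ‖w‖ ^ 2 = ∑ i, (0 + 1 * inner ℝ w (b i)) ^ 2 := fun w => by
    simpa using (b.sum_sq_inner_left w).symm
  simp_rw [h]
  rw [← ofReal_integral_eq_lintegral_ofReal
    (integrable_finsetSum _ fun i _ => integrable_add_mul_inner_sq _ _ _)
    (ae_of_all _ fun w => Finset.sum_nonneg fun i _ => sq_nonneg _),
    integral_finsetSum _ fun i _ => integrable_add_mul_inner_sq _ _ _]
  simp_rw [integral_add_mul_inner_sq (b.orthonormal.1 _)]
  simp

theorem postSq_nonneg {d : ℕ} (ν : Measure (Vec d)) (v : ℝ) (x : Vec d) : 0 ≤ postSq ν v x :=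
  integral_nonneg fun _ => sq_nonneg _

/-! ### Total variation error of one sampler step -/

section OneStepTV

variable {d : ℕ} {ν : Measure (Vec d)} [IsProbabilityMeasure ν] {v : ℝ}

theorem ofReal_postSq (hv : 0 < v) (x : Vec d) :
    ENNReal.ofReal (postSq ν v x) = ∫⁻ a, ENNReal.ofReal (‖x - a‖ ^ 2) ∂(post ν v x) :=
  ofReal_integral_eq_lintegral_ofReal (integrable_normSq_post hv x) (ae_of_all _ fun _ => sq_nonneg _)

theorem measurable_postSq (hv : 0 < v) : Measurable (postSq ν v) := by
  have h := (measurable_lintegral_post (ν := ν) hv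
    (f := fun x a => ENNReal.ofReal (‖x - a‖ ^ 2)) (by fun_prop)).ennreal_toReal
  convert h using 2 with x
  rw [← ofReal_postSq hv, ENNReal.toReal_ofReal (postSq_nonneg ν v x)]

/-- By disintegration this is the mean of ‖√v w‖² for a standard Gaussian w, whatever the signal. -/
theorem lintegral_postSq (hv : 0 < v) :
    ∫⁻ x, ENNReal.ofReal (postSq ν v x) ∂(gaussMix ν v) = ENNReal.ofReal (v * d) := by
  simp_rw [ofReal_postSq hv]
  rw [lintegral_gaussMix_post hv (by fun_prop)]
  have e : ∀ a w : Vec d, ENNReal.ofReal (‖a + √v • w - a‖ ^ 2) =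
      ENNReal.ofReal v * ENNReal.ofReal (‖w‖ ^ 2) := by
    intro a w
    rw [add_sub_cancel_left, norm_smul, mul_pow, Real.norm_of_nonneg (Real.sqrt_nonneg v),
      Real.sq_sqrt hv.le, ENNReal.ofReal_mul hv.le]
  simp_rw [e]
  rw [lintegral_const_mul _ (by fun_prop), lintegral_normSq_stdGaussian]
  simp [ENNReal.ofReal_mul hv.le]

theorem normSq_postMean_le (hv : 0 < v) (x : Vec d) : ‖postMean ν v x‖ ^ 2 ≤ postSq ν v x := by
  obtain ⟨-, -, hl, -, h⟩ := postEig_spec (ν := ν) hv x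
  have : 0 ≤ v * ∑ i, postEig ν v x i := mul_nonneg hv.le (Finset.sum_nonneg fun i _ => hl i)
  linarith

/-- Along the segment from `y` to `x` the component of the step in the direction `x - y` has
positive derivative by coercivity, so the endpoints cannot share an image. -/
theorem injective_step (hv : 0 < v) {η : ℝ} (hη : 0 < η) (hη' : η ≤ 1 / 2) {s : Vec d → Vec d}
    (hs : JacobianAddPSD s v⁻¹) : Function.Injective fun x => x + (η * v / 2) • s x := by
  intro y x hyx
  by_contra hne
  set w := x - y with hw
  have hw0 : 0 < ‖w‖ := norm_pos_iff.2 (sub_ne_zero.2 (Ne.symm hne))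
  set g : ℝ → ℝ := fun t => inner ℝ w ((y + t • w) + (η * v / 2) • s (y + t • w)) with hg
  have hder : ∀ t, HasDerivAt g (inner ℝ w (w + (η * v / 2) • fderiv ℝ s (y + t • w) w)) t := by
    intro t
    have h1 : HasDerivAt (fun t : ℝ => y + t • w) w t := by
      simpa using ((hasDerivAt_id t).smul_const w).const_add y
    have h2 := (hs.1 (y + t • w)).hasFDerivAt.comp_hasDerivAt t h1
    exact ((innerSL ℝ w).hasFDerivAt.comp_hasDerivAt t (h1.add (h2.const_smul (η * v / 2))))
  have hmono : StrictMono g := by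
    refine strictMono_of_deriv_pos fun t => ?_
    rw [(hder t).deriv]
    have := norm_le_norm_add_of_psd hv (hs.2 (y + t • w)) hη w
    have h3 : 0 < (1 - η / 2) * ‖w‖ ^ 2 := mul_pos (by linarith) (by positivity)
    linarith
  have h01 := hmono zero_lt_one
  simp only [hg, zero_smul, add_zero, one_smul, hw, add_sub_cancel] at h01
  simp only at hyx
  rw [hyx] at h01
  exact lt_irrefl _ h01

theorem tvDist_step_le_lintegral (hv : 0 < v) {η : ℝ} (hη : 0 < η) (hη' : η ≤ 1 / 2)
    {s : Vec d → Vec d} (hs : JacobianAddPSD s v⁻¹) :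
    tvDist (gaussMix ν ((1 - η) * v)) ((gaussMix ν v).map fun x => x + (η * v / 2) • s x) ≤
      ∫⁻ x, ENNReal.ofReal (stepBound ν v η s x) ∂(gaussMix ν v) := by
  have hv' : 0 < (1 - η) * v := mul_pos (by linarith) hv
  have hpm := (continuous_mixDens (ν := ν) hv).measurable.ennreal_ofReal
  have hqm := (continuous_mixDens (ν := ν) hv').measurable.ennreal_ofReal
  have i1 : IsProbabilityMeasure (volume.withDensity fun x => ENNReal.ofReal (mixDens ν v x)) := by
    rw [← gaussMix_eq_withDensity hv]; infer_instance
  have i2 : IsProbabilityMeasure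
      (volume.withDensity fun x => ENNReal.ofReal (mixDens ν ((1 - η) * v) x)) := by
    rw [← gaussMix_eq_withDensity hv']; infer_instance
  rw [gaussMix_eq_withDensity hv, gaussMix_eq_withDensity hv']
  have hT : Differentiable ℝ fun x => x + (η * v / 2) • s x :=
    differentiable_id.add (hs.1.fun_const_smul _)
  refine (tvDist_map_withDensity_le hqm hT (injective_step hv hη hη' hs)).trans ?_
  rw [lintegral_withDensity_eq_lintegral_mul_non_measurable _ hpm (by simp)]
  refine lintegral_mono fun x => ?_
  rw [Pi.mul_apply, ← ENNReal.ofReal_mul (abs_nonneg _), ← ENNReal.ofReal_sub _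
    (mul_nonneg (abs_nonneg _) (mixDens_pos hv' _).le), ← ENNReal.ofReal_mul (mixDens_pos hv x).le]
  exact ENNReal.ofReal_le_ofReal (mixDens_sub_le hv hη hη' hs x)

/-- Young's inequality with weight `θ` on the cross term, then ‖m‖² ≤ `postSq`. The weight stays
free so that it can be tuned to the total score error after summation. -/
theorem stepBound_le (hv : 0 < v) {η θ : ℝ} (hη : 0 < η) (hθ : 0 < θ) (s : Vec d → Vec d)
    (x : Vec d) :
    stepBound ν v η s x ≤ η / 2 * varianceDrop ν v η x + (d * η ^ 2 / 2 +
      ((η ^ 2 + η / (2 * θ)) / v * postSq ν v x +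
      ((η * θ / 2 + η ^ 2 / 4) * v * ‖s x - score (gaussMix ν v) x‖ ^ 2 +
      2 / 3 * (d * (η * v)) * ‖fderiv ℝ s x - fderiv ℝ (score (gaussMix ν v)) x‖))) := by
  rw [stepBound]
  set e := ‖s x - score (gaussMix ν v) x‖
  have h := normSq_postMean_le (ν := ν) hv x
  set m := ‖postMean ν v x‖
  have h1 : η * m * e ≤ η / (2 * θ) / v * m ^ 2 + η * θ / 2 * v * e ^ 2 := by
    have : η / (2 * θ) / v * m ^ 2 + η * θ / 2 * v * e ^ 2 - η * m * e =
        η / (2 * θ * v) * (m - θ * v * e) ^ 2 := by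
      field_simp
      ring
    have h2 : 0 ≤ η / (2 * θ * v) * (m - θ * v * e) ^ 2 := by positivity
    linarith
  have h2 : η / (2 * θ) / v * m ^ 2 ≤ η / (2 * θ) / v * postSq ν v x := by gcongr
  have h3 : (η ^ 2 + η / (2 * θ)) / v * postSq ν v x =
    η ^ 2 * postSq ν v x / v + η / (2 * θ) / v * postSq ν v x := by ring
  rw [h3]
  linarith

/-- Total variation error of one step of the sampler. -/
theorem tvDist_step_le (hv : 0 < v) {η θ : ℝ} (hη : 0 < η) (hη' : η ≤ 1 / 2) (hθ : 0 < θ)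
    {s : Vec d → Vec d} (hs : JacobianAddPSD s v⁻¹) :
    tvDist (gaussMix ν ((1 - η) * v)) ((gaussMix ν v).map fun x => x + (η * v / 2) • s x) ≤
      ENNReal.ofReal (η / 2) * ∫⁻ x, ENNReal.ofReal (varianceDrop ν v η x) ∂(gaussMix ν v) +
      (ENNReal.ofReal (3 / 2 * d * η ^ 2 + d * η / (2 * θ)) +
      (ENNReal.ofReal ((η * θ / 2 + η ^ 2 / 4) * v) *
        ∫⁻ x, ‖s x - score (gaussMix ν v) x‖ₑ ^ 2 ∂(gaussMix ν v) +
      ENNReal.ofReal (2 / 3 * (d * (η * v))) *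
        ∫⁻ x, ‖fderiv ℝ s x - fderiv ℝ (score (gaussMix ν v)) x‖ₑ ∂(gaussMix ν v))) := by
  refine (tvDist_step_le_lintegral hv hη hη' hs).trans ?_
  have hsm : Measurable s := hs.1.continuous.measurable
  have hscm : Measurable (score (gaussMix ν v)) := by
    rw [score_gaussMix hv]
    exact ((continuous_postMean hv).const_smul (-v⁻¹)).measurable
  have m4 : Measurable fun x => ‖fderiv ℝ s x - fderiv ℝ (score (gaussMix ν v)) x‖ₑ :=
    ((measurable_fderiv ℝ s).sub (measurable_fderiv ℝ _)).enorm
  have m3 : Measurable fun x => ‖s x - score (gaussMix ν v) x‖ₑ ^ 2 := by fun_prop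
  have m2 := (measurable_postSq (ν := ν) hv).ennreal_ofReal
  have hpt : ∀ x, ENNReal.ofReal (stepBound ν v η s x) ≤
      ENNReal.ofReal (η / 2) * ENNReal.ofReal (varianceDrop ν v η x) +
      (ENNReal.ofReal (d * η ^ 2 / 2) +
      (ENNReal.ofReal ((η ^ 2 + η / (2 * θ)) / v) * ENNReal.ofReal (postSq ν v x) +
      (ENNReal.ofReal ((η * θ / 2 + η ^ 2 / 4) * v) * ‖s x - score (gaussMix ν v) x‖ₑ ^ 2 +
      ENNReal.ofReal (2 / 3 * (d * (η * v))) *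
        ‖fderiv ℝ s x - fderiv ℝ (score (gaussMix ν v)) x‖ₑ))) := by
    intro x
    refine (ENNReal.ofReal_le_ofReal (stepBound_le hv hη hθ s x)).trans ?_
    refine ENNReal.ofReal_add_le.trans (add_le_add (ENNReal.ofReal_mul (by positivity)).le ?_)
    refine ENNReal.ofReal_add_le.trans (add_le_add le_rfl ?_)
    refine ENNReal.ofReal_add_le.trans (add_le_add (ENNReal.ofReal_mul (by positivity)).le ?_)
    refine ENNReal.ofReal_add_le.trans (add_le_add ?_ ?_)
    · rw [ENNReal.ofReal_mul (by positivity), ENNReal.ofReal_pow (norm_nonneg _), ofReal_norm]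
    · rw [ENNReal.ofReal_mul (by positivity), ofReal_norm]
  refine (lintegral_mono hpt).trans ?_
  -- The eigenvalues are chosen point by point, so `varianceDrop` comes with no measurability; it is
  -- split off using the measurability of the other summands.
  rw [lintegral_add_right _ (by fun_prop), lintegral_const_mul' _ _ ENNReal.ofReal_ne_top,
    lintegral_add_left (by fun_prop), lintegral_add_left (by fun_prop),
    lintegral_add_left (by fun_prop), lintegral_const_mul _ m2, lintegral_const_mul _ m3,
    lintegral_const_mul _ m4, lintegral_postSq hv, ← add_assoc (∫⁻ _, ENNReal.ofReal (d * η ^ 2 / 2) ∂_)]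
  refine add_le_add le_rfl (add_le_add (le_of_eq ?_) le_rfl)
  rw [lintegral_const, measure_univ, mul_one, ← ENNReal.ofReal_mul (by positivity),
    ← ENNReal.ofReal_add (by positivity) (by positivity)]
  congr 1
  field_simp
  ring

end OneStepTV

/-! ### Minimum mean square error along the forward process -/

/-- Gaussian bridge: if y adds noise of variance (1 - η)v to a, and x adds ηv to y, then given a and
x the point y is Gaussian about x - η(x - a) with variance η(1 - η)v. -/
theorem gaussDens_mul_gaussDens {d : ℕ} {v η : ℝ} (hv : 0 < v) (hη : 0 < η) (hη' : η < 1)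
    (a x y : Vec d) :
    gaussDens (η * v) (x - y) * gaussDens ((1 - η) * v) (y - a) =
      gaussDens v (x - a) * gaussDens (η * (1 - η) * v) (y - (x - η • (x - a))) := by
  have h1 : 0 < 1 - η := by linarith
  have hpi := Real.pi_pos
  obtain ⟨p, rfl⟩ : ∃ p, y = p + a := ⟨y - a, by abel⟩
  obtain ⟨q, rfl⟩ : ∃ q, x = q + p + a := ⟨x - p - a, by abel⟩
  rw [show q + p + a - (p + a) = q by abel, show p + a - a = p by abel,
    show q + p + a - a = q + p by abel,
    show p + a - (q + p + a - η • (q + p)) = η • p - (1 - η) • q by module]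
  unfold gaussDens
  rw [mul_mul_mul_comm, mul_mul_mul_comm ((2 * Real.pi * v) ^ (-(d / 2) : ℝ)),
    ← Real.mul_rpow (by positivity) (by positivity), ← Real.mul_rpow (by positivity) (by positivity),
    ← Real.exp_add, ← Real.exp_add]
  congr 2
  · ring
  · rw [norm_add_sq_real, norm_sub_sq_real, norm_smul, norm_smul, real_inner_smul_left,
      real_inner_smul_right, mul_pow, mul_pow, Real.norm_eq_abs, Real.norm_eq_abs, sq_abs, sq_abs,
      real_inner_comm]
    field_simp
    ring

theorem lintegral_gaussDens_sub {d : ℕ} {v : ℝ} (hv : 0 < v) (y : Vec d) :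
    ∫⁻ x, ENNReal.ofReal (gaussDens v (x - y)) = 1 := by
  have := lintegral_stdGaussian_add_smul hv y (f := fun _ => 1) measurable_const
  simpa using this.symm

/-- Error along one eigendirection: a coordinate of variance vl is predicted from an observation of
slope η and noise variance η(1 - η)v, with the optimal coefficient l/(1 - η + ηl). -/
theorem linear_estimator_error {η v l : ℝ} (h : 1 - η + η * l ≠ 0) :
    (1 - l / (1 - η + η * l) * η) ^ 2 * (v * l) + (l / (1 - η + η * l)) ^ 2 * (η * (1 - η) * v) =
      v * l * (1 - η) / (1 - η + η * l) := by
  obtain ⟨t, ht⟩ : ∃ t, t = 1 - η + η * l := ⟨_, rfl⟩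
  have h1 : 1 - η = t - η * l := by linarith
  rw [← ht] at h ⊢
  rw [h1]
  field_simp
  ring

theorem linear_estimator_error_add {η v l : ℝ} (h : 1 - η + η * l ≠ 0) :
    v * l * (1 - η) / (1 - η + η * l) + v * (η * l ^ 2 / (1 - η + η * l)) = v * l := by
  obtain ⟨t, ht⟩ : ∃ t, t = 1 - η + η * l := ⟨_, rfl⟩
  have h1 : 1 - η = t - η * l := by linarith
  rw [← ht] at h ⊢
  rw [h1]
  field_simp
  ring

section MMSE

variable {d : ℕ} {ν : Measure (Vec d)} [IsProbabilityMeasure ν] {v : ℝ}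

/-- The posterior variance of `a` given `a + √v w = x`. -/
def postVar (ν : Measure (Vec d)) (v : ℝ) (x : Vec d) : ℝ := postSq ν v x - ‖postMean ν v x‖ ^ 2

/-- The minimum mean square error for the estimation of `a` from `a + √v w`. -/
def mmse (ν : Measure (Vec d)) (v : ℝ) : ℝ≥0∞ :=
  ∫⁻ x, ENNReal.ofReal (postVar ν v x) ∂(gaussMix ν v)

theorem measurable_postVar (hv : 0 < v) : Measurable (postVar ν v) :=
  (measurable_postSq hv).sub ((continuous_postMean hv).norm.pow 2).measurable

theorem mmse_le (hv : 0 < v) : mmse ν v ≤ ENNReal.ofReal (v * d) := by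
  rw [← lintegral_postSq (ν := ν) hv]
  exact lintegral_mono fun x => ENNReal.ofReal_le_ofReal (sub_le_self _ (sq_nonneg _))

/-- The posterior mean minimizes the mean square error; using `c` instead costs the squared distance
from `c` to it. -/
theorem ofReal_postVar_le (hv : 0 < v) (x c : Vec d) :
    ENNReal.ofReal (postVar ν v x) ≤ ∫⁻ a, ENNReal.ofReal (‖a - c‖ ^ 2) ∂(post ν v x) := by
  have := isProbabilityMeasure_post (ν := ν) hv x
  set u := c - x with hu
  have h2 : Integrable (fun a => inner ℝ (x - a) u) (post ν v x) := by
    refine ((innerSL ℝ u).integrable_comp (integrable_sub_post (ν := ν) hv x)).congr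
      (ae_of_all _ fun a => ?_)
    simp [real_inner_comm]
  have hs := integrable_normSq_post (ν := ν) hv x
  have hs2 : Integrable (fun a => ‖x - a‖ ^ 2 + 2 * inner ℝ (x - a) u) (post ν v x) :=
    hs.add (h2.const_mul 2)
  have e : ∀ a : Vec d, ‖a - c‖ ^ 2 = ‖x - a‖ ^ 2 + 2 * inner ℝ (x - a) u + ‖u‖ ^ 2 := by
    intro a
    rw [← norm_add_sq_real, ← norm_neg (a - c)]
    congr 2
    rw [hu]; abel
  simp_rw [e]
  have hs3 : Integrable (fun a => ‖x - a‖ ^ 2 + 2 * inner ℝ (x - a) u + ‖u‖ ^ 2) (post ν v x) :=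
    hs2.add (integrable_const _)
  rw [← ofReal_integral_eq_lintegral_ofReal hs3
    (ae_of_all _ fun a => by simp only [← e]; exact sq_nonneg _), integral_add hs2 (integrable_const _),
    integral_add hs (h2.const_mul 2), integral_const_mul, inner_postMean hv]
  refine ENNReal.ofReal_le_ofReal ?_
  have h3 := sq_nonneg (‖postMean ν v x + u‖)
  rw [norm_add_sq_real] at h3
  simp only [postVar, postSq, integral_const, probReal_univ, one_smul]
  linarith

/-- The mean square error of an affine estimator in an orthonormal basis. -/
theorem lintegral_affine_estimator (b : OrthonormalBasis (Fin d) ℝ (Vec d)) (c : Fin d → ℝ)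
    (η r : ℝ) (u : Vec d) :
    ∫⁻ w, ENNReal.ofReal (‖u + ∑ i, (c i * inner ℝ (-η • u + r • w) (b i)) • b i‖ ^ 2)
      ∂(stdGaussian (Vec d)) =
    ENNReal.ofReal (∑ i, ((1 - c i * η) ^ 2 * inner ℝ u (b i) ^ 2 + (c i * r) ^ 2)) := by
  have h : ∀ w : Vec d, ‖u + ∑ i, (c i * inner ℝ (-η • u + r • w) (b i)) • b i‖ ^ 2 =
      ∑ i, ((1 - c i * η) * inner ℝ u (b i) + (c i * r) * inner ℝ w (b i)) ^ 2 := by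
    intro w
    rw [← b.sum_sq_inner_left]
    refine Finset.sum_congr rfl fun j _ => ?_
    rw [inner_add_left, sum_inner, Finset.sum_eq_single j]
    · rw [real_inner_smul_left, real_inner_self_eq_norm_sq, b.orthonormal.1 j, inner_add_left,
        real_inner_smul_left, real_inner_smul_left]
      ring
    · intro i _ hij
      rw [real_inner_smul_left, b.orthonormal.2 hij, mul_zero]
    · simp
  simp_rw [h]
  rw [← ofReal_integral_eq_lintegral_ofReal
    (integrable_finsetSum _ fun i _ => integrable_add_mul_inner_sq _ _ _)
    (ae_of_all _ fun w => Finset.sum_nonneg fun i _ => sq_nonneg _),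
    integral_finsetSum _ fun i _ => integrable_add_mul_inner_sq _ _ _]
  simp_rw [integral_add_mul_inner_sq (b.orthonormal.1 _), mul_pow]

/-- Split the noise as a → y → x, with variances (1 - η)v and ηv, and fix x. The posterior mean
given y does at least as well as the affine estimator `f y`, whose error the bridge makes explicit
in the eigenbasis. Its gain over the posterior variance given x is `v * varianceDrop`. -/
theorem lintegral_postVar_add_le (hv : 0 < v) {η : ℝ} (hη : 0 < η) (hη' : η ≤ 1 / 2) (x : Vec d) :
    (∫⁻ y, ENNReal.ofReal (gaussDens (η * v) (x - y)) *
      (ENNReal.ofReal (mixDens ν ((1 - η) * v) y) *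
        ENNReal.ofReal (postVar ν ((1 - η) * v) y))) +
      ENNReal.ofReal (mixDens ν v x) * ENNReal.ofReal (v * varianceDrop ν v η x) ≤
      ENNReal.ofReal (mixDens ν v x) * ENNReal.ofReal (postVar ν v x) := by
  have h1η : 0 < 1 - η := by linarith
  have hv' : 0 < (1 - η) * v := by positivity
  have hβ : 0 < η * (1 - η) * v := by positivity
  have := isProbabilityMeasure_post (ν := ν) hv x
  obtain ⟨b, -, hl, hvar, hsum⟩ := postEig_spec (ν := ν) hv x
  set l := postEig ν v x with hldef
  set m := postMean ν v x with hm
  set c : Fin d → ℝ := fun i => l i / (1 - η + η * l i) with hc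
  have hden : ∀ i, 0 < 1 - η + η * l i := fun i => by have := hl i; positivity
  -- Best affine predictor of a from y given x: the conditional means of a and y are `x - m` and `x
  -- - η • m`, and `c i` is the regression coefficient along `b i`.
  set f : Vec d → Vec d := fun y => x - m + ∑ i, (c i * inner ℝ (y - x + η • m) (b i)) • b i with hf
  have hfc : Continuous f := by fun_prop
  have hmain : ∫⁻ y, ENNReal.ofReal (gaussDens (η * v) (x - y)) *
      (ENNReal.ofReal (mixDens ν ((1 - η) * v) y) * ENNReal.ofReal (postVar ν ((1 - η) * v) y)) ≤
      ENNReal.ofReal (mixDens ν v x) * ENNReal.ofReal (∑ i, v * l i * (1 - η) / (1 - η + η * l i)) := by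
    calc _ ≤ ∫⁻ y, ENNReal.ofReal (gaussDens (η * v) (x - y)) *
          ∫⁻ a, ENNReal.ofReal (gaussDens ((1 - η) * v) (y - a)) * ENNReal.ofReal (‖a - f y‖ ^ 2) ∂ν := by
          refine lintegral_mono fun y => ?_
          rw [← lintegral_post hv' y (by fun_prop)]
          gcongr
          exact ofReal_postVar_le hv' y (f y)
      _ = ∫⁻ y, ∫⁻ a, ENNReal.ofReal (gaussDens (η * v) (x - y)) *
          (ENNReal.ofReal (gaussDens ((1 - η) * v) (y - a)) * ENNReal.ofReal (‖a - f y‖ ^ 2)) ∂ν := by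
          refine lintegral_congr fun y => ?_
          rw [lintegral_const_mul _ (by fun_prop)]
      _ = ∫⁻ a, (∫⁻ y, ENNReal.ofReal (gaussDens (η * v) (x - y)) *
          (ENNReal.ofReal (gaussDens ((1 - η) * v) (y - a)) * ENNReal.ofReal (‖a - f y‖ ^ 2))) ∂ν := by
          rw [lintegral_lintegral_swap]
          exact Measurable.aemeasurable (by fun_prop)
      _ = ∫⁻ a, ENNReal.ofReal (gaussDens v (x - a)) * ENNReal.ofReal (∑ i, ((1 - c i * η) ^ 2 *
            inner ℝ (x - a - m) (b i) ^ 2 + (c i * √(η * (1 - η) * v)) ^ 2)) ∂ν := by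
          refine lintegral_congr fun a => ?_
          have e : ∀ y, ENNReal.ofReal (gaussDens (η * v) (x - y)) *
              (ENNReal.ofReal (gaussDens ((1 - η) * v) (y - a)) * ENNReal.ofReal (‖a - f y‖ ^ 2)) =
              ENNReal.ofReal (gaussDens v (x - a)) *
              (ENNReal.ofReal (gaussDens (η * (1 - η) * v) (y - (x - η • (x - a)))) *
                ENNReal.ofReal (‖a - f y‖ ^ 2)) := by
            intro y
            rw [← mul_assoc, ← mul_assoc, ← ENNReal.ofReal_mul (gaussDens_pos (by positivity) _).le,
              ← ENNReal.ofReal_mul (gaussDens_pos hv _).le,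
              gaussDens_mul_gaussDens hv hη (by linarith)]
          simp_rw [e]
          rw [lintegral_const_mul _ (by fun_prop), ← lintegral_stdGaussian_add_smul hβ _ (by fun_prop),
            ← lintegral_affine_estimator]
          congr 1
          refine lintegral_congr fun w => ?_
          congr 2
          rw [← norm_neg]
          congr 1
          simp only [hf]
          rw [show x - η • (x - a) + √(η * (1 - η) * v) • w - x + η • m =
            -η • (x - a - m) + √(η * (1 - η) * v) • w by module]
          abel
      _ = ENNReal.ofReal (mixDens ν v x) * ∫⁻ a, ENNReal.ofReal (∑ i, ((1 - c i * η) ^ 2 *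
            inner ℝ (x - a - m) (b i) ^ 2 + (c i * √(η * (1 - η) * v)) ^ 2)) ∂(post ν v x) :=
          (lintegral_post hv x (by fun_prop)).symm
      _ = _ := by
          congr 1
          have hi : ∀ i, Integrable (fun a => inner ℝ (x - a - m) (b i) ^ 2) (post ν v x) := by
            intro i
            refine integrable_post hv x (by fun_prop) (B := 2 * (1 + ‖m‖ ^ 2)) fun a => ?_
            have h1 : |inner ℝ (x - a - m) (b i)| ≤ ‖x - a‖ + ‖m‖ := by
              refine (abs_real_inner_le_norm _ _).trans ?_
              rw [b.orthonormal.1 i, mul_one]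
              exact norm_sub_le _ _
            rw [Real.norm_of_nonneg (sq_nonneg _), ← sq_abs]
            have h2 := pow_le_pow_left₀ (abs_nonneg _) h1 2
            nlinarith [sq_nonneg (‖x - a‖ - ‖m‖), sq_nonneg (‖x - a‖ * ‖m‖)]
          have hi2 : ∀ i, Integrable (fun a => (1 - c i * η) ^ 2 *
            inner ℝ (x - a - m) (b i) ^ 2 + (c i * √(η * (1 - η) * v)) ^ 2) (post ν v x) :=
            fun i => ((hi i).const_mul _).add (integrable_const _)
          rw [← ofReal_integral_eq_lintegral_ofReal (integrable_finsetSum _ fun i _ => hi2 i)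
            (ae_of_all _ fun a => Finset.sum_nonneg fun i _ => by positivity),
            integral_finsetSum _ fun i _ => hi2 i]
          congr 1
          refine Finset.sum_congr rfl fun i _ => ?_
          rw [integral_add ((hi i).const_mul _) (integrable_const _), integral_const_mul, ← hvar i,
            mul_pow, Real.sq_sqrt hβ.le]
          simp only [integral_const, probReal_univ, one_smul, hc]
          exact linear_estimator_error (hden i).ne'
  refine (add_le_add hmain le_rfl).trans (le_of_eq ?_)
  rw [← mul_add, ← ENNReal.ofReal_add (Finset.sum_nonneg fun i _ => by
    have := hl i; have := hden i; positivity)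
    (mul_nonneg hv.le (varianceDrop_nonneg hv hη hη' x))]
  congr 2
  rw [postVar, ← hsum, varianceDrop, ← hldef, Finset.mul_sum, Finset.mul_sum,
    ← Finset.sum_add_distrib]
  refine Finset.sum_congr rfl fun i _ => ?_
  exact linear_estimator_error_add (hden i).ne'

/-- Decrease of the minimum mean square error when the noise level decreases. -/
theorem mmse_add_le (hv : 0 < v) {η : ℝ} (hη : 0 < η) (hη' : η ≤ 1 / 2) :
    mmse ν ((1 - η) * v) +
      ENNReal.ofReal v * ∫⁻ x, ENNReal.ofReal (varianceDrop ν v η x) ∂(gaussMix ν v) ≤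
      mmse ν v := by
  have h1η : 0 < 1 - η := by linarith
  have hv' : 0 < (1 - η) * v := by positivity
  have hp := (continuous_mixDens (ν := ν) hv).measurable.ennreal_ofReal
  have hp' := (continuous_mixDens (ν := ν) hv').measurable.ennreal_ofReal
  have hvar := (measurable_postVar (ν := ν) hv').ennreal_ofReal
  have e1 : mmse ν ((1 - η) * v) = ∫⁻ x, ∫⁻ y, ENNReal.ofReal (gaussDens (η * v) (x - y)) *
      (ENNReal.ofReal (mixDens ν ((1 - η) * v) y) *
        ENNReal.ofReal (postVar ν ((1 - η) * v) y)) := by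
    rw [lintegral_lintegral_swap, mmse, gaussMix_eq_withDensity hv',
      lintegral_withDensity_eq_lintegral_mul _ hp' hvar]
    · refine lintegral_congr fun y => ?_
      rw [lintegral_mul_const _ (by fun_prop), lintegral_gaussDens_sub (by positivity), one_mul]
      rfl
    · exact Measurable.aemeasurable (Measurable.mul (by fun_prop)
        ((hp'.mul hvar).comp measurable_snd))
  have e2 : ENNReal.ofReal v * ∫⁻ x, ENNReal.ofReal (varianceDrop ν v η x) ∂(gaussMix ν v) =
      ∫⁻ x, ENNReal.ofReal (mixDens ν v x) * ENNReal.ofReal (v * varianceDrop ν v η x) := by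
    rw [← lintegral_const_mul' _ _ ENNReal.ofReal_ne_top, gaussMix_eq_withDensity hv,
      lintegral_withDensity_eq_lintegral_mul_non_measurable _ hp (by simp)]
    refine lintegral_congr fun x => ?_
    rw [Pi.mul_apply, ENNReal.ofReal_mul hv.le]
  have e3 : mmse ν v = ∫⁻ x, ENNReal.ofReal (mixDens ν v x) * ENNReal.ofReal (postVar ν v x) := by
    rw [mmse, gaussMix_eq_withDensity hv,
      lintegral_withDensity_eq_lintegral_mul _ hp (measurable_postVar hv).ennreal_ofReal]
    rfl
  rw [e1, e2, e3]
  -- Superadditivity of the lower integral again avoids measurability of `varianceDrop`.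
  exact (le_lintegral_add _ _).trans (lintegral_mono fun x => lintegral_postVar_add_le hv hη hη' x)

end MMSE

/-! ### Scaling -/

theorem gaussDens_smul {d : ℕ} {v c : ℝ} (hc : 0 < c) (hv : 0 < v) (u : Vec d) :
    gaussDens (c ^ 2 * v) (c • u) = (c ^ 2) ^ (-(d / 2) : ℝ) * gaussDens v u := by
  unfold gaussDens
  have hpi := Real.pi_pos
  rw [show 2 * Real.pi * (c ^ 2 * v) = c ^ 2 * (2 * Real.pi * v) by ring,
    Real.mul_rpow (by positivity) (by positivity), norm_smul, mul_pow, Real.norm_eq_abs, sq_abs,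
    mul_assoc]
  congr 3
  field_simp

theorem mixDens_map_smul {d : ℕ} (ν : Measure (Vec d)) {v c : ℝ} (hc : 0 < c) (hv : 0 < v) (x : Vec d) :
    mixDens (ν.map (c • ·)) (c ^ 2 * v) (c • x) = (c ^ 2) ^ (-(d / 2) : ℝ) * mixDens ν v x := by
  rw [mixDens, integral_map (by fun_prop) (Continuous.aestronglyMeasurable (by fun_prop)), mixDens,
    ← integral_const_mul]
  simp_rw [← smul_sub, gaussDens_smul hc hv]

section Scaling

variable {d : ℕ} {ν : Measure (Vec d)} {v : ℝ}

theorem post_map_smul {c : ℝ} (hc : 0 < c) (hv : 0 < v) (x : Vec d) :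
    post (ν.map (c • ·)) (c ^ 2 * v) (c • x) = (post ν v x).map (c • ·) := by
  refine Measure.ext_of_lintegral _ fun f hf => ?_
  have hκ : (0 : ℝ) < (c ^ 2) ^ (-(d / 2) : ℝ) := by positivity
  rw [lintegral_map hf (by fun_prop), post, post,
    lintegral_withDensity_eq_lintegral_mul _ (by fun_prop) hf,
    lintegral_withDensity_eq_lintegral_mul _ (by fun_prop) (by fun_prop),
    lintegral_map (Measurable.mul (by fun_prop) hf) (by fun_prop)]
  refine lintegral_congr fun a => ?_
  simp only [Pi.mul_apply]
  rw [← smul_sub, gaussDens_smul hc hv, mixDens_map_smul ν hc hv,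
    mul_div_mul_left _ _ hκ.ne']

theorem postVar_map_smul {c : ℝ} (hc : 0 < c) (hv : 0 < v) (x : Vec d) :
    postVar (ν.map (c • ·)) (c ^ 2 * v) (c • x) = c ^ 2 * postVar ν v x := by
  have h1 : postMean (ν.map (c • ·)) (c ^ 2 * v) (c • x) = c • postMean ν v x := by
    rw [postMean, post_map_smul hc hv, integral_map (by fun_prop)
      (Continuous.aestronglyMeasurable (by fun_prop)), postMean, ← integral_smul]
    simp_rw [← smul_sub]
  have h2 : postSq (ν.map (c • ·)) (c ^ 2 * v) (c • x) = c ^ 2 * postSq ν v x := by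
    rw [postSq, post_map_smul hc hv, integral_map (by fun_prop)
      (Continuous.aestronglyMeasurable (by fun_prop)), postSq, ← integral_const_mul]
    simp_rw [← smul_sub, norm_smul, mul_pow, Real.norm_eq_abs, sq_abs]
  rw [postVar, h1, h2, norm_smul, mul_pow, Real.norm_eq_abs, sq_abs, postVar, mul_sub]

variable [IsProbabilityMeasure ν]

theorem gaussMix_map_smul {c : ℝ} (hc : 0 ≤ c) :
    (gaussMix ν v).map (c • ·) = gaussMix (ν.map (c • ·)) (c ^ 2 * v) := by
  have : IsProbabilityMeasure (ν.map (c • ·)) := Measure.isProbabilityMeasure_map (by fun_prop)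
  refine Measure.ext_of_lintegral _ fun f hf => ?_
  rw [lintegral_map hf (by fun_prop), lintegral_gaussMix _ _ (by fun_prop),
    lintegral_gaussMix _ _ hf, lintegral_map (Measurable.lintegral_prod_right'
      (f := fun q : Vec d × Vec d => f (q.1 + √(c ^ 2 * v) • q.2)) (by fun_prop)) (by fun_prop)]
  simp_rw [Real.sqrt_mul (sq_nonneg c), Real.sqrt_sq hc, smul_add, smul_smul]

/-- The laws of consecutive signals differ by the factor √α; this identifies the error of step k + 1
at its reduced noise with that of step k. -/
theorem mmse_map_smul {c : ℝ} (hc : 0 < c) (hv : 0 < v) :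
    mmse (ν.map (c • ·)) (c ^ 2 * v) = ENNReal.ofReal (c ^ 2) * mmse ν v := by
  have : IsProbabilityMeasure (ν.map (c • ·)) := Measure.isProbabilityMeasure_map (by fun_prop)
  have h1 := (measurable_postVar (ν := ν.map (c • ·)) (v := c ^ 2 * v) (by positivity)).ennreal_ofReal
  have h2 := (measurable_postVar (ν := ν) hv).ennreal_ofReal
  rw [mmse, ← gaussMix_map_smul hc.le, lintegral_map h1 (by fun_prop), mmse,
    ← lintegral_const_mul _ h2]
  refine lintegral_congr fun x => ?_
  rw [postVar_map_smul hc hv, ENNReal.ofReal_mul (sq_nonneg c)]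

end Scaling

/-! ### The forward process -/

theorem stdGaussian_smul_conv {d : ℕ} (s t : ℝ) :
    ((stdGaussian (Vec d)).map (s • ·)) ∗ ((stdGaussian (Vec d)).map (t • ·)) =
      (stdGaussian (Vec d)).map (√(s ^ 2 + t ^ 2) • ·) := by
  have : IsProbabilityMeasure ((stdGaussian (Vec d)).map (s • ·)) :=
    Measure.isProbabilityMeasure_map (by fun_prop)
  have : IsProbabilityMeasure ((stdGaussian (Vec d)).map (t • ·)) :=
    Measure.isProbabilityMeasure_map (by fun_prop)
  have : IsProbabilityMeasure ((stdGaussian (Vec d)).map (√(s ^ 2 + t ^ 2) • ·)) :=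
    Measure.isProbabilityMeasure_map (by fun_prop)
  refine Measure.ext_of_charFun ?_
  ext u
  rw [charFun_conv, charFun_map_smul, charFun_map_smul, charFun_map_smul, charFun_stdGaussian,
    charFun_stdGaussian, charFun_stdGaussian, ← Complex.exp_add, norm_smul, norm_smul, norm_smul]
  congr 1
  simp only [← Complex.ofReal_pow, mul_pow, Real.norm_eq_abs, sq_abs]
  rw [Real.sq_sqrt (by positivity)]
  push_cast
  ring

theorem gaussMix_noise {d : ℕ} (ν : Measure (Vec d)) [IsProbabilityMeasure ν] {v a : ℝ}
    (hv : 0 ≤ v) (ha : 0 ≤ a) (ha' : a ≤ 1) :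
    ((gaussMix ν v).prod (stdGaussian (Vec d))).map (fun q => √a • q.1 + √(1 - a) • q.2) =
      gaussMix (ν.map (√a • ·)) (a * v + (1 - a)) := by
  have : IsProbabilityMeasure (ν.map (√a • ·)) := Measure.isProbabilityMeasure_map (by fun_prop)
  have : IsProbabilityMeasure ((stdGaussian (Vec d)).map ((√a * √v) • ·)) :=
    Measure.isProbabilityMeasure_map (by fun_prop)
  have : IsProbabilityMeasure ((stdGaussian (Vec d)).map (√(1 - a) • ·)) :=
    Measure.isProbabilityMeasure_map (by fun_prop)
  refine Measure.ext_of_lintegral _ fun f hf => ?_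
  rw [lintegral_map hf (by fun_prop), lintegral_prod _ (by fun_prop),
    lintegral_gaussMix _ _ (Measurable.lintegral_prod_right'
      (f := fun q : Vec d × Vec d => f (√a • q.1 + √(1 - a) • q.2)) (by fun_prop)),
    lintegral_gaussMix _ _ hf, lintegral_map (Measurable.lintegral_prod_right'
      (f := fun q : Vec d × Vec d => f (q.1 + √(a * v + (1 - a)) • q.2)) (by fun_prop)) (by fun_prop)]
  refine lintegral_congr fun x => ?_
  have h := stdGaussian_smul_conv (d := d) (√a * √v) (√(1 - a))
  rw [mul_pow, Real.sq_sqrt ha, Real.sq_sqrt hv, Real.sq_sqrt (by linarith)] at h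
  rw [← lintegral_map (f := fun y => f (√a • x + y)) (g := fun w => √(a * v + (1 - a)) • w)
    (by fun_prop) (by fun_prop), ← h, Measure.lintegral_conv (by fun_prop),
    lintegral_map (Measurable.lintegral_prod_right'
      (f := fun q : Vec d × Vec d => f (√a • x + (q.1 + q.2))) (by fun_prop)) (by fun_prop)]
  refine lintegral_congr fun w => ?_
  rw [lintegral_map (by fun_prop) (by fun_prop)]
  refine lintegral_congr fun w' => ?_
  rw [smul_add, smul_smul, add_assoc]

theorem forwardLaw_eq_gaussMix {d : ℕ} (p0 : Measure (Vec d)) [IsProbabilityMeasure p0]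
    {α abar : ℕ → ℝ} (h0 : abar 0 = 1) {K : ℕ} (hrec : ∀ k < K, abar (k + 1) = α (k + 1) * abar k)
    (hα : ∀ k < K, 0 ≤ α (k + 1) ∧ α (k + 1) ≤ 1) (habar : ∀ k ≤ K, 0 ≤ abar k ∧ abar k ≤ 1) :
    ∀ k ≤ K, forwardLaw α p0 k = gaussMix (p0.map (√(abar k) • ·)) (1 - abar k) := by
  intro k
  induction k with
  | zero =>
    intro _
    refine Measure.ext_of_lintegral _ fun f hf => ?_
    have : IsProbabilityMeasure (p0.map (√(abar 0) • ·)) :=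
      Measure.isProbabilityMeasure_map (by fun_prop)
    rw [lintegral_gaussMix _ _ hf, h0]
    simp [forwardLaw]
  | succ k ih =>
    intro hk
    have : IsProbabilityMeasure (p0.map (√(abar k) • ·)) :=
      Measure.isProbabilityMeasure_map (by fun_prop)
    have ha := hα k hk
    rw [forwardLaw, ih (by omega), gaussMix_noise _ (by linarith [habar k (by omega)]) ha.1 ha.2,
      Measure.map_map (by fun_prop) (by fun_prop), hrec k hk]
    congr 1
    · congr 1
      funext x
      simp [smul_smul, Real.sqrt_mul ha.1]
    · ring

/-! ### The initialization error -/

/-- For v ≤ 1 the normalizing constants compare favourably, so the shifted Gaussian density is at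
least the standard one times exp F ≥ 1 + F. Averaging F over the signal and x needs only second
moments; `κ` is the Young weight for the inner product. -/
theorem tvDist_gaussMix_stdGaussian_le {d : ℕ} (ν : Measure (Vec d)) [IsProbabilityMeasure ν]
    {v A κ : ℝ} (hv : 1 / 2 ≤ v) (hv' : v ≤ 1) (hκ : 0 < κ) (hA : 0 ≤ A)
    (h : ∫⁻ a, ‖a‖ₑ ^ 2 ∂ν ≤ ENNReal.ofReal A) :
    tvDist (gaussMix ν v) (stdGaussian (Vec d)) ≤
      ENNReal.ofReal (d * (1 - v + 1 / κ) + A * (1 + κ)) := by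
  have hv0 : 0 < v := by linarith
  have hpi := Real.pi_pos
  have hstd : stdGaussian (Vec d) = volume.withDensity fun u => ENNReal.ofReal (gaussDens 1 u) := by
    rw [← map_smul_stdGaussian one_pos]
    simp
  have h2 : Integrable (fun a : Vec d => ‖a‖ ^ 2) ν := by
    refine ⟨by fun_prop, ?_⟩
    rw [hasFiniteIntegral_iff_enorm]
    simpa using h.trans_lt ENNReal.ofReal_lt_top
  have h2A : ∫ a, ‖a‖ ^ 2 ∂ν ≤ A := by
    rw [integral_eq_lintegral_of_nonneg_ae (ae_of_all _ fun _ => sq_nonneg _) h2.1]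
    refine ENNReal.toReal_le_of_le_ofReal hA (le_trans (le_of_eq ?_) h)
    refine lintegral_congr fun a => ?_
    rw [ENNReal.ofReal_pow (norm_nonneg _), ofReal_norm]
  have hpt : ∀ x, gaussDens 1 x - mixDens ν v x ≤
      gaussDens 1 x * ((1 - v + 1 / κ) * ‖x‖ ^ 2 + A * (1 + κ)) := by
    intro x
    have hg := gaussDens_pos one_pos x
    set t := (1 - v + 1 / κ) * ‖x‖ ^ 2 with ht
    have hkey : ∀ a, gaussDens 1 x * (1 - (t + ‖a‖ ^ 2 * (1 + κ))) ≤ gaussDens v (x - a) := by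
      intro a
      set F := ‖x‖ ^ 2 / 2 - ‖x - a‖ ^ 2 / (2 * v) with hF
      have e1 : gaussDens 1 x * Real.exp F ≤ gaussDens v (x - a) := by
        unfold gaussDens
        rw [mul_assoc, ← Real.exp_add]
        refine mul_le_mul ?_ (Real.exp_le_exp.2 (le_of_eq ?_)) (Real.exp_pos _).le (by positivity)
        · refine Real.rpow_le_rpow_of_nonpos (by positivity) (by gcongr) ?_
          exact neg_nonpos.2 (by positivity)
        · rw [hF]; ring
      have e2 := Real.add_one_le_exp F
      have e3 : -F ≤ t + ‖a‖ ^ 2 * (1 + κ) := by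
        have hin : inner ℝ x a ≥ -(‖x‖ * ‖a‖) := neg_le_of_abs_le (abs_real_inner_le_norm x a)
        have hin2 : inner ℝ x a ≤ ‖x‖ * ‖a‖ := real_inner_le_norm x a
        have hF' : -F * (2 * v) = (1 - v) * ‖x‖ ^ 2 - 2 * inner ℝ x a + ‖a‖ ^ 2 := by
          rw [hF, norm_sub_sq_real]
          field_simp
          ring
        have hyoung : 2 * (‖x‖ * ‖a‖) ≤ 1 / κ * ‖x‖ ^ 2 + κ * ‖a‖ ^ 2 := by
          have : 1 / κ * ‖x‖ ^ 2 + κ * ‖a‖ ^ 2 - 2 * (‖x‖ * ‖a‖) =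
            1 / κ * (‖x‖ - κ * ‖a‖) ^ 2 := by field_simp; ring
          have h3 : 0 ≤ 1 / κ * (‖x‖ - κ * ‖a‖) ^ 2 := by positivity
          linarith
        have hR : 0 ≤ t + ‖a‖ ^ 2 * (1 + κ) := by
          have : 0 ≤ 1 - v := by linarith
          positivity
        have h4 : -F * (2 * v) ≤ t + ‖a‖ ^ 2 * (1 + κ) := by rw [hF', ht]; nlinarith
        by_contra hcon
        push Not at hcon
        nlinarith
      refine le_trans ?_ e1
      gcongr
      linarith
    have hi : Integrable (fun a : Vec d => gaussDens 1 x * (1 - (t + ‖a‖ ^ 2 * (1 + κ)))) ν :=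
      ((integrable_const _).sub ((integrable_const _).add (h2.mul_const _))).const_mul _
    have h5 := integral_mono hi (integrable_gaussDens_sub hv0 x) hkey
    have i1 : Integrable (fun a : Vec d => ‖a‖ ^ 2 * (1 + κ)) ν := h2.mul_const _
    have i2 : Integrable (fun a : Vec d => t + ‖a‖ ^ 2 * (1 + κ)) ν := (integrable_const _).add i1
    rw [integral_const_mul, integral_sub (integrable_const _) i2,
      integral_add (integrable_const _) i1,
      integral_mul_const (1 + κ) fun a : Vec d => ‖a‖ ^ 2] at h5
    simp only [integral_const, probReal_univ, one_smul] at h5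
    change _ ≤ mixDens ν v x at h5
    have h6 : gaussDens 1 x * ((∫ a, ‖a‖ ^ 2 ∂ν) * (1 + κ)) ≤ gaussDens 1 x * (A * (1 + κ)) := by
      gcongr
    nlinarith
  have i1 : IsProbabilityMeasure (volume.withDensity fun u : Vec d =>
      ENNReal.ofReal (gaussDens 1 u)) := by rw [← hstd]; infer_instance
  have i2 : IsProbabilityMeasure (volume.withDensity fun x => ENNReal.ofReal (mixDens ν v x)) := by
    rw [← gaussMix_eq_withDensity hv0]; infer_instance
  rw [tvDist_comm, gaussMix_eq_withDensity hv0]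
  nth_rw 1 [hstd]
  refine (tvDist_withDensity_le (continuous_mixDens hv0).measurable.ennreal_ofReal).trans ?_
  have hB : 0 ≤ 1 - v + 1 / κ := by
    have : 0 ≤ 1 - v := by linarith
    positivity
  calc _ ≤ ∫⁻ x, ENNReal.ofReal (gaussDens 1 x) *
        ENNReal.ofReal ((1 - v + 1 / κ) * ‖x‖ ^ 2 + A * (1 + κ)) := by
        refine lintegral_mono fun x => ?_
        rw [← ENNReal.ofReal_sub _ (mixDens_pos hv0 x).le,
          ← ENNReal.ofReal_mul (gaussDens_pos one_pos x).le]
        exact ENNReal.ofReal_le_ofReal (hpt x)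
    _ = ∫⁻ x, ENNReal.ofReal ((1 - v + 1 / κ) * ‖x‖ ^ 2 + A * (1 + κ)) ∂(stdGaussian (Vec d)) := by
        rw [hstd, lintegral_withDensity_eq_lintegral_mul _ (by fun_prop) (by fun_prop)]
        rfl
    _ = ∫⁻ x, (ENNReal.ofReal (1 - v + 1 / κ) * ENNReal.ofReal (‖x‖ ^ 2) +
          ENNReal.ofReal (A * (1 + κ))) ∂(stdGaussian (Vec d)) := by
        refine lintegral_congr fun x => ?_
        rw [ENNReal.ofReal_add (by positivity) (by positivity), ENNReal.ofReal_mul hB]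
    _ = _ := by
        rw [lintegral_add_right _ measurable_const, lintegral_const_mul _ (by fun_prop),
          lintegral_normSq_stdGaussian, lintegral_const, measure_univ, mul_one,
          ENNReal.ofReal_add (mul_nonneg (Nat.cast_nonneg d) hB) (by positivity),
          ENNReal.ofReal_mul (Nat.cast_nonneg d), ENNReal.ofReal_natCast, mul_comm (d : ℝ≥0∞)]

/-! ### The learning rates -/

section Schedule

variable {c₀ c₁ : ℝ} {K : ℕ}

theorem alphaBar_succ {k : ℕ} (hk : 1 ≤ k) : alphaBar c₀ c₁ K (k + 1) = alphaBar c₀ c₁ K k -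
    c₁ * Real.log K / K * alphaBar c₀ c₁ K k * (1 - alphaBar c₀ c₁ K k) := by
  obtain ⟨j, rfl⟩ : ∃ j, k = j + 1 := ⟨k - 1, by omega⟩
  rfl

theorem alphaBar_mem (hc₀ : 0 < c₀) (hK : 2 ≤ K) (hε : 0 < c₁ * Real.log K / K)
    (hε' : c₁ * Real.log K / K ≤ 1 / 4) {k : ℕ} (hk : 1 ≤ k) :
    0 < alphaBar c₀ c₁ K k ∧ alphaBar c₀ c₁ K k < 1 := by
  induction k, hk using Nat.le_induction with
  | base =>
    have h1 : (1 : ℝ) < K := by exact_mod_cast hK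
    have h2 : (1 : ℝ) < (K : ℝ) ^ c₀ := Real.one_lt_rpow h1 hc₀
    have h3 : 1 / (K : ℝ) ^ c₀ < 1 := (div_lt_one (by linarith)).2 h2
    have h4 : 0 < 1 / (K : ℝ) ^ c₀ := by positivity
    simp only [alphaBar]
    constructor <;> linarith
  | succ k hk ih =>
    rw [alphaBar_succ hk]
    set ε := c₁ * Real.log K / K
    set a := alphaBar c₀ c₁ K k
    have h1 : 0 < ε * a * (1 - a) := mul_pos (mul_pos hε ih.1) (by linarith)
    have h2 : ε * a * (1 - a) ≤ 1 / 4 * a * 1 := by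
      have := ih.1
      gcongr
      · linarith
      · linarith
    constructor <;> linarith [ih.1, ih.2]

theorem alpha_succ (hc₀ : 0 < c₀) (hK : 2 ≤ K) (hε : 0 < c₁ * Real.log K / K)
    (hε' : c₁ * Real.log K / K ≤ 1 / 4) {k : ℕ} (hk : 1 ≤ k) :
    alpha c₀ c₁ K (k + 1) = 1 - c₁ * Real.log K / K * (1 - alphaBar c₀ c₁ K k) := by
  have h := (alphaBar_mem hc₀ hK hε hε' hk).1
  rw [alpha, alphaBar_succ hk, Nat.add_sub_cancel]
  field_simp

theorem alphaBar_succ_eq_mul (hc₀ : 0 < c₀) (hK : 2 ≤ K) (hε : 0 < c₁ * Real.log K / K)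
    (hε' : c₁ * Real.log K / K ≤ 1 / 4) (k : ℕ) :
    alphaBar c₀ c₁ K (k + 1) = alpha c₀ c₁ K (k + 1) * alphaBar c₀ c₁ K k := by
  have h : alphaBar c₀ c₁ K k ≠ 0 := by
    rcases Nat.eq_zero_or_pos k with rfl | hk
    · simp [alphaBar]
    · exact (alphaBar_mem hc₀ hK hε hε' hk).1.ne'
  rw [alpha, Nat.add_sub_cancel, div_mul_cancel₀ _ h]

theorem alpha_mem (hc₀ : 0 < c₀) (hK : 2 ≤ K) (hε : 0 < c₁ * Real.log K / K)
    (hε' : c₁ * Real.log K / K ≤ 1 / 4) (k : ℕ) :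
    0 < alpha c₀ c₁ K (k + 1) ∧ alpha c₀ c₁ K (k + 1) ≤ 1 := by
  rcases Nat.eq_zero_or_pos k with rfl | hk
  · have := alphaBar_mem hc₀ hK hε hε' le_rfl
    simp only [alpha, zero_add, Nat.sub_self, show alphaBar c₀ c₁ K 0 = 1 from rfl, div_one]
    exact ⟨this.1, this.2.le⟩
  · have h := alphaBar_mem hc₀ hK hε hε' hk
    rw [alpha_succ hc₀ hK hε hε' hk]
    constructor <;> nlinarith

/-- The step size `(1 - α_{k+1}) / (1 - ᾱ_{k+1})` relative to the noise level. -/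
def relStep (c₀ c₁ : ℝ) (K k : ℕ) : ℝ :=
  c₁ * Real.log K / K / (1 + c₁ * Real.log K / K * alphaBar c₀ c₁ K k)

/-- All parts follow from 1 - ᾱ_{k+1} = (1 + εᾱ_k)(1 - ᾱ_k). The last identity says that shrinking
the noise of X_{k+1} by 1 - η gives that of √α_{k+1} X_k. -/
theorem relStep_facts (hc₀ : 0 < c₀) (hK : 2 ≤ K) (hε : 0 < c₁ * Real.log K / K)
    (hε' : c₁ * Real.log K / K ≤ 1 / 4) {k : ℕ} (hk : 1 ≤ k) :
    0 < relStep c₀ c₁ K k ∧ relStep c₀ c₁ K k ≤ c₁ * Real.log K / K ∧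
      c₁ * Real.log K / K / (1 + c₁ * Real.log K / K) ≤ relStep c₀ c₁ K k ∧
      relStep c₀ c₁ K k * (1 - alphaBar c₀ c₁ K (k + 1)) = 1 - alpha c₀ c₁ K (k + 1) ∧
      (1 - relStep c₀ c₁ K k) * (1 - alphaBar c₀ c₁ K (k + 1)) =
        alpha c₀ c₁ K (k + 1) * (1 - alphaBar c₀ c₁ K k) := by
  have h := alphaBar_mem hc₀ hK hε hε' hk
  rw [alpha_succ hc₀ hK hε hε' hk, alphaBar_succ hk, relStep]
  set ε := c₁ * Real.log K / K
  set a := alphaBar c₀ c₁ K k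
  have h1 : 0 < 1 + ε * a := by have := mul_pos hε h.1; linarith
  have h2 : 1 - (a - ε * a * (1 - a)) = (1 + ε * a) * (1 - a) := by ring
  refine ⟨by positivity, div_le_self hε.le (by linarith [mul_pos hε h.1]), ?_, ?_, ?_⟩
  · gcongr
    nlinarith
  · rw [h2]; field_simp; ring
  · rw [h2]; field_simp; ring

/-- The odds ᾱ/(1 - ᾱ) start below K^c₀ and shrink at each step by 1 - η ≤ 1/(1 + ε). Over K - 1 ≥
3K/4 steps, with log(1 + ε) ≥ 4ε/5, this gains K^(-3c₁/5), and c₀ ≤ c₁/5 leaves more than the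
exponent needed. -/
theorem alphaBar_last_le (hc₀ : 0 < c₀) (hc₁ : 5 * c₀ ≤ c₁) (hK : 4 ≤ K)
    (hε' : c₁ * Real.log K / K ≤ 1 / 4) :
    alphaBar c₀ c₁ K K ≤ (K : ℝ) ^ (-(c₁ / 4)) := by
  have hc₁0 : 0 < c₁ := by linarith
  have hK1 : (4 : ℝ) ≤ K := by exact_mod_cast hK
  have hL : 0 < Real.log K := Real.log_pos (by linarith)
  have hε : 0 < c₁ * Real.log K / K := by positivity
  set ε := c₁ * Real.log K / K with hεdef
  have hK2 : 2 ≤ K := by omega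
  have hrec : ∀ k, 1 ≤ k → alphaBar c₀ c₁ K k / (1 - alphaBar c₀ c₁ K k) ≤
      (K : ℝ) ^ c₀ * ((1 + ε)⁻¹) ^ (k - 1) := by
    intro k hk
    induction k, hk using Nat.le_induction with
    | base =>
      have h2 : (1 : ℝ) < (K : ℝ) ^ c₀ := Real.one_lt_rpow (by linarith) hc₀
      simp only [alphaBar, Nat.sub_self, pow_zero, mul_one, sub_sub_cancel]
      rw [div_div_eq_mul_div, div_one]
      refine mul_le_of_le_one_left (by linarith) ?_
      have : 0 < 1 / (K : ℝ) ^ c₀ := by positivity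
      linarith
    | succ k hk ih =>
      have h := alphaBar_mem hc₀ hK2 hε hε' hk
      have h' := alphaBar_mem hc₀ hK2 hε hε' (k := k + 1) (by omega)
      obtain ⟨e1, -, e3, -, e5⟩ := relStep_facts hc₀ hK2 hε hε' hk
      have hα := (alpha_mem hc₀ hK2 hε hε' k).1
      have e6 : alphaBar c₀ c₁ K (k + 1) / (1 - alphaBar c₀ c₁ K (k + 1)) =
          (1 - relStep c₀ c₁ K k) * (alphaBar c₀ c₁ K k / (1 - alphaBar c₀ c₁ K k)) := by
        have h1 : 0 < 1 - alphaBar c₀ c₁ K k := by linarith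
        have h2 : 0 < 1 - alphaBar c₀ c₁ K (k + 1) := by linarith
        have h3 := alphaBar_succ_eq_mul hc₀ hK2 hε hε' k
        rw [← mul_div_assoc, div_eq_div_iff h2.ne' h1.ne']
        linear_combination (1 - alphaBar c₀ c₁ K k) * h3 - alphaBar c₀ c₁ K k * e5
      have e7 : 1 - relStep c₀ c₁ K k ≤ (1 + ε)⁻¹ := by
        have : (1 + ε)⁻¹ = 1 - ε / (1 + ε) := by field_simp; ring
        linarith
      have e8 : 0 ≤ alphaBar c₀ c₁ K k / (1 - alphaBar c₀ c₁ K k) :=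
        div_nonneg h.1.le (by linarith)
      have e9 : (1 + ε)⁻¹ ^ (k + 1 - 1) = (1 + ε)⁻¹ * (1 + ε)⁻¹ ^ (k - 1) := by
        rw [← pow_succ']
        congr 1
        omega
      rw [e6, e9, mul_left_comm]
      exact mul_le_mul e7 ih e8 (by positivity)
  have h := alphaBar_mem hc₀ hK2 hε hε' (k := K) (by omega)
  have h1 : alphaBar c₀ c₁ K K ≤ alphaBar c₀ c₁ K K / (1 - alphaBar c₀ c₁ K K) := by
    rw [le_div_iff₀ (by linarith)]
    nlinarith
  refine h1.trans ((hrec K (by omega)).trans ?_)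
  have hlog : 3 / 5 * (c₁ * Real.log K) ≤ (K - 1 : ℕ) * Real.log (1 + ε) := by
    have e1 := Real.one_sub_inv_le_log_of_pos (x := 1 + ε) (by linarith)
    have e2 : 4 / 5 * ε ≤ 1 - (1 + ε)⁻¹ := by
      have : 1 - (1 + ε)⁻¹ = ε / (1 + ε) := by field_simp; ring
      rw [this, le_div_iff₀ (by linarith)]
      nlinarith
    have e3 : ((K - 1 : ℕ) : ℝ) = K - 1 := by
      rw [Nat.cast_sub (by omega)]; simp
    rw [e3]
    calc 3 / 5 * (c₁ * Real.log K) = (3 / 4 * K) * (4 / 5 * ε) := by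
          rw [hεdef]; field_simp
      _ ≤ (K - 1) * Real.log (1 + ε) := by
          refine mul_le_mul (by linarith) (e2.trans e1) (by positivity) (by linarith)
  have hpow : ((1 + ε)⁻¹) ^ (K - 1) ≤ (K : ℝ) ^ (-(3 / 5 * c₁)) := by
    rw [inv_pow, Real.rpow_neg (by linarith)]
    refine inv_anti₀ (by positivity) ?_
    rw [← Real.log_le_log_iff (by positivity) (by positivity), Real.log_rpow (by linarith),
      Real.log_pow]
    linarith
  calc (K : ℝ) ^ c₀ * ((1 + ε)⁻¹) ^ (K - 1) ≤ (K : ℝ) ^ c₀ * (K : ℝ) ^ (-(3 / 5 * c₁)) := by gcongr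
    _ = (K : ℝ) ^ (c₀ + -(3 / 5 * c₁)) := (Real.rpow_add (by linarith) _ _).symm
    _ ≤ (K : ℝ) ^ (-(c₁ / 4)) := Real.rpow_le_rpow_of_exponent_le (by linarith) (by linarith)

end Schedule

/-! ### Telescoping of the variance decrease -/

section Telescope

variable {c₀ c₁ : ℝ} {K d : ℕ}

/-- The law of `√ᾱ_k X_0`. -/
def signalLaw (c₀ c₁ : ℝ) (K : ℕ) (p0 : Measure (Vec d)) (k : ℕ) : Measure (Vec d) :=
  p0.map (√(alphaBar c₀ c₁ K k) • ·)

instance (p0 : Measure (Vec d)) [IsProbabilityMeasure p0] (k : ℕ) :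
    IsProbabilityMeasure (signalLaw c₀ c₁ K p0 k) :=
  Measure.isProbabilityMeasure_map (by fun_prop)

theorem signalLaw_succ (p0 : Measure (Vec d)) (hc₀ : 0 < c₀) (hK : 2 ≤ K)
    (hε : 0 < c₁ * Real.log K / K) (hε' : c₁ * Real.log K / K ≤ 1 / 4) (k : ℕ) :
    signalLaw c₀ c₁ K p0 (k + 1) =
      (signalLaw c₀ c₁ K p0 k).map (√(alpha c₀ c₁ K (k + 1)) • ·) := by
  rw [signalLaw, signalLaw, Measure.map_map (by fun_prop) (by fun_prop),
    alphaBar_succ_eq_mul hc₀ hK hε hε' k, Real.sqrt_mul (alpha_mem hc₀ hK hε hε' k).1.le]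
  congr 1
  funext x
  simp [smul_smul]

variable (p0 : Measure (Vec d)) [IsProbabilityMeasure p0]

theorem forwardLaw_eq (hc₀ : 0 < c₀) (hK : 2 ≤ K)
    (hε : 0 < c₁ * Real.log K / K) (hε' : c₁ * Real.log K / K ≤ 1 / 4) (k : ℕ) :
    forwardLaw (alpha c₀ c₁ K) p0 k =
      gaussMix (signalLaw c₀ c₁ K p0 k) (1 - alphaBar c₀ c₁ K k) := by
  refine forwardLaw_eq_gaussMix p0 rfl (K := k)
    (fun j _ => alphaBar_succ_eq_mul hc₀ hK hε hε' j)
    (fun j _ => ⟨(alpha_mem hc₀ hK hε hε' j).1.le, (alpha_mem hc₀ hK hε hε' j).2⟩)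
    (fun j _ => ?_) k le_rfl
  rcases Nat.eq_zero_or_pos j with rfl | hj
  · simp [alphaBar]
  · exact ⟨(alphaBar_mem hc₀ hK hε hε' hj).1.le, (alphaBar_mem hc₀ hK hε hε' hj).2.le⟩

/-- The expected decrease of variance in the step from `k + 1` to `k`. -/
def meanDrop (c₀ c₁ : ℝ) (K : ℕ) (p0 : Measure (Vec d)) [IsProbabilityMeasure p0] (k : ℕ) : ℝ≥0∞ :=
  ∫⁻ x, ENNReal.ofReal (varianceDrop (signalLaw c₀ c₁ K p0 (k + 1))
      (1 - alphaBar c₀ c₁ K (k + 1)) (relStep c₀ c₁ K k) x)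
    ∂(gaussMix (signalLaw c₀ c₁ K p0 (k + 1)) (1 - alphaBar c₀ c₁ K (k + 1)))

/-- The mean square error relative to the noise level. -/
def relMmse (c₀ c₁ : ℝ) (K : ℕ) (p0 : Measure (Vec d)) (k : ℕ) : ℝ :=
  (mmse (signalLaw c₀ c₁ K p0 k) (1 - alphaBar c₀ c₁ K k)).toReal / (1 - alphaBar c₀ c₁ K k)

theorem relMmse_le (hc₀ : 0 < c₀) (hK : 2 ≤ K) (hε : 0 < c₁ * Real.log K / K)
    (hε' : c₁ * Real.log K / K ≤ 1 / 4) {k : ℕ} (hk : 1 ≤ k) :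
    0 ≤ relMmse c₀ c₁ K p0 k ∧ relMmse c₀ c₁ K p0 k ≤ d := by
  have h := alphaBar_mem hc₀ hK hε hε' hk
  have hv : 0 < 1 - alphaBar c₀ c₁ K k := by linarith
  refine ⟨div_nonneg ENNReal.toReal_nonneg hv.le, ?_⟩
  rw [relMmse, div_le_iff₀ hv, mul_comm]
  exact ENNReal.toReal_le_of_le_ofReal (by positivity) (mmse_le hv)

/-- `mmse_add_le` divided by the noise level: after rescaling, its first term is (1 - η) times the
relative error at `k`, and the defect η times that error is at most εd. -/
theorem meanDrop_le (hc₀ : 0 < c₀) (hK : 2 ≤ K) (hε : 0 < c₁ * Real.log K / K)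
    (hε' : c₁ * Real.log K / K ≤ 1 / 4) {k : ℕ} (hk : 1 ≤ k) :
    meanDrop c₀ c₁ K p0 k ≠ ∞ ∧ (meanDrop c₀ c₁ K p0 k).toReal ≤
      relMmse c₀ c₁ K p0 (k + 1) - relMmse c₀ c₁ K p0 k + c₁ * Real.log K / K * d := by
  have h := alphaBar_mem hc₀ hK hε hε' hk
  have h' := alphaBar_mem hc₀ hK hε hε' (k := k + 1) (by omega)
  have hα := alpha_mem hc₀ hK hε hε' k
  obtain ⟨e1, e2, -, -, e5⟩ := relStep_facts hc₀ hK hε hε' hk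
  have hN := relMmse_le p0 hc₀ hK hε hε' hk
  set v := 1 - alphaBar c₀ c₁ K k with hv
  set v' := 1 - alphaBar c₀ c₁ K (k + 1) with hv'
  have hv0 : 0 < v := by linarith
  have hv0' : 0 < v' := by linarith
  have key := mmse_add_le (ν := signalLaw c₀ c₁ K p0 (k + 1)) hv0' e1 (by linarith)
  have hsc := mmse_map_smul (ν := signalLaw c₀ c₁ K p0 k) (v := v)
    (Real.sqrt_pos.2 hα.1) hv0
  rw [Real.sq_sqrt hα.1.le, ← signalLaw_succ p0 hc₀ hK hε hε'] at hsc
  rw [e5, hsc] at key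
  change _ + ENNReal.ofReal v' * meanDrop c₀ c₁ K p0 k ≤ _ at key
  have hfin : mmse (signalLaw c₀ c₁ K p0 k) v ≠ ∞ :=
    ((mmse_le hv0).trans_lt ENNReal.ofReal_lt_top).ne
  have hfin' : mmse (signalLaw c₀ c₁ K p0 (k + 1)) v' ≠ ∞ :=
    ((mmse_le hv0').trans_lt ENNReal.ofReal_lt_top).ne
  have hD : meanDrop c₀ c₁ K p0 k ≠ ∞ := by
    intro htop
    rw [htop, ENNReal.mul_top (by simpa using hv0'), add_top, top_le_iff] at key
    exact hfin' key
  refine ⟨hD, ?_⟩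
  have hreal := ENNReal.toReal_mono hfin' key
  rw [ENNReal.toReal_add (ENNReal.mul_ne_top ENNReal.ofReal_ne_top hfin)
    (ENNReal.mul_ne_top ENNReal.ofReal_ne_top hD), ENNReal.toReal_mul, ENNReal.toReal_mul,
    ENNReal.toReal_ofReal hα.1.le, ENNReal.toReal_ofReal hv0'.le] at hreal
  have r1 : (mmse (signalLaw c₀ c₁ K p0 k) v).toReal = v * relMmse c₀ c₁ K p0 k := by
    rw [relMmse, ← hv]; field_simp
  have r2 : (mmse (signalLaw c₀ c₁ K p0 (k + 1)) v').toReal = v' * relMmse c₀ c₁ K p0 (k + 1) := by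
    rw [relMmse, ← hv']; field_simp
  rw [r1, r2, ← mul_assoc, ← e5, mul_comm (1 - relStep c₀ c₁ K k), mul_assoc, ← mul_add] at hreal
  have h3 := le_of_mul_le_mul_left hreal hv0'
  have h4 : relStep c₀ c₁ K k * relMmse c₀ c₁ K p0 k ≤ c₁ * Real.log K / K * d :=
    mul_le_mul e2 hN.2 hN.1 hε.le
  linarith

theorem sum_meanDrop_le (hc₀ : 0 < c₀) (hK : 2 ≤ K) (hε : 0 < c₁ * Real.log K / K)
    (hε' : c₁ * Real.log K / K ≤ 1 / 4) :
    ∑ k ∈ Finset.Ico 1 K, meanDrop c₀ c₁ K p0 k ≤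
      ENNReal.ofReal (d + K * (c₁ * Real.log K / K * d)) := by
  have h1 : ∀ k ∈ Finset.Ico 1 K, meanDrop c₀ c₁ K p0 k ≠ ∞ := fun k hk =>
    (meanDrop_le p0 hc₀ hK hε hε' (Finset.mem_Ico.1 hk).1).1
  rw [ENNReal.le_ofReal_iff_toReal_le (ENNReal.sum_ne_top.2 h1) (by positivity),
    ENNReal.toReal_sum h1]
  calc _ ≤ ∑ k ∈ Finset.Ico 1 K, ((relMmse c₀ c₁ K p0 (k + 1) - relMmse c₀ c₁ K p0 k) +
        c₁ * Real.log K / K * d) := Finset.sum_le_sum fun k hk =>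
          (meanDrop_le p0 hc₀ hK hε hε' (Finset.mem_Ico.1 hk).1).2
    _ = relMmse c₀ c₁ K p0 K - relMmse c₀ c₁ K p0 1 + (K - 1 : ℕ) * (c₁ * Real.log K / K * d) := by
        rw [Finset.sum_add_distrib, Finset.sum_Ico_sub _ (by omega), Finset.sum_const, Nat.card_Ico,
          nsmul_eq_mul]
    _ ≤ _ := by
        have e1 := (relMmse_le p0 hc₀ hK hε hε' (k := K) (by omega)).2
        have e2 := (relMmse_le p0 hc₀ hK hε hε' (k := 1) le_rfl).1
        have e3 : ((K - 1 : ℕ) : ℝ) ≤ K := by exact_mod_cast Nat.sub_le K 1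
        have e4 : ((K - 1 : ℕ) : ℝ) * (c₁ * Real.log K / K * d) ≤ K * (c₁ * Real.log K / K * d) := by
          gcongr
        linarith

end Telescope

/-! ### Error of the sampler for a given score estimator -/

section Sampler

variable {c₀ c₁ c₂ : ℝ} {K d : ℕ} (p0 : Measure (Vec d)) [IsProbabilityMeasure p0]

theorem measurable_step (α : ℕ → ℝ) {s : ℕ → Vec d → Vec d} {k : ℕ} (hs : Measurable (s k)) :
    Measurable (step α s k) := by
  unfold step
  fun_prop

/-- Both laws are images under division by √α: the step applies it after x ↦ x + (ηv/2) s(x), and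
X_k is the mixture with noise (1 - η)v so rescaled. Then η ≤ ε removes the dependence of the
coefficients on `k`. -/
theorem tvDist_sampler_step_le (hc₀ : 0 < c₀) (hK : 2 ≤ K) (hε : 0 < c₁ * Real.log K / K)
    (hε' : c₁ * Real.log K / K ≤ 1 / 4) {k : ℕ} (hk : 1 ≤ k) {θ : ℝ} (hθ : 0 < θ)
    {s : ℕ → Vec d → Vec d}
    (hs : JacobianAddPSD (s (k + 1)) (1 - alphaBar c₀ c₁ K (k + 1))⁻¹) :
    tvDist (forwardLaw (alpha c₀ c₁ K) p0 k)
      ((forwardLaw (alpha c₀ c₁ K) p0 (k + 1)).map (step (alpha c₀ c₁ K) s (k + 1))) ≤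
      ENNReal.ofReal (c₁ * Real.log K / K / 2) * meanDrop c₀ c₁ K p0 k +
      (ENNReal.ofReal (3 / 2 * d * (c₁ * Real.log K / K) ^ 2 +
        d * (c₁ * Real.log K / K) / (2 * θ)) +
      (ENNReal.ofReal (c₁ * Real.log K / K * θ / 2 + (c₁ * Real.log K / K) ^ 2 / 4) *
        (ENNReal.ofReal (1 - alphaBar c₀ c₁ K (k + 1)) *
          ∫⁻ x, ‖s (k + 1) x - score (forwardLaw (alpha c₀ c₁ K) p0 (k + 1)) x‖ₑ ^ 2
            ∂(forwardLaw (alpha c₀ c₁ K) p0 (k + 1))) +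
      ENNReal.ofReal (d * (c₁ * Real.log K / K)) *
        (ENNReal.ofReal (1 - alphaBar c₀ c₁ K (k + 1)) *
          ∫⁻ x, ‖fderiv ℝ (s (k + 1)) x -
              fderiv ℝ (score (forwardLaw (alpha c₀ c₁ K) p0 (k + 1))) x‖ₑ
            ∂(forwardLaw (alpha c₀ c₁ K) p0 (k + 1))))) := by
  have h' := alphaBar_mem hc₀ hK hε hε' (k := k + 1) (by omega)
  have hα := alpha_mem hc₀ hK hε hε' k
  obtain ⟨e1, e2, -, e4, e5⟩ := relStep_facts hc₀ hK hε hε' hk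
  set ε := c₁ * Real.log K / K
  set η := relStep c₀ c₁ K k with hη
  set α := alpha c₀ c₁ K (k + 1) with hαdef
  set v := 1 - alphaBar c₀ c₁ K (k + 1) with hv
  have hv0 : 0 < v := by linarith
  have hsqrt : √α ≠ 0 := (Real.sqrt_pos.2 hα.1).ne'
  have hlaw : forwardLaw (alpha c₀ c₁ K) p0 k =
      (gaussMix (signalLaw c₀ c₁ K p0 (k + 1)) ((1 - η) * v)).map ((1 / √α) • ·) := by
    have h1 := gaussMix_map_smul (ν := signalLaw c₀ c₁ K p0 k) (v := 1 - alphaBar c₀ c₁ K k)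
      (Real.sqrt_nonneg α)
    rw [Real.sq_sqrt hα.1.le, ← signalLaw_succ p0 hc₀ hK hε hε', ← e5] at h1
    rw [← h1, forwardLaw_eq p0 hc₀ hK hε hε', Measure.map_map (by fun_prop) (by fun_prop)]
    have : ((fun x : Vec d => (1 / √α) • x) ∘ fun x => √α • x) = id := by
      funext x
      simp [smul_smul, hsqrt]
    rw [this, Measure.map_id]
  have hstep : step (alpha c₀ c₁ K) s (k + 1) =
      (fun x : Vec d => (1 / √α) • x) ∘ fun x => x + (η * v / 2) • s (k + 1) x := by
    funext x
    simp only [step, Function.comp_apply]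
    rw [e4]
  have hsm := hs.1.continuous.measurable
  have hTm : Measurable fun x => x + (η * v / 2) • s (k + 1) x := by fun_prop
  rw [hlaw, forwardLaw_eq p0 hc₀ hK hε hε' (k + 1), hstep, ← Measure.map_map (by fun_prop) hTm]
  refine (tvDist_map_le (by fun_prop)).trans ?_
  refine (tvDist_step_le (ν := signalLaw c₀ c₁ K p0 (k + 1)) hv0 e1 (by linarith) hθ hs).trans ?_
  have hd : (0 : ℝ) ≤ d := Nat.cast_nonneg d
  refine add_le_add ?_ (add_le_add ?_ (add_le_add ?_ ?_))
  · exact mul_le_mul (ENNReal.ofReal_le_ofReal (by linarith)) le_rfl zero_le zero_le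
  · refine ENNReal.ofReal_le_ofReal ?_
    gcongr
  · rw [← mul_assoc, ← ENNReal.ofReal_mul (by positivity)]
    gcongr
  · rw [← mul_assoc (ENNReal.ofReal (d * ε)), ← ENNReal.ofReal_mul (by positivity)]
    refine mul_le_mul (ENNReal.ofReal_le_ofReal ?_) le_rfl zero_le zero_le
    have h1 : (d : ℝ) * (η * v) ≤ d * (ε * v) := by gcongr
    have h2 : 0 ≤ (d : ℝ) * (η * v) := by positivity
    nlinarith

theorem isProbabilityMeasure_samplerLawAux {α : ℕ → ℝ} {s : ℕ → Vec d → Vec d} {j : ℕ}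
    (hs : ∀ i < j, Measurable (step α s (K - i))) :
    IsProbabilityMeasure (samplerLawAux α s K j) := by
  induction j with
  | zero => exact inferInstanceAs (IsProbabilityMeasure (stdGaussian (Vec d)))
  | succ j ih =>
    have := ih fun i hi => hs i (by omega)
    exact Measure.isProbabilityMeasure_map (hs j (by omega)).aemeasurable

/-- Insert the image of the true law under one sampler step: one part is the fresh error of that
step, the other is controlled by data processing and induction. -/
theorem tvDist_samplerLawAux_le (α : ℕ → ℝ) (s : ℕ → Vec d → Vec d) (μ : ℕ → Measure (Vec d))
    {j : ℕ} (hj : j ≤ K) (hs : ∀ i < j, Measurable (step α s (K - i))) :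
    tvDist (μ (K - j)) (samplerLawAux α s K j) ≤ tvDist (μ K) (stdGaussian (Vec d)) +
      ∑ k ∈ Finset.Ico (K - j) K, tvDist (μ k) ((μ (k + 1)).map (step α s (k + 1))) := by
  induction j with
  | zero => simp [samplerLawAux]
  | succ j ih =>
    have h1 : K - (j + 1) + 1 = K - j := by omega
    have hm := hs j (by omega)
    rw [Finset.sum_eq_sum_Ico_succ_bot (by omega : K - (j + 1) < K), h1]
    refine (tvDist_triangle _ ((μ (K - j)).map (step α s (K - j))) _).trans ?_
    rw [← add_assoc, add_comm (tvDist (μ K) _), add_assoc]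
    refine add_le_add le_rfl ?_
    exact (tvDist_map_le hm).trans (ih (by omega) fun i hi => hs i (by omega))

theorem tvDist_forwardLaw_stdGaussian_le (hd : 1 ≤ d) (hc₀ : 0 < c₀) (hc₂ : 0 < c₂)
    (hc₁ : 5 * c₀ ≤ c₁) (hc : 1 ≤ c₁ / 8 - c₂ / 2) (hK : 4 ≤ K)
    (hε' : c₁ * Real.log K / K ≤ 1 / 4)
    (h2 : ∫⁻ x, ‖x‖ₑ ^ 2 ∂p0 ≤ ENNReal.ofReal ((K : ℝ) ^ c₂)) :
    tvDist (forwardLaw (alpha c₀ c₁ K) p0 K) (stdGaussian (Vec d)) ≤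
      ENNReal.ofReal (4 * d / K) := by
  have hc₁0 : 0 < c₁ := by linarith
  have hK1 : (4 : ℝ) ≤ K := by exact_mod_cast hK
  have hd1 : (1 : ℝ) ≤ d := by exact_mod_cast hd
  have hL : 0 < Real.log K := Real.log_pos (by linarith)
  have hε : 0 < c₁ * Real.log K / K := by positivity
  have hlast := alphaBar_last_le hc₀ hc₁ hK hε'
  have hmem := alphaBar_mem hc₀ (by omega : 2 ≤ K) hε hε' (k := K) (by omega)
  set a := alphaBar c₀ c₁ K K with ha
  have hsq : (K : ℝ) ^ (-(2 : ℝ)) = 1 / (K : ℝ) ^ 2 := by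
    rw [Real.rpow_neg (by linarith), one_div]
    norm_cast
  -- The exponent satisfies -c₁/4 + c₂ ≤ -2, twice the hypothesis `hc`.
  have hm : a * (K : ℝ) ^ c₂ ≤ 1 / (K : ℝ) ^ 2 := by
    calc a * (K : ℝ) ^ c₂ ≤ (K : ℝ) ^ (-(c₁ / 4)) * (K : ℝ) ^ c₂ := by gcongr
      _ = (K : ℝ) ^ (-(c₁ / 4) + c₂) := (Real.rpow_add (by linarith) _ _).symm
      _ ≤ (K : ℝ) ^ (-(2 : ℝ)) :=
          Real.rpow_le_rpow_of_exponent_le (by linarith) (by linarith)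
      _ = _ := hsq
  have ha2 : a ≤ 1 / (K : ℝ) ^ 2 := by
    refine le_trans (le_mul_of_one_le_right hmem.1.le ?_) hm
    exact Real.one_le_rpow (by linarith) hc₂.le
  have hsq4 : 1 / (K : ℝ) ^ 2 ≤ 1 / 16 := by
    gcongr
    nlinarith
  have hsqK : 1 / (K : ℝ) ^ 2 ≤ 1 / K := by
    gcongr
    nlinarith
  have hmom : ∫⁻ x, ‖x‖ₑ ^ 2 ∂(signalLaw c₀ c₁ K p0 K) ≤ ENNReal.ofReal (a * (K : ℝ) ^ c₂) := by
    rw [signalLaw, lintegral_map (by fun_prop) (by fun_prop)]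
    have e : ∀ x : Vec d, ‖√a • x‖ₑ ^ 2 = ENNReal.ofReal a * ‖x‖ₑ ^ 2 := by
      intro x
      rw [enorm_smul, mul_pow, Real.enorm_eq_ofReal (Real.sqrt_nonneg a),
        ← ENNReal.ofReal_pow (Real.sqrt_nonneg a), Real.sq_sqrt hmem.1.le]
    simp_rw [← ha, e]
    rw [lintegral_const_mul _ (by fun_prop), ENNReal.ofReal_mul hmem.1.le]
    gcongr
  rw [forwardLaw_eq p0 hc₀ (by omega) hε hε', ← ha]
  -- With κ = K both d/κ and K^(-2)(1 + κ) are of order at most d/K.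
  refine (tvDist_gaussMix_stdGaussian_le (signalLaw c₀ c₁ K p0 K) (v := 1 - a)
    (κ := K) (by linarith) (by linarith [hmem.1]) (by linarith)
    (mul_nonneg hmem.1.le (by positivity)) hmom).trans (ENNReal.ofReal_le_ofReal ?_)
  have h3 : a * (K : ℝ) ^ c₂ * (1 + K) ≤ 2 / K := by
    calc a * (K : ℝ) ^ c₂ * (1 + K) ≤ 1 / (K : ℝ) ^ 2 * (2 * K) := by
          gcongr
          linarith
      _ = 2 / K := by field_simp
  have h4 : (d : ℝ) * (1 - (1 - a) + 1 / K) ≤ d * (2 / K) := by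
    gcongr
    have : (2 : ℝ) / K = 1 / K + 1 / K := by ring
    linarith
  have h5 : (2 : ℝ) / K ≤ d * (2 / K) := le_mul_of_one_le_left (by positivity) hd1
  calc _ ≤ (d : ℝ) * (2 / K) + d * (2 / K) := by linarith
    _ = 4 * d / K := by ring

theorem tvDist_samplerLaw_le (hd : 1 ≤ d) (hc₀ : 0 < c₀) (hc₂ : 0 < c₂) (hc₁ : 5 * c₀ ≤ c₁)
    (hc : 1 ≤ c₁ / 8 - c₂ / 2) (hK : 4 ≤ K) (hε' : c₁ * Real.log K / K ≤ 1 / 4)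
    (h2 : ∫⁻ x, ‖x‖ₑ ^ 2 ∂p0 ≤ ENNReal.ofReal ((K : ℝ) ^ c₂)) {θ : ℝ} (hθ : 0 < θ)
    {s : ℕ → Vec d → Vec d}
    (hs : ∀ k ∈ Finset.Icc 1 K, JacobianAddPSD (s k) (1 - alphaBar c₀ c₁ K k)⁻¹) :
    tvDist (forwardLaw (alpha c₀ c₁ K) p0 1) (samplerLaw (alpha c₀ c₁ K) s K 1) ≤
      ENNReal.ofReal (4 * d / K + c₁ * Real.log K / K / 2 * (d + K * (c₁ * Real.log K / K * d)) +
        K * (3 / 2 * d * (c₁ * Real.log K / K) ^ 2 + d * (c₁ * Real.log K / K) / (2 * θ))) +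
      (ENNReal.ofReal (c₁ * Real.log K / K * θ / 2 + (c₁ * Real.log K / K) ^ 2 / 4) *
        ∑ k ∈ Finset.Icc 1 K, (ENNReal.ofReal (1 - alphaBar c₀ c₁ K k) *
          ∫⁻ x, ‖s k x - score (forwardLaw (alpha c₀ c₁ K) p0 k) x‖ₑ ^ 2
            ∂(forwardLaw (alpha c₀ c₁ K) p0 k)) +
      ENNReal.ofReal (d * (c₁ * Real.log K / K)) *
        ∑ k ∈ Finset.Icc 1 K, (ENNReal.ofReal (1 - alphaBar c₀ c₁ K k) *
          ∫⁻ x, ‖fderiv ℝ (s k) x - fderiv ℝ (score (forwardLaw (alpha c₀ c₁ K) p0 k)) x‖ₑ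
            ∂(forwardLaw (alpha c₀ c₁ K) p0 k))) := by
  have hc₁0 : 0 < c₁ := by linarith
  have hK1 : (4 : ℝ) ≤ K := by exact_mod_cast hK
  have hL : 0 < Real.log K := Real.log_pos (by linarith)
  have hε : 0 < c₁ * Real.log K / K := by positivity
  have hK2 : 2 ≤ K := by omega
  set ε := c₁ * Real.log K / K with hεdef
  set A : ℕ → ℝ≥0∞ := fun k => ENNReal.ofReal (1 - alphaBar c₀ c₁ K k) *
          ∫⁻ x, ‖s k x - score (forwardLaw (alpha c₀ c₁ K) p0 k) x‖ₑ ^ 2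
            ∂(forwardLaw (alpha c₀ c₁ K) p0 k) with hA
  set B : ℕ → ℝ≥0∞ := fun k => ENNReal.ofReal (1 - alphaBar c₀ c₁ K k) *
          ∫⁻ x, ‖fderiv ℝ (s k) x - fderiv ℝ (score (forwardLaw (alpha c₀ c₁ K) p0 k)) x‖ₑ
            ∂(forwardLaw (alpha c₀ c₁ K) p0 k) with hB
  -- The steps use the estimators of index 2 to K; the term of index 1 is only added.
  have hreindex : ∀ F : ℕ → ℝ≥0∞, ∑ k ∈ Finset.Ico 1 K, F (k + 1) ≤ ∑ k ∈ Finset.Icc 1 K, F k := by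
    intro F
    rw [Finset.sum_Ico_add' F 1 K 1]
    refine Finset.sum_le_sum_of_subset fun k hk => ?_
    simp only [Finset.mem_Ico, Finset.mem_Icc] at hk ⊢
    omega
  have hmeas : ∀ i < K - 1, Measurable (step (alpha c₀ c₁ K) s (K - i)) := by
    intro i hi
    exact measurable_step _ (hs (K - i) (Finset.mem_Icc.2 (by omega))).1.continuous.measurable
  have htel := tvDist_samplerLawAux_le (K := K) (alpha c₀ c₁ K) s (forwardLaw (alpha c₀ c₁ K) p0)
    (j := K - 1) (by omega) hmeas
  rw [show K - (K - 1) = 1 by omega] at htel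
  have hterm := tvDist_forwardLaw_stdGaussian_le p0 hd hc₀ hc₂ hc₁ hc hK hε' h2
  have hsum : ∑ k ∈ Finset.Ico 1 K, tvDist (forwardLaw (alpha c₀ c₁ K) p0 k)
      ((forwardLaw (alpha c₀ c₁ K) p0 (k + 1)).map (step (alpha c₀ c₁ K) s (k + 1))) ≤
      ENNReal.ofReal (ε / 2 * (d + K * (ε * d))) +
      (ENNReal.ofReal (K * (3 / 2 * d * ε ^ 2 + d * ε / (2 * θ))) +
      (ENNReal.ofReal (ε * θ / 2 + ε ^ 2 / 4) * ∑ k ∈ Finset.Icc 1 K, A k +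
        ENNReal.ofReal (d * ε) * ∑ k ∈ Finset.Icc 1 K, B k)) := by
    refine (Finset.sum_le_sum fun k hk => tvDist_sampler_step_le p0 hc₀ hK2 hε hε'
      (Finset.mem_Ico.1 hk).1 hθ (hs (k + 1) (Finset.mem_Icc.2 ⟨by omega, by
        have := (Finset.mem_Ico.1 hk).2; omega⟩))).trans ?_
    rw [Finset.sum_add_distrib, Finset.sum_add_distrib, Finset.sum_add_distrib, ← Finset.mul_sum,
      ← Finset.mul_sum, ← Finset.mul_sum]
    refine add_le_add ?_ (add_le_add ?_ (add_le_add ?_ ?_))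
    · rw [ENNReal.ofReal_mul (by positivity)]
      gcongr
      exact sum_meanDrop_le p0 hc₀ hK2 hε hε'
    · rw [Finset.sum_const, Nat.card_Ico, nsmul_eq_mul, ENNReal.ofReal_mul (by positivity),
        ENNReal.ofReal_natCast]
      gcongr
      omega
    · gcongr
      exact hreindex A
    · gcongr
      exact hreindex B
  refine htel.trans ((add_le_add hterm hsum).trans (le_of_eq ?_))
  have e : ∀ x y z : ℝ, 0 ≤ x → 0 ≤ y → 0 ≤ z → ENNReal.ofReal (x + y + z) =
      ENNReal.ofReal x + (ENNReal.ofReal y + ENNReal.ofReal z) := by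
    intro x y z hx hy hz
    rw [ENNReal.ofReal_add (by positivity) hz, ENNReal.ofReal_add hx hy, add_assoc]
  rw [e _ _ _ (by positivity) (by positivity) (by positivity)]
  simp only [add_assoc]

end Sampler

/-! ### Measurability of the Jacobian in the training data -/

/-- The derivative is the almost everywhere limit of difference quotients of step 1/n along an
orthonormal basis, and these are jointly measurable in the data and the point. -/
theorem aemeasurable_fderiv_prod {T : Type*} [MeasurableSpace T] {d : ℕ} {P : Measure T} [SFinite P]
    {μ : Measure (Vec d)} [SFinite μ] {s : T → Vec d → Vec d}
    (hs : Measurable fun q : T × Vec d => s q.1 q.2) (hdiff : ∀ᵐ D ∂P, Differentiable ℝ (s D)) :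
    AEMeasurable (fun q : T × Vec d => fderiv ℝ (s q.1) q.2) (P.prod μ) := by
  let b := stdOrthonormalBasis ℝ (Vec d)
  let f : ℕ → T × Vec d → Vec d →L[ℝ] Vec d := fun n q =>
    ∑ i, (innerSL ℝ (b i)).smulRight
      ((n : ℝ) • (s q.1 (q.2 + (n : ℝ)⁻¹ • b i) - s q.1 q.2))
  refine aemeasurable_of_tendsto_metrizable_ae Filter.atTop (f := f) (fun n => ?_) ?_
  · refine (Finset.measurable_sum _ fun i _ => ?_).aemeasurable
    have h1 : Measurable fun q : T × Vec d => s q.1 (q.2 + (n : ℝ)⁻¹ • b i) :=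
      hs.comp (by fun_prop : Measurable fun q : T × Vec d => (q.1, q.2 + (n : ℝ)⁻¹ • b i))
    have h2 : Continuous fun u : Vec d => (innerSL ℝ (b i)).smulRight u := by
      have : (fun u : Vec d => (innerSL ℝ (b i)).smulRight u) = fun u =>
          ContinuousLinearMap.smulRightL ℝ (Vec d) (Vec d) (innerSL ℝ (b i)) u := by
        ext; simp
      rw [this]
      fun_prop
    have h3 : Measurable fun q : T × Vec d =>
        (n : ℝ) • (s q.1 (q.2 + (n : ℝ)⁻¹ • b i) - s q.1 q.2) := by fun_prop
    exact h2.measurable.comp h3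
  · filter_upwards [Measure.quasiMeasurePreserving_fst.ae hdiff] with q hq
    have hlim : fderiv ℝ (s q.1) q.2 =
        ∑ i, (innerSL ℝ (b i)).smulRight (fderiv ℝ (s q.1) q.2 (b i)) := by
      ext1 w
      conv_lhs => rw [← b.sum_repr' w, map_sum]
      rw [sum_apply]
      refine Finset.sum_congr rfl fun i _ => ?_
      rw [map_smul]
      rfl
    rw [hlim]
    refine tendsto_finsetSum _ fun i _ => ?_
    have h2 : Continuous fun u : Vec d => (innerSL ℝ (b i)).smulRight u := by
      have : (fun u : Vec d => (innerSL ℝ (b i)).smulRight u) = fun u =>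
          ContinuousLinearMap.smulRightL ℝ (Vec d) (Vec d) (innerSL ℝ (b i)) u := by
        ext; simp
      rw [this]
      fun_prop
    refine (h2.tendsto _).comp ((hq q.2).hasFDerivAt.lim (b i) ?_)
    simpa using tendsto_natCast_atTop_atTop (R := ℝ)

/-! ### Averaging over the training data -/

section Average

variable {c₀ c₁ c₂ : ℝ} {K d : ℕ} {T : Type*} [MeasurableSpace T]

instance {pstar : Measure (Vec d)} [IsProbabilityMeasure pstar] (τ : ℝ) :
    IsProbabilityMeasure (smoothed pstar τ) := by
  have : IsProbabilityMeasure ((stdGaussian (Vec d)).map fun w => √τ • w) :=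
    Measure.isProbabilityMeasure_map (by fun_prop)
  unfold smoothed
  infer_instance

theorem lintegral_tvDist_samplerLaw_le (P : Measure T) [IsProbabilityMeasure P]
    (p0 : Measure (Vec d)) [IsProbabilityMeasure p0] (hd : 1 ≤ d) (hc₀ : 0 < c₀) (hc₂ : 0 < c₂)
    (hc₁ : 5 * c₀ ≤ c₁) (hc : 1 ≤ c₁ / 8 - c₂ / 2) (hK : 4 ≤ K)
    (hε' : c₁ * Real.log K / K ≤ 1 / 4)
    (h2 : ∫⁻ x, ‖x‖ₑ ^ 2 ∂p0 ≤ ENNReal.ofReal ((K : ℝ) ^ c₂)) {θ : ℝ} (hθ : 0 < θ)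
    {s : T → ℕ → Vec d → Vec d}
    (hsm : ∀ k ∈ Finset.Icc 1 K, Measurable fun q : T × Vec d => s q.1 k q.2)
    (hs : ∀ᵐ D ∂P, ∀ k ∈ Finset.Icc 1 K, JacobianAddPSD (s D k) (1 - alphaBar c₀ c₁ K k)⁻¹) :
    ∫⁻ D, tvDist (forwardLaw (alpha c₀ c₁ K) p0 1) (samplerLaw (alpha c₀ c₁ K) (s D) K 1) ∂P ≤
      ENNReal.ofReal (4 * d / K + c₁ * Real.log K / K / 2 * (d + K * (c₁ * Real.log K / K * d)) +
        K * (3 / 2 * d * (c₁ * Real.log K / K) ^ 2 + d * (c₁ * Real.log K / K) / (2 * θ))) +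
      (ENNReal.ofReal (c₁ * Real.log K / K * θ / 2 + (c₁ * Real.log K / K) ^ 2 / 4) *
        ∑ k ∈ Finset.Icc 1 K, (ENNReal.ofReal (1 - alphaBar c₀ c₁ K k) *
          scoreErrSq P (forwardLaw (alpha c₀ c₁ K) p0 k) (fun D => s D k)) +
      ENNReal.ofReal (d * (c₁ * Real.log K / K)) *
        ∑ k ∈ Finset.Icc 1 K, (ENNReal.ofReal (1 - alphaBar c₀ c₁ K k) *
          jacErr P (forwardLaw (alpha c₀ c₁ K) p0 k) (fun D => s D k))) := by
  have hc₁0 : 0 < c₁ := by linarith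
  have hK1 : (4 : ℝ) ≤ K := by exact_mod_cast hK
  have hL : 0 < Real.log K := Real.log_pos (by linarith)
  have hε : 0 < c₁ * Real.log K / K := by positivity
  have hK2 : 2 ≤ K := by omega
  have hlaw := forwardLaw_eq p0 hc₀ hK2 hε hε'
  have hprob : ∀ k, IsProbabilityMeasure (forwardLaw (alpha c₀ c₁ K) p0 k) := fun k => by
    rw [hlaw]; infer_instance
  have hv : ∀ k ∈ Finset.Icc 1 K, 0 < 1 - alphaBar c₀ c₁ K k := fun k hk => by
    linarith [(alphaBar_mem hc₀ hK2 hε hε' (Finset.mem_Icc.1 hk).1).2]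
  have hscore : ∀ k ∈ Finset.Icc 1 K, Measurable (score (forwardLaw (alpha c₀ c₁ K) p0 k)) := by
    intro k hk
    rw [hlaw, score_gaussMix (hv k hk)]
    have hm := (continuous_postMean (ν := signalLaw c₀ c₁ K p0 k) (hv k hk)).measurable
    fun_prop
  have hA : ∀ k ∈ Finset.Icc 1 K, Measurable fun D =>
      ∫⁻ x, ‖s D k x - score (forwardLaw (alpha c₀ c₁ K) p0 k) x‖ₑ ^ 2
        ∂(forwardLaw (alpha c₀ c₁ K) p0 k) := fun k hk =>
    (((hsm k hk).sub ((hscore k hk).comp measurable_snd)).enorm.pow_const 2).lintegral_prod_right'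
  have hB : ∀ k ∈ Finset.Icc 1 K, AEMeasurable (fun D =>
      ∫⁻ x, ‖fderiv ℝ (s D k) x - fderiv ℝ (score (forwardLaw (alpha c₀ c₁ K) p0 k)) x‖ₑ
        ∂(forwardLaw (alpha c₀ c₁ K) p0 k)) P := fun k hk => by
    have h1 := aemeasurable_fderiv_prod (P := P) (μ := forwardLaw (alpha c₀ c₁ K) p0 k) (hsm k hk)
      (hs.mono fun D hD => (hD k hk).1)
    have h3 : Measurable fun q : T × Vec d =>
        fderiv ℝ (score (forwardLaw (alpha c₀ c₁ K) p0 k)) q.2 :=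
      (measurable_fderiv ℝ _).comp measurable_snd
    exact (h1.sub h3.aemeasurable).enorm.lintegral_prod_right'
  -- Monotonicity needs no measurability of the distance in `D`; only the error terms are integrated
  -- exactly.
  refine (lintegral_mono_ae (hs.mono fun D hD => tvDist_samplerLaw_le p0 hd hc₀ hc₂ hc₁ hc hK hε'
    h2 hθ hD)).trans (le_of_eq ?_)
  have hA' := Finset.measurable_sum (Finset.Icc 1 K) fun k hk =>
    (hA k hk).const_mul (ENNReal.ofReal (1 - alphaBar c₀ c₁ K k))
  rw [lintegral_add_left measurable_const, lintegral_const, measure_univ, mul_one,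
    lintegral_add_left (hA'.const_mul _), lintegral_const_mul _ hA',
    lintegral_const_mul'' _ (Finset.aemeasurable_fun_sum _ fun k hk => (hB k hk).const_mul _),
    lintegral_finsetSum _ fun k hk => (hA k hk).const_mul _,
    lintegral_finsetSum' _ fun k hk => (hB k hk).const_mul _]
  refine congrArg₂ _ rfl (congrArg₂ _ (congrArg _ ?_) (congrArg _ ?_))
  · refine Finset.sum_congr rfl fun k hk => ?_
    rw [lintegral_const_mul _ (hA k hk), scoreErrSq]
  · refine Finset.sum_congr rfl fun k hk => ?_
    rw [lintegral_const_mul'' _ (hB k hk), jacErr]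

theorem natCast_mul_epsSc_sq {P : Measure T} {abar : ℕ → ℝ} {μ : ℕ → Measure (Vec d)}
    {s : T → ℕ → Vec d → Vec d} (hK : K ≠ 0) :
    ∑ k ∈ Finset.Icc 1 K, ENNReal.ofReal (1 - abar k) * scoreErrSq P (μ k) (fun D => s D k) =
      K * epsSc P abar K μ s ^ 2 := by
  rw [epsSc, ← ENNReal.rpow_natCast, ← ENNReal.rpow_mul]
  norm_num
  rw [← mul_assoc, ENNReal.mul_inv_cancel (by exact_mod_cast hK) (ENNReal.natCast_ne_top K),
    one_mul]

theorem natCast_mul_epsJcb {P : Measure T} {abar : ℕ → ℝ} {μ : ℕ → Measure (Vec d)}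
    {s : T → ℕ → Vec d → Vec d} (hK : K ≠ 0) :
    ∑ k ∈ Finset.Icc 1 K, ENNReal.ofReal (1 - abar k) * jacErr P (μ k) (fun D => s D k) =
      K * epsJcb P abar K μ s := by
  rw [epsJcb, ← mul_assoc, ENNReal.mul_inv_cancel (by exact_mod_cast hK)
    (ENNReal.natCast_ne_top K), one_mul]

theorem lintegral_tvDist_samplerLaw_le_one (P : Measure T) [IsProbabilityMeasure P]
    {α : ℕ → ℝ} {μ : Measure (Vec d)} [IsProbabilityMeasure μ] {s : T → ℕ → Vec d → Vec d}
    (hsm : ∀ k ∈ Finset.Icc 1 K, Measurable fun q : T × Vec d => s q.1 k q.2) :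
    ∫⁻ D, tvDist μ (samplerLaw α (s D) K 1) ∂P ≤ 1 := by
  calc ∫⁻ D, tvDist μ (samplerLaw α (s D) K 1) ∂P ≤ ∫⁻ _, 1 ∂P := lintegral_mono fun D => by
        have : IsProbabilityMeasure (samplerLaw α (s D) K 1) :=
          isProbabilityMeasure_samplerLawAux fun i hi => measurable_step α
            ((hsm (K - i) (Finset.mem_Icc.2 (by omega))).comp measurable_prodMk_left)
        exact tvDist_le_one _ _
    _ = 1 := by simp

end Average

/-! ### Balancing the error terms -/

theorem ofReal_add_mul_eq {x y z e : ℝ} {K : ℕ} {J : ℝ≥0∞} (hx : 0 ≤ x) (hy : 0 ≤ y) (hz : 0 ≤ z)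
    (he : 0 ≤ e) :
    ENNReal.ofReal x + (ENNReal.ofReal y * (K * ENNReal.ofReal e ^ 2) +
      ENNReal.ofReal z * (K * J)) =
      ENNReal.ofReal (x + y * (K * e ^ 2)) + ENNReal.ofReal (z * K) * J := by
  rw [ENNReal.ofReal_add hx (by positivity), ENNReal.ofReal_mul hy,
    ENNReal.ofReal_mul (Nat.cast_nonneg K), ENNReal.ofReal_mul hz, ENNReal.ofReal_pow he,
    ENNReal.ofReal_natCast, add_assoc, mul_assoc (ENNReal.ofReal z)]

theorem half_le_sqrt {L : ℝ} (hL : 1 / 2 ≤ L) : 1 / 2 ≤ √L :=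
  Real.le_sqrt_of_sq_le (by linarith)

theorem rpow_three_halves {L : ℝ} (hL : 0 < L) : L ^ (3 / 2 : ℝ) = L * √L := by
  rw [Real.sqrt_eq_rpow, ← Real.rpow_one_add' hL.le (by norm_num)]
  norm_num

/-- The weight θ = √d/(e + 1/K) makes each half of Young's inequality at most cL√d e/2, up to
cLd/(2K); the 1/K keeps θ finite at e = 0. Raising powers of L by L ≥ 1/2 explains the constants,
for instance 64 = 4 · 16 and 9 = 4 · 9/4. -/
theorem error_terms_le {d K L c e : ℝ} (hd : 1 ≤ d) (hK : 0 < K) (hL : 1 / 2 ≤ L) (hc : 0 < c)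
    (he : 0 ≤ e) (he' : e ≤ 1) :
    4 * d / K + c * L / K / 2 * (d + K * (c * L / K * d)) +
        K * (3 / 2 * d * (c * L / K) ^ 2 + d * (c * L / K) / (2 * (√d / (e + 1 / K)))) +
      (c * L / K * (√d / (e + 1 / K)) / 2 + (c * L / K) ^ 2 / 4) * (K * e ^ 2) ≤
    (64 + 12 * c + 9 * c ^ 2) * (d * L ^ 4 / K + e * (√d * L ^ (3 / 2 : ℝ))) := by
  have hd0 : 0 < √d := Real.sqrt_pos.2 (by linarith)
  have hdd : √d * √d = d := Real.mul_self_sqrt (by linarith)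
  have hd1 : √d ≤ d := by
    have : 1 ≤ √d := Real.one_le_sqrt.2 hd
    nlinarith
  have hL0 : 0 < L := by linarith
  obtain ⟨κ, hκ, rfl⟩ : ∃ κ, 0 < κ ∧ K = κ⁻¹ := ⟨K⁻¹, by positivity, by simp⟩
  have hex : 0 < e + κ := by positivity
  have h1 : d / √d = √d := by
    rw [div_eq_iff hd0.ne', hdd]
  have hlhs : 4 * d / κ⁻¹ + c * L / κ⁻¹ / 2 * (d + κ⁻¹ * (c * L / κ⁻¹ * d)) +
        κ⁻¹ * (3 / 2 * d * (c * L / κ⁻¹) ^ 2 + d * (c * L / κ⁻¹) / (2 * (√d / (e + 1 / κ⁻¹)))) +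
      (c * L / κ⁻¹ * (√d / (e + 1 / κ⁻¹)) / 2 + (c * L / κ⁻¹) ^ 2 / 4) * (κ⁻¹ * e ^ 2) =
      κ * d * (4 + c * L / 2 + c ^ 2 * L ^ 2 / 2 + 3 / 2 * (c ^ 2 * L ^ 2)) +
        c * L * ((d / √d) * (e + κ)) / 2 + c * L * √d * (e ^ 2 / (e + κ)) / 2 +
        c ^ 2 * L ^ 2 * (κ * e ^ 2) / 4 := by
    field_simp
    ring
  have h2 : e ^ 2 / (e + κ) ≤ e := by
    rw [div_le_iff₀ hex]
    nlinarith [mul_nonneg he hκ.le]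
  have h3 : κ * e ^ 2 ≤ κ * d := by
    gcongr
    nlinarith
  have h4 : c * L * √d * (e ^ 2 / (e + κ)) ≤ c * L * √d * e := by gcongr
  have h5 : c ^ 2 * L ^ 2 * (κ * e ^ 2) ≤ c ^ 2 * L ^ 2 * (κ * d) := by gcongr
  have h6 : c * L * (√d * κ) ≤ c * L * (d * κ) := by gcongr
  have h7 : L * (√d * e) ≤ 2 * (L * √L) * (√d * e) := by
    gcongr
    nlinarith [half_le_sqrt hL]
  have h7' : c * L * √d * e ≤ 2 * c * (e * (√d * (L * √L))) := by
    linarith [mul_le_mul_of_nonneg_left h7 hc.le]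
  have hL2 : 1 ≤ 4 * L ^ 2 := by nlinarith
  have hL4 : L ^ 2 ≤ 4 * L ^ 4 := by nlinarith [mul_nonneg (sq_nonneg L) (sub_nonneg.2 hL2)]
  have hL3 : (1 / 2) ^ 3 ≤ L ^ 3 := by gcongr
  have hL1 : L ≤ 8 * L ^ 4 := by linarith [mul_le_mul_of_nonneg_left hL3 hL0.le]
  have h8 : κ * d * (4 + c * L + 9 / 4 * (c ^ 2 * L ^ 2)) ≤
      κ * d * (64 * L ^ 4 + 8 * c * L ^ 4 + 9 * c ^ 2 * L ^ 4) := by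
    gcongr ?_ * ?_
    have a1 : c * L ≤ c * (8 * L ^ 4) := by gcongr
    have a2 : c ^ 2 * L ^ 2 ≤ c ^ 2 * (4 * L ^ 4) := by gcongr
    linarith
  have hx : 0 ≤ κ * d * L ^ 4 := by positivity
  have hy : 0 ≤ e * (√d * (L * √L)) := by positivity
  have h9 : 0 ≤ c * (κ * d * L ^ 4) := by positivity
  have h10 : 0 ≤ c * (e * (√d * (L * √L))) := by positivity
  have h11 : 0 ≤ c ^ 2 * (e * (√d * (L * √L))) := by positivity
  rw [hlhs, h1, rpow_three_halves hL0, div_inv_eq_mul]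
  linarith

end ProbFlow
end

open ProbFlow

/-! ### The final bound -/

theorem theorem2 (c₀ c₁ c₂ : ℝ) (hc₀ : 0 < c₀) (hc₂ : 0 < c₂) (hc₁ : 5 * c₀ ≤ c₁)
    (hc : 1 ≤ c₁ / 8 - c₂ / 2) :
    -- the implied constants depend on `c₀, c₁, c₂` only
    ∃ C₀ C : ℝ, 0 < C₀ ∧ 0 < C ∧
      ∀ (d K n : ℕ), 1 ≤ d → 2 ≤ K →
      C₀ * (d : ℝ) ^ 2 * Real.log K ^ 5 ≤ K →
      ∀ (pstar : Measure (Vec d)) [IsProbabilityMeasure pstar] (τ : ℝ), 0 ≤ τ →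
      ∫⁻ x, ‖x‖ₑ ^ 2 ∂(smoothed pstar τ) ≤ ENNReal.ofReal ((K : ℝ) ^ c₂) →
      -- the score estimator `s D k` of `X_k` is built from the training data `D`
      ∀ s : (Fin n → Vec d) → ℕ → Vec d → Vec d,
      (∀ k ∈ Finset.Icc 1 K, Measurable (fun q : (Fin n → Vec d) × Vec d => s q.1 k q.2)) →
      (∀ᵐ D ∂(Measure.pi fun _ : Fin n => pstar), ∀ k ∈ Finset.Icc 1 K,
        JacobianAddPSD (s D k) (1 - alphaBar c₀ c₁ K k)⁻¹) →
      ∫⁻ D, tvDist (forwardLaw (alpha c₀ c₁ K) (smoothed pstar τ) 1)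
            (samplerLaw (alpha c₀ c₁ K) (s D) K 1) ∂(Measure.pi fun _ : Fin n => pstar) ≤
        ENNReal.ofReal C *
          (ENNReal.ofReal (d * Real.log K ^ 4 / K) +
            epsSc (Measure.pi fun _ : Fin n => pstar) (alphaBar c₀ c₁ K) K
                (forwardLaw (alpha c₀ c₁ K) (smoothed pstar τ)) s *
              ENNReal.ofReal (√d * Real.log K ^ (3 / 2 : ℝ)) +
            epsJcb (Measure.pi fun _ : Fin n => pstar) (alphaBar c₀ c₁ K) K
                (forwardLaw (alpha c₀ c₁ K) (smoothed pstar τ)) s *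
              ENNReal.ofReal (d * Real.log K)) := by
  have hc₁8 : 8 ≤ c₁ := by linarith
  have hc₁0 : 0 < c₁ := by linarith
  -- As log K ≥ 1/2 and 100/2⁴ ≥ 6, the size condition gives K ≥ 6c₁ log K, hence ε ≤ 1/4 and, with
  -- c₁ ≥ 8, K ≥ 4.
  refine ⟨100 * c₁, 64 + 12 * c₁ + 9 * c₁ ^ 2, by positivity, by positivity, ?_⟩
  intro d K n hd hK hKd pstar _ τ _ h2 s hsm hs
  have hd1 : (1 : ℝ) ≤ d := by exact_mod_cast hd
  have hK2 : (2 : ℝ) ≤ K := by exact_mod_cast hK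
  have hL : 1 / 2 ≤ Real.log K := by
    have := Real.log_le_log (by norm_num) hK2
    linarith [Real.log_two_gt_d9]
  set L := Real.log K with hLdef
  have hL0 : 0 < L := by linarith
  have hL4 : (1 / 2) ^ 4 ≤ L ^ 4 := by gcongr
  have hKL : 6 * (c₁ * L) ≤ K := by
    calc 6 * (c₁ * L) ≤ 100 * c₁ * (1 : ℝ) ^ 2 * (L * (1 / 2) ^ 4) := by
          nlinarith [mul_pos hc₁0 hL0]
      _ ≤ 100 * c₁ * (d : ℝ) ^ 2 * (L * L ^ 4) := by gcongr
      _ = 100 * c₁ * (d : ℝ) ^ 2 * L ^ 5 := by ring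
      _ ≤ K := hKd
  have hK4 : 4 ≤ K := by
    have : (4 : ℝ) ≤ K := by nlinarith
    exact_mod_cast this
  have hε' : c₁ * L / K ≤ 1 / 4 := by
    rw [div_le_iff₀ (by linarith)]
    nlinarith [mul_pos hc₁0 hL0]
  have hε : 0 < c₁ * L / K := by positivity
  set P := Measure.pi fun _ : Fin n => pstar
  set E := epsSc P (alphaBar c₀ c₁ K) K (forwardLaw (alpha c₀ c₁ K) (smoothed pstar τ)) s with hE
  set J := epsJcb P (alphaBar c₀ c₁ K) K (forwardLaw (alpha c₀ c₁ K) (smoothed pstar τ)) s with hJ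
  -- If ε_sc ≥ 1 the right side is at least 64 · (1/4) · (1/16) = 1, which bounds any total
  -- variation distance. Otherwise ε_sc is finite, and ε_sc² ≤ 1 lets its second-order contribution
  -- be absorbed in the d/K term.
  rcases le_total 1 E with h1 | h1
  · have : IsProbabilityMeasure (forwardLaw (alpha c₀ c₁ K) (smoothed pstar τ) 1) := by
      rw [forwardLaw_eq _ hc₀ hK hε hε']
      infer_instance
    refine (lintegral_tvDist_samplerLaw_le_one P hsm).trans ?_
    have hs1 : 1 ≤ √(d : ℝ) := Real.one_le_sqrt.2 hd1
    have hLL : 1 / 4 ≤ L ^ (3 / 2 : ℝ) := by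
      rw [rpow_three_halves hL0]
      nlinarith [half_le_sqrt hL]
    calc (1 : ℝ≥0∞) = ENNReal.ofReal 64 * (1 * ENNReal.ofReal (1 * (1 / 4))) *
          ENNReal.ofReal (1 / 16) := by
          rw [one_mul, ← ENNReal.ofReal_mul (by norm_num), ← ENNReal.ofReal_mul (by norm_num)]
          norm_num
      _ ≤ ENNReal.ofReal (64 + 12 * c₁ + 9 * c₁ ^ 2) *
          (E * ENNReal.ofReal (√d * L ^ (3 / 2 : ℝ))) * 1 := by
          gcongr
          · nlinarith
          · rw [← ENNReal.ofReal_one]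
            exact ENNReal.ofReal_le_ofReal (by norm_num)
      _ ≤ _ := by
          rw [mul_one]
          gcongr
          exact le_add_right le_add_self
  · have hEtop : E ≠ ∞ := ne_top_of_le_ne_top ENNReal.one_ne_top h1
    set e := E.toReal with he
    have he0 : 0 ≤ e := ENNReal.toReal_nonneg
    have he1 : e ≤ 1 := ENNReal.toReal_le_of_le_ofReal zero_le_one (by simpa using h1)
    have hEe : E = ENNReal.ofReal e := (ENNReal.ofReal_toReal hEtop).symm
    have hθ : 0 < √(d : ℝ) / (e + 1 / K) := by positivity
    refine (lintegral_tvDist_samplerLaw_le P (smoothed pstar τ) hd hc₀ hc₂ hc₁ hc hK4 hε' h2 hθ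
      hsm hs).trans ?_
    rw [natCast_mul_epsSc_sq (by omega), natCast_mul_epsJcb (by omega), ← hE, ← hJ, ← hLdef,
      hEe, ofReal_add_mul_eq (by positivity) (by positivity) (by positivity) he0,
      ← ENNReal.ofReal_mul he0, ← ENNReal.ofReal_add (by positivity) (by positivity),
      mul_add (ENNReal.ofReal (64 + 12 * c₁ + 9 * c₁ ^ 2)),
      ← ENNReal.ofReal_mul (by positivity)]
    refine add_le_add (ENNReal.ofReal_le_ofReal
      (error_terms_le hd1 (by linarith) hL hc₁0 he0 he1)) ?_
    rw [mul_comm J, ← mul_assoc, ← ENNReal.ofReal_mul (by positivity)]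
    have h3 : d * (c₁ * L / K) * K = c₁ * (d * L) := by field_simp
    have h4 : c₁ ≤ 64 + 12 * c₁ + 9 * c₁ ^ 2 := by nlinarith
    rw [h3]
    gcongr
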